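/- **Conventions.** A parameterized problem is a set $L\subseteq\Sigma^*\times\mathbb N$, $\Sigma$ a finite alphabet. An fpt-reduction from $L$ to $L'$ ($L\le_{\mathrm{fpt}}L'$) is a map $R:(I,k)\mapsto(I',k')$ with $(I,k)\in L\Leftrightarrow(I',k')\in L'$, with $k'\le g(k)$ for some computable $g$, and computable in time $O(f(k)\,|I|^c)$ for some computable $f$ and constant $c$. The closure $[S]^{\mathrm{fpt}}$ of a set $S$ of problems consists of all problems that are fpt-reducible to a problem in $S$; a problem is complete for a class if it lies in the class and every problem of the class is fpt-reducible to it. $\Gamma_{t,u}$ is the class of Boolean circuits (gates $\wedge$, $\vee$ of arbitrary fan-in, $\neg$; one output) of depth at most $u$ in which every path to the output contains at most $t$ gates of fan-in greater than $2$. An $r$-CNF ($r$-DNF) formula is a conjunction of disjunctions (disjunction of conjunctions) of at most $r$ literals each. For a class $\mathcal C$ of circuits over two disjoint sets $X,Y$ of variables: * $\exists^*\forall^k\text{-WSat}(\mathcal C)$: given $C\in\mathcal C$ and the parameter $k\in\mathbb N$, is there an assignment $\alpha$ to $X$ such that for all assignments $\beta$ to $Y$ with exactly $k$ variables set to true, $\alpha\cup\beta$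 satisfies $C$? * $\forall^*\exists^k\text{-WSat}(\mathcal C)$: given $C\in\mathcal C$ and the parameter $k\in\mathbb N$, is there for every assignment $\alpha$ to $X$ an assignment $\beta$ to $Y$ with exactly $k$ variables set to true such that $\alpha\cup\beta$ satisfies $C$? Let $\exists^*\forall^k\text{-}\mathrm W[1]=[\{\exists^*\forall^k\text{-WSat}(\Gamma_{1,u}) : u\ge1\}]^{\mathrm{fpt}}$, and let $\forall^*\exists^k\text{-}\mathrm W[1]$ be the class of the complements of the problems in $\exists^*\forall^k\text{-}\mathrm W[1]$. **Theorem.** 1. For every $u\ge1$, $\forall^*\exists^k\text{-WSat}(\Gamma_{1,u})\le_{\mathrm{fpt}}\forall^*\exists^k\text{-WSat}(s\text{-CNF})$, where $s=2^u+1$. 2. $\forall^*\exists^k\text{-WSat}(2\text{-CNF})$ is $\forall^*\exists^k\text{-}\mathrm W[1]$-complete. 3. For every fixed integer $r\ge2$, $\exists^*\forall^k\text{-WSat}(r\text{-DNF})$ is $\exists^*\forall^k\text{-}\mathrm W[1]$-complete. -/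

import Mathlib

namespace ParamComplexity

/-! ### Computation with a running time

Programs act on finite binary trees.  Every primitive operation is charged the full size of the
tree it acts on (and every duplication of a tree the size of the copy), so a computation of cost `t`
only ever handles trees of size at most `t`, and this model and multi-tape Turing machines simulate
each other with polynomial overhead. -/

/-- Finite binary trees, the data of the programs. -/
inductive Data : Type
  | nil : Data
  | cons : Data → Data → Data
  deriving DecidableEq

namespace Data

/-- The number of nodes. -/
def size : Data → ℕ
  | nil => 1
  | cons a b => a.size + b.size + 1

/-- Lists as trees. -/
def ofList : List Data → Data
  | [] => nil
  | a :: l => cons a (ofList l)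

/-- Natural numbers, in unary. -/
def ofNat : ℕ → Data
  | 0 => nil
  | n + 1 => cons nil (ofNat n)

/-- A tree written as a binary string, in preorder. -/
def bits : Data → List (Fin 2)
  | nil => [0]
  | cons a b => 1 :: (a.bits ++ b.bits)

end Data

/-- Programs: a small language over binary trees.  A program maps an input tree to an output
tree; `ite c p q` and `loop c p` branch on whether the result of the test `c` is a `cons`. -/
inductive Prog : Type
  | ident : Prog
  | nil : Prog
  | left : Prog
  | right : Prog
  | pair : Prog → Prog → Prog
  | comp : Prog → Prog → Prog
  | ite : Prog → Prog → Prog → Prog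
  | loop : Prog → Prog → Prog

/-- `Runs p x y t`: on input `x` the program `p` halts with output `y` after a computation of
cost `t`.  `comp p q` runs `p` first; `loop c p` is `while c x do x := p x`. -/
inductive Runs : Prog → Data → Data → ℕ → Prop
  | ident (x : Data) : Runs .ident x x x.size
  | nil (x : Data) : Runs .nil x .nil x.size
  | left_nil : Runs .left .nil .nil Data.nil.size
  | left_cons (a b : Data) : Runs .left (.cons a b) a (Data.cons a b).size
  | right_nil : Runs .right .nil .nil Data.nil.size
  | right_cons (a b : Data) : Runs .right (.cons a b) b (Data.cons a b).size
  | pair {p q : Prog} {x a b : Data} {s t : ℕ} (hp : Runs p x a s) (hq : Runs q x b t) :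
      Runs (.pair p q) x (.cons a b) (x.size + s + t)
  | comp {p q : Prog} {x y z : Data} {s t : ℕ} (hp : Runs p x y s) (hq : Runs q y z t) :
      Runs (.comp p q) x z (s + t)
  | ite_true {c p q : Prog} {x a b y : Data} {s t : ℕ} (hc : Runs c x (.cons a b) s)
      (hp : Runs p x y t) : Runs (.ite c p q) x y (x.size + s + t)
  | ite_false {c p q : Prog} {x y : Data} {s t : ℕ} (hc : Runs c x .nil s)
      (hq : Runs q x y t) : Runs (.ite c p q) x y (x.size + s + t)
  | loop_done {c p : Prog} {x : Data} {s : ℕ} (hc : Runs c x .nil s) :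
      Runs (.loop c p) x x (x.size + s)
  | loop_step {c p : Prog} {x a b y z : Data} {s t r : ℕ} (hc : Runs c x (.cons a b) s)
      (hp : Runs p x y t) (hl : Runs (.loop c p) y z r) :
      Runs (.loop c p) x z (x.size + s + t + r)

/-! ### Parameterized problems and fpt-reductions -/

/-- An instance `(I, k)` over the alphabet `{0, …, m - 1}`: main part `I`, parameter `k`. -/
abbrev Inst (m : ℕ) : Type := List (Fin m) × ℕ

/-- The tree on which a program receives (or returns) an instance: the list of the symbols of the
main part, together with the parameter. -/
def Inst.toData {m : ℕ} (x : Inst m) : Data :=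
  .cons (Data.ofList (x.1.map fun a : Fin m => Data.ofNat a.val)) (Data.ofNat x.2)

/-- A parameterized problem: a finite alphabet and a set of (yes-)instances over it. -/
structure ParamProblem : Type where
  alphabet : ℕ
  yes : Set (Inst alphabet)

/-- The complementary problem. -/
def ParamProblem.compl (L : ParamProblem) : ParamProblem := ⟨L.alphabet, L.yesᶜ⟩

/-- `R` is computable in fpt-time: in time `f(k) * |I|^c` for a computable `f` and a constant `c`
(`|I| + 1` in place of `|I|` only serves the empty string). -/
def FptComputable {m m' : ℕ} (R : Inst m → Inst m') : Prop :=
  ∃ (p : Prog) (f : ℕ → ℕ) (c : ℕ), Computable f ∧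
    ∀ x : Inst m, ∃ t : ℕ, t ≤ f x.2 * (x.1.length + 1) ^ c ∧ Runs p x.toData (R x).toData t

/-- There is an fpt-reduction from `L` to `L'`. -/
def FptReducible (L L' : ParamProblem) : Prop :=
  ∃ R : Inst L.alphabet → Inst L'.alphabet,
    (∀ x, x ∈ L.yes ↔ R x ∈ L'.yes) ∧
    (∃ g : ℕ → ℕ, Computable g ∧ ∀ x, (R x).2 ≤ g x.2) ∧
    FptComputable R

/-- The closure of a set of problems under fpt-reductions. -/
def fptClosure (S : Set ParamProblem) : Set ParamProblem :=
  {L | ∃ L' ∈ S, FptReducible L L'}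

/-- The class of the complements of the problems in `K`. -/
def coClass (K : Set ParamProblem) : Set ParamProblem := {L | L.compl ∈ K}

/-- `P` is complete for `K` under fpt-reductions. -/
def IsFptComplete (K : Set ParamProblem) (P : ParamProblem) : Prop :=
  P ∈ K ∧ ∀ L ∈ K, FptReducible L P

/-! ### Boolean circuits -/

/-- A gate, with the indices of the nodes that feed it. -/
inductive Gate : Type
  | and : List ℕ → Gate
  | or : List ℕ → Gate
  | not : ℕ → Gate
  deriving DecidableEq

namespace Gate

/-- The nodes that feed the gate. -/
def inputs : Gate → List ℕ
  | and l => l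
  | or l => l
  | not i => [i]

/-- The value of a gate, given the values of all nodes. -/
def eval : Gate → (ℕ → Bool) → Bool
  | and l, v => l.all v
  | or l, v => l.any v
  | not i, v => !(v i)

/-- A gate as a tree. -/
def toData : Gate → Data
  | and l => .cons (Data.ofNat 0) (Data.ofList (l.map Data.ofNat))
  | or l => .cons (Data.ofNat 1) (Data.ofList (l.map Data.ofNat))
  | not i => .cons (Data.ofNat 2) (Data.ofNat i)

end Gate

/-- A Boolean circuit over two disjoint sets of variables: the `n₁` variables of the first block,
which are the nodes `0, …, n₁ - 1`, and the `n₂` variables of the second block, which are the next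
`n₂` nodes.  The remaining nodes are the gates, in topological order; a gate may feed any number of
later gates, and an `and` or `or` gate without inputs is a constant.  One node is the output. -/
structure Circuit : Type where
  n₁ : ℕ
  n₂ : ℕ
  gates : List Gate
  out : ℕ
  inputs_lt : ∀ (j : ℕ) (hj : j < gates.length), ∀ i ∈ (gates[j]).inputs, i < n₁ + n₂ + j
  out_lt : out < n₁ + n₂ + gates.length

namespace Circuit

/-- The label of the output node when the variables are labelled by the list `vars` and the label
of every gate is computed by `step` from the labels of the nodes before it. -/
def label {β : Type} [Inhabited β] (C : Circuit) (step : Gate → (ℕ → β) → β) (vars : List β) : β :=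
  (C.gates.foldl (fun vs g => vs ++ [step g fun i => vs.getD i default]) vars).getD C.out default

/-- The value of the circuit under the assignment `a` to the first and `b` to the second block. -/
def eval (C : Circuit) (a : Fin C.n₁ → Bool) (b : Fin C.n₂ → Bool) : Bool :=
  C.label Gate.eval (List.ofFn (Fin.append a b))

/-- The depth: the length of a longest path (from a variable or constant) to the output. -/
def depth (C : Circuit) : ℕ :=
  C.label (fun g d => 1 + (g.inputs.map d).foldr max 0) (List.replicate (C.n₁ + C.n₂) 0)

/-- The weft: the largest number of large gates (of fan-in more than 2) on a path to the output. -/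
def weft (C : Circuit) : ℕ :=
  C.label (fun g w => (if 2 < g.inputs.length then 1 else 0) + (g.inputs.map w).foldr max 0)
    (List.replicate (C.n₁ + C.n₂) 0)

/-- The gate at a node; there is none at a variable. -/
def gateAt (C : Circuit) (j : ℕ) : Option Gate :=
  if j < C.n₁ + C.n₂ then none else C.gates[j - (C.n₁ + C.n₂)]?

/-- A Boolean formula is a circuit in which every gate has fan-out at most 1. -/
def IsFormula (C : Circuit) : Prop :=
  ((C.gates.flatMap Gate.inputs).filter fun i => C.n₁ + C.n₂ ≤ i).Nodup

/-- The node is a variable or a negated variable. -/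
def IsLiteral (C : Circuit) (j : ℕ) : Prop :=
  j < C.n₁ + C.n₂ ∨ ∃ i < C.n₁ + C.n₂, C.gateAt j = some (.not i)

/-- The circuit written as a binary string. -/
def code (C : Circuit) : List (Fin 2) :=
  (Data.cons (Data.ofNat C.n₁) (.cons (Data.ofNat C.n₂)
    (.cons (Data.ofList (C.gates.map Gate.toData)) (Data.ofNat C.out)))).bits

end Circuit

/-- The circuits of depth at most `u` and weft at most `t`. -/
def Gam (t u : ℕ) : Set Circuit := {C | C.depth ≤ u ∧ C.weft ≤ t}

/-- The `r`-CNF formulas: conjunctions of disjunctions of at most `r` literals. -/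
def CNF (r : ℕ) : Set Circuit :=
  {C | C.IsFormula ∧ ∃ l, C.gateAt C.out = some (.and l) ∧
    ∀ j ∈ l, ∃ c, C.gateAt j = some (.or c) ∧ c.length ≤ r ∧ ∀ i ∈ c, C.IsLiteral i}

/-- The `r`-DNF formulas: disjunctions of conjunctions of at most `r` literals. -/
def DNF (r : ℕ) : Set Circuit :=
  {C | C.IsFormula ∧ ∃ l, C.gateAt C.out = some (.or l) ∧
    ∀ j ∈ l, ∃ c, C.gateAt j = some (.and c) ∧ c.length ≤ r ∧ ∀ i ∈ c, C.IsLiteral i}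

/-! ### Weighted quantified satisfiability -/

/-- The weight of an assignment: the number of variables set to true. -/
def weight {n : ℕ} (a : Fin n → Bool) : ℕ := (Finset.univ.filter fun i => a i = true).card

/-- The problem `∃*∀ᵏ-WSat(𝒞)`: is there an assignment to the first block such that every
assignment of weight `k` to the second block satisfies the circuit? -/
def EAWSat (𝒞 : Set Circuit) : ParamProblem where
  alphabet := 2
  yes := {x | ∃ C ∈ 𝒞, x.1 = C.code ∧
    ∃ a : Fin C.n₁ → Bool, ∀ b : Fin C.n₂ → Bool, weight b = x.2 → C.eval a b = true}

/-- The problem `∀*∃ᵏ-WSat(𝒞)`: is there for every assignment to the first block an assignment of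
weight `k` to the second block that together with it satisfies the circuit? -/
def AEWSat (𝒞 : Set Circuit) : ParamProblem where
  alphabet := 2
  yes := {x | ∃ C ∈ 𝒞, x.1 = C.code ∧
    ∀ a : Fin C.n₁ → Bool, ∃ b : Fin C.n₂ → Bool, weight b = x.2 ∧ C.eval a b = true}

/-- The class `∃*∀ᵏ-W[t]`. -/
def EAW (t : ℕ) : Set ParamProblem := fptClosure {P | ∃ u ≥ 1, P = EAWSat (Gam t u)}

/-- The class `∀*∃ᵏ-W[t]`. -/
def AEW (t : ℕ) : Set ParamProblem := coClass (EAW t)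

end ParamComplexity

open ParamComplexity

/-! All three claims follow from one construction. It takes a circuit `C` of depth at most `u` with
at most one gate of fan-in above `s` on every path, a value `v` and `k`, and produces clauses with
two literals such that "for every assignment to the first block some assignment of weight `k` to the
second gives `C` the value `v`" becomes a statement of the same shape about those clauses. The new
parameter is `(k + 1) ^ (s ^ u)`. The conjunction of the clauses is a 2-CNF, its negation a 2-DNF;
varying `v` and the polarity yields the reductions between the two problems and their complements.

Chains. An assignment of weight `k` is a chain `0 = p 0 < ⋯ < p (k + 1) = n₂ + 1`, whose inner
members are the positions of the true variables. The closed gap `(p i, p (i + 1))` determines every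
variable in it: true at an endpoint, false inside. A node of weft zero depends on at most `s ^ u`
variables, so `s ^ u` gaps and the first block determine its value (`exists_cov`,
`nodeVal_eq_of_cov`).

Certificates. That the output has value `v` is witnessed by at most `(s + 1) ^ u` claims on values
of nodes (`exists_cert`, `cert_sound`). A claim about all inputs of a large gate is not expanded;
these inputs have weft zero, and their values become requirements. So every requirement concerns a
node of weft zero.

Blocks. For every tuple of `s ^ u` gap indices one choice has to be made: a certificate, the same
for all blocks, and the gaps at these indices. Pairwise conditions (same index, same gap;
consecutive indices, adjacent gaps) make the gaps those of a single chain. Each choice demands the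
requirements on the nodes that its gaps cover, and every requirement is covered by some block.

Width two. The value of a covered node depends on the first block through up to `s ^ u` variables.
To make it a literal, a universal variable is added for every tuple of gaps and every node, meant to
be the node's value. If an assignment breaks a local evaluation rule, a few literals exhibit the
fault, and irregular choices that demand just these literals satisfy all constraints. So only
truthful assignments matter (`nodeVal_of_no_fault`, `no_fault`). Conflicts are clauses of two
negative literals, demands are clauses "choice implies literal", and the prescribed weight forces
exactly one choice per block (`exists_selects_iff`).

Everything is computed in polynomial time since `s` and `u` are constants; the library of `PolyTime`
functions establishes this for the given programs. -/

namespace ParamComplexity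

/-! ### Polynomial time on encoded types -/

/-- Types whose elements are written as trees. -/
class Enc (α : Type) where
  /-- The tree that represents an element. -/
  enc : α → Data

open Enc

instance : Enc Data := ⟨id⟩
instance : Enc Unit := ⟨fun _ => .nil⟩
instance : Enc ℕ := ⟨Data.ofNat⟩
instance : Enc Bool := ⟨fun b => bif b then .cons .nil .nil else .nil⟩
instance {m : ℕ} : Enc (Fin m) := ⟨fun a => Data.ofNat a.val⟩
instance {α β : Type} [Enc α] [Enc β] : Enc (α × β) := ⟨fun x => .cons (enc x.1) (enc x.2)⟩
instance {α : Type} [Enc α] : Enc (List α) := ⟨fun l => Data.ofList (l.map enc)⟩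
instance : Enc Gate := ⟨Gate.toData⟩

/-- The size of the encoding. -/
def esize {α : Type} [Enc α] (a : α) : ℕ := (enc a).size

section Basic

variable {α β γ δ σ : Type} [Enc α] [Enc β] [Enc γ] [Enc δ] [Enc σ]

lemma enc_prod (a : α) (b : β) : enc (a, b) = .cons (enc a) (enc b) := rfl
lemma enc_list_nil : enc ([] : List α) = .nil := rfl
lemma enc_list_cons (a : α) (l : List α) : enc (a :: l) = .cons (enc a) (enc l) := rfl

lemma Data.size_pos (d : Data) : 0 < d.size := by cases d <;> simp [Data.size]

lemma esize_pos (a : α) : 0 < esize a := Data.size_pos _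

@[simp] lemma esize_prod (a : α) (b : β) : esize (a, b) = esize a + esize b + 1 := rfl
@[simp] lemma esize_nil : esize ([] : List α) = 1 := rfl
@[simp] lemma esize_cons (a : α) (l : List α) : esize (a :: l) = esize a + esize l + 1 := rfl
@[simp] lemma esize_nat (n : ℕ) : esize n = 2 * n + 1 := by
  induction n with
  | zero => rfl
  | succ n ih =>
    have : esize (n + 1) = 1 + esize n + 1 := rfl
    omega

lemma esize_bool_le (b : Bool) : esize b ≤ 3 := by cases b <;> decide

lemma esize_append (l l' : List α) : esize (l ++ l') + 1 = esize l + esize l' := by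
  induction l with
  | nil => simp [add_comm]
  | cons a l ih => simp; omega

lemma esize_le_of_mem {a : α} {l : List α} (h : a ∈ l) : esize a < esize l := by
  induction l with
  | nil => simp at h
  | cons b l ih =>
    rcases List.mem_cons.1 h with rfl | h
    · simp only [esize_cons]; omega
    · have := ih h; simp only [esize_cons]; omega

lemma length_lt_esize (l : List α) : l.length < esize l := by
  induction l with
  | nil => simp
  | cons a l ih => simp; omega

lemma esize_reverse (l : List α) : esize l.reverse = esize l := by
  induction l with
  | nil => rfl
  | cons a l ih =>
    have := esize_append l.reverse [a]
    simp at this ⊢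
    omega

lemma esize_list_le (l : List α) (B : ℕ) (h : ∀ a ∈ l, esize a ≤ B) :
    esize l ≤ l.length * (B + 1) + 1 := by
  induction l with
  | nil => simp
  | cons a l ih =>
    have h1 := h a (by simp)
    have h2 := ih fun b hb => h b (by simp [hb])
    simp [add_mul]; omega

/-- Quantities bounded by a polynomial in the size of the encoding. -/
def PolyBdd (g : α → ℕ) : Prop := ∃ c : ℕ, ∀ a, g a ≤ (esize a + 1) ^ c

lemma PolyBdd.mono {g h : α → ℕ} (hg : PolyBdd g) (hh : ∀ a, h a ≤ g a) : PolyBdd h := by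
  obtain ⟨c, hc⟩ := hg
  exact ⟨c, fun a => (hh a).trans (hc a)⟩

lemma PolyBdd.const (n : ℕ) : PolyBdd fun _ : α => n :=
  ⟨n, fun a => (Nat.lt_pow_self (by have := esize_pos a; omega)).le⟩

lemma PolyBdd.esize : PolyBdd fun a : α => ParamComplexity.esize a := ⟨1, fun a => by simp⟩

lemma PolyBdd.mul {g h : α → ℕ} (hg : PolyBdd g) (hh : PolyBdd h) :
    PolyBdd fun a => g a * h a := by
  obtain ⟨c, hc⟩ := hg
  obtain ⟨d, hd⟩ := hh
  exact ⟨c + d, fun a => by rw [pow_add]; exact Nat.mul_le_mul (hc a) (hd a)⟩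

/-- Both summands are at most `M ^ max c d` with `M ≥ 2`, and the factor two is absorbed by one more
power of `M`. -/
lemma PolyBdd.add {g h : α → ℕ} (hg : PolyBdd g) (hh : PolyBdd h) :
    PolyBdd fun a => g a + h a := by
  obtain ⟨c, hc⟩ := hg
  obtain ⟨d, hd⟩ := hh
  refine ⟨max c d + 1, fun a => ?_⟩
  have h1 : 1 ≤ ParamComplexity.esize a := esize_pos a
  have e1 := (hc a).trans (Nat.pow_le_pow_right (by omega) (le_max_left c d))
  have e2 := (hd a).trans (Nat.pow_le_pow_right (by omega) (le_max_right c d))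
  show g a + h a ≤ _
  rw [pow_succ]
  have := Nat.mul_le_mul_left ((ParamComplexity.esize a + 1) ^ max c d)
    (show 2 ≤ ParamComplexity.esize a + 1 by omega)
  omega

lemma PolyBdd.pow {g : α → ℕ} (hg : PolyBdd g) (n : ℕ) : PolyBdd fun a => g a ^ n := by
  obtain ⟨c, hc⟩ := hg
  exact ⟨c * n, fun a => by rw [pow_mul]; exact Nat.pow_le_pow_left (hc a) n⟩

lemma PolyBdd.comp {g : β → ℕ} {f : α → β} (hg : PolyBdd g)
    (hf : PolyBdd fun a => ParamComplexity.esize (f a)) : PolyBdd fun a => g (f a) := by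
  obtain ⟨c, hc⟩ := hg
  exact ((hf.add (PolyBdd.const 1)).pow c).mono fun a => hc _

/-- Functions computed by a program in time polynomial in the size of the encoding. -/
@[fun_prop]
def PolyTime (f : α → β) : Prop :=
  ∃ (p : Prog) (T : α → ℕ), PolyBdd T ∧ ∀ a, ∃ t ≤ T a, Runs p (enc a) (enc (f a)) t

/-- Every rule is charged at least the size of its result. Hence a time bound is also a bound on the
output, which is what lets time bounds compose. -/
lemma Runs.size_le {p : Prog} {x y : Data} {t : ℕ} (h : Runs p x y t) : y.size ≤ t := by
  induction h with
  | nil x => exact x.size_pos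
  | @pair _ _ x _ _ _ _ _ _ ihp ihq =>
    have := x.size_pos
    simp only [Data.size]
    omega
  | _ => first | omega | (simp only [Data.size] at *; omega)

lemma PolyTime.size {f : α → β} (hf : PolyTime f) : PolyBdd fun a => esize (f a) := by
  obtain ⟨p, T, hT, h⟩ := hf
  refine hT.mono fun a => ?_
  obtain ⟨t, ht, hr⟩ := h a
  exact hr.size_le.trans ht

/-- A function that does not change the encoding. -/
lemma PolyTime.of_enc_eq {f : α → β} (h : ∀ a, enc (f a) = enc a) : PolyTime f :=
  ⟨.ident, fun a => esize a, PolyBdd.esize, fun a => ⟨_, le_rfl, by rw [h]; exact .ident _⟩⟩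

@[fun_prop]
lemma PolyTime.id : PolyTime fun a : α => a := .of_enc_eq fun _ => rfl

@[fun_prop]
lemma PolyTime.comp {g : β → γ} {f : α → β} (hg : PolyTime g) (hf : PolyTime f) :
    PolyTime fun a => g (f a) := by
  have hs := hf.size
  obtain ⟨p, T, hT, h⟩ := hf
  obtain ⟨q, U, hU, h'⟩ := hg
  refine ⟨.comp p q, fun a => T a + U (f a), hT.add (hU.comp hs), fun a => ?_⟩
  obtain ⟨t, ht, hr⟩ := h a
  obtain ⟨u, hu, hr'⟩ := h' (f a)
  exact ⟨_, add_le_add ht hu, .comp hr hr'⟩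

@[fun_prop]
lemma PolyTime.prodMk {f : α → β} {g : α → γ} (hf : PolyTime f) (hg : PolyTime g) :
    PolyTime fun a => (f a, g a) := by
  obtain ⟨p, T, hT, h⟩ := hf
  obtain ⟨q, U, hU, h'⟩ := hg
  refine ⟨.pair p q, fun a => esize a + T a + U a, (PolyBdd.esize.add hT).add hU, fun a => ?_⟩
  obtain ⟨t, ht, hr⟩ := h a
  obtain ⟨u, hu, hr'⟩ := h' a
  exact ⟨_, by simp only [esize]; omega, .pair hr hr'⟩

lemma PolyTime.prog_left {f : α → β} (h : ∀ a, ∃ d, enc a = .cons (enc (f a)) d) : PolyTime f :=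
  ⟨.left, fun a => esize a, PolyBdd.esize, fun a => by
    obtain ⟨d, hd⟩ := h a
    exact ⟨_, le_rfl, by simp only [esize]; rw [hd]; exact .left_cons _ _⟩⟩

lemma PolyTime.prog_right {f : α → β} (h : ∀ a, ∃ d, enc a = .cons d (enc (f a))) : PolyTime f :=
  ⟨.right, fun a => esize a, PolyBdd.esize, fun a => by
    obtain ⟨d, hd⟩ := h a
    exact ⟨_, le_rfl, by simp only [esize]; rw [hd]; exact .right_cons _ _⟩⟩

@[fun_prop]
lemma PolyTime.fst {f : α → β × γ} (hf : PolyTime f) : PolyTime fun a => (f a).1 :=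
  (PolyTime.prog_left (f := fun x : β × γ => x.1) fun _ => ⟨_, rfl⟩).comp hf

@[fun_prop]
lemma PolyTime.snd {f : α → β × γ} (hf : PolyTime f) : PolyTime fun a => (f a).2 :=
  (PolyTime.prog_right (f := fun x : β × γ => x.2) fun _ => ⟨_, rfl⟩).comp hf

/-- The constant is assembled node by node. Each primitive is charged the whole input, so the cost
is linear in the input, with a factor that depends on the constant. -/
lemma exists_prog_const (d : Data) : ∃ (p : Prog) (c : ℕ), ∀ x : Data, ∃ t ≤ c * x.size,
    Runs p x d t := by
  induction d with
  | nil => exact ⟨.nil, 1, fun x => ⟨_, by simp, .nil x⟩⟩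
  | cons a b iha ihb =>
    obtain ⟨p, c, hp⟩ := iha
    obtain ⟨q, d, hq⟩ := ihb
    refine ⟨.pair p q, 1 + c + d, fun x => ?_⟩
    obtain ⟨t, ht, hr⟩ := hp x
    obtain ⟨u, hu, hr'⟩ := hq x
    exact ⟨_, by rw [add_mul, add_mul]; omega, .pair hr hr'⟩

@[fun_prop]
lemma PolyTime.const (b : β) : PolyTime fun _ : α => b := by
  obtain ⟨p, c, hp⟩ := exists_prog_const (enc b)
  exact ⟨p, fun a => c * esize a, (PolyBdd.const c).mul .esize, fun a => hp _⟩

/-- Branching on a test whose outcome is read off from the encoding. -/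
lemma PolyTime.branch {c : α → δ} {b : α → Bool} {f g : α → β} (hc : PolyTime c)
    (hb : ∀ a, enc (c a) = .nil ↔ b a = false) (hf : PolyTime f) (hg : PolyTime g) :
    PolyTime fun a => bif b a then f a else g a := by
  obtain ⟨r, V, hV, h''⟩ := hc
  obtain ⟨p, T, hT, h⟩ := hf
  obtain ⟨q, U, hU, h'⟩ := hg
  refine ⟨.ite r p q, fun a => esize a + V a + (T a + U a),
    (PolyBdd.esize.add hV).add (hT.add hU), fun a => ?_⟩
  obtain ⟨t, ht, hr⟩ := h a
  obtain ⟨u, hu, hr'⟩ := h' a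
  obtain ⟨v, hv, hr''⟩ := h'' a
  cases hba : b a with
  | false =>
    rw [(hb a).2 hba] at hr''
    refine ⟨_, ?_, by simpa only [hba] using .ite_false hr'' hr'⟩
    simp only [esize]; omega
  | true =>
    cases hca : enc (c a) with
    | nil => simp [(hb a).1 hca] at hba
    | cons d e =>
      rw [hca] at hr''
      refine ⟨_, ?_, by simpa only [hba] using .ite_true hr'' hr⟩
      simp only [esize]; omega

@[fun_prop]
lemma PolyTime.cond {b : α → Bool} {f g : α → β} (hb : PolyTime b) (hf : PolyTime f)
    (hg : PolyTime g) : PolyTime fun a => bif b a then f a else g a :=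
  .branch hb (fun a => by cases b a <;> simp [enc]) hf hg

/-! ### Folds -/

/-- The body of the loop that computes a fold. -/
def foldBody (p : Prog) : Prog :=
  .pair (.comp .left .right) (.pair (.comp .right .left)
    (.comp (.pair (.comp .right .left) (.pair (.comp .right .right) (.comp .left .left))) p))

/-- The loop state is `(remaining list, (fixed argument, accumulator))`. One round drops the head
`x`, keeps `a`, and runs `p` on `(a, (s, x))`; the rearranging costs at most 14 times the size of
the state. -/
lemma foldBody_runs {p : Prog} {x xs a s s' : Data} {t : ℕ}
    (h : Runs p (.cons a (.cons s x)) s' t) :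
    ∃ u ≤ 14 * (Data.cons (.cons x xs) (.cons a s)).size + t,
      Runs (foldBody p) (.cons (.cons x xs) (.cons a s)) (.cons xs (.cons a s')) u := by
  refine ⟨_, ?_, .pair (.comp (.left_cons _ _) (.right_cons _ _))
    (.pair (.comp (.right_cons _ _) (.left_cons _ _))
      (.comp (.pair (.comp (.right_cons _ _) (.left_cons _ _))
        (.pair (.comp (.right_cons _ _) (.right_cons _ _))
          (.comp (.left_cons _ _) (.left_cons _ _)))) h))⟩
  simp only [Data.size]
  omega

/-- The test `.left` returns the remaining list, so the loop ends exactly when it is empty. A round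
is charged the state twice for the test, 14 times for the rearranging, and `K` for the step. The
bounds are assumed for prefixes of the list only, that is, for states that occur. -/
lemma foldLoop_runs {p : Prog} {f : σ → β → σ} (a : α) (B K : ℕ) (l : List β) (s : σ)
    (hB : ∀ l₁ l₂, l = l₁ ++ l₂ → esize (l₂, (a, l₁.foldl f s)) ≤ B)
    (hK : ∀ l₁ x l₂, l = l₁ ++ x :: l₂ → ∃ t ≤ K,
      Runs p (enc (a, (l₁.foldl f s, x))) (enc (f (l₁.foldl f s) x)) t) :
    ∃ t ≤ (l.length + 1) * (16 * B + K),
      Runs (.loop .left (foldBody p)) (enc (l, (a, s))) (enc (([] : List β), (a, l.foldl f s))) t := by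
  induction l generalizing s with
  | nil =>
    have := hB [] [] rfl
    refine ⟨_, ?_, .loop_done (.left_cons _ _)⟩
    simp only [esize, List.foldl_nil] at this
    change (enc (([] : List β), (a, s))).size + (enc (([] : List β), (a, s))).size ≤ _
    simp only [List.length_nil]
    omega
  | cons x l ih =>
    obtain ⟨t, ht, hr⟩ := hK [] x l rfl
    obtain ⟨u, hu, hr'⟩ := foldBody_runs (xs := enc l) hr
    obtain ⟨v, hv, hr''⟩ := ih (f s x) (fun l₁ l₂ h => hB (x :: l₁) l₂ (by simp [h]))
      (fun l₁ y l₂ h => hK (x :: l₁) y l₂ (by simp [h]))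
    have h0 := hB [] (x :: l) rfl
    refine ⟨_, ?_, .loop_step (.left_cons _ _) hr' hr''⟩
    change (enc (x :: l, (a, s))).size + (enc (x :: l, (a, s))).size + u + v ≤ _
    change u ≤ 14 * (enc (x :: l, (a, s))).size + t at hu
    simp only [esize, List.foldl_nil] at h0
    rw [List.length_cons, add_mul (l.length + 1)]
    omega

/-- Folds are polynomial-time if the states have polynomial size. -/
lemma PolyTime.foldl_of_bound {l : α → List β} {f : α → σ → β → σ} {i : α → σ} {B : α → ℕ}
    (hl : PolyTime l) (hf : PolyTime fun p : α × σ × β => f p.1 p.2.1 p.2.2) (hi : PolyTime i)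
    (hB : PolyBdd B) (h : ∀ a l₁ l₂, l a = l₁ ++ l₂ → esize (l₁.foldl (f a) (i a)) ≤ B a) :
    PolyTime fun a => (l a).foldl (f a) (i a) := by
  have hls := hl.size
  obtain ⟨p, T, hT, hp⟩ := (PolyTime.prodMk hl (PolyTime.id.prodMk hi))
  obtain ⟨q, U, ⟨c, hU⟩, hq⟩ := hf
  -- `S a` bounds both the loop states and the inputs `(a, (state, x))` of the step, since `x` is
  -- smaller than the list that contains it.
  let S : α → ℕ := fun a => esize (l a) + esize a + B a + 2
  have hS : PolyBdd S := ((hls.add .esize).add hB).add (.const 2)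
  let K : α → ℕ := fun a => (S a + 1) ^ c
  have hK : PolyBdd K := (hS.add (.const 1)).pow c
  refine ⟨.comp p (.comp (.loop .left (foldBody q)) (.comp .right .right)),
    fun a => T a + (esize (l a) * (16 * S a + K a) + (S a + S a)),
    hT.add ((hls.mul (((PolyBdd.const 16).mul hS).add hK)).add (hS.add hS)), fun a => ?_⟩
  obtain ⟨t, ht, hr⟩ := hp a
  obtain ⟨u, hu, hr'⟩ := foldLoop_runs (p := q) (f := f a) a (S a) (K a) (l a) (i a)
    (fun l₁ l₂ e => by
      have h1 := h a l₁ l₂ e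
      have h2 := esize_append l₁ l₂
      have h3 := esize_pos l₁
      rw [← e] at h2
      simp only [esize_prod, S]
      omega)
    (fun l₁ x l₂ e => by
      obtain ⟨v, hv, hr''⟩ := hq (a, (l₁.foldl (f a) (i a), x))
      refine ⟨v, hv.trans ((hU _).trans (Nat.pow_le_pow_left ?_ c)), hr''⟩
      have h1 := h a l₁ _ e
      have h2 := esize_le_of_mem (a := x) (l := l a) (by simp [e])
      simp only [esize_prod, S]
      omega)
  refine ⟨_, ?_, .comp hr (.comp hr' (.comp (.right_cons _ _) (.right_cons _ _)))⟩
  have h1 := h a (l a) [] (by simp)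
  have h2 := length_lt_esize (l a)
  have h3 : ∀ b : σ, (Data.cons .nil (.cons (enc a) (enc b))).size = esize a + esize b + 3 := by
    intro b; simp only [Data.size, esize]; omega
  have h4 : ∀ b : σ, (Data.cons (enc a) (enc b)).size = esize a + esize b + 1 := by
    intro b; simp only [Data.size, esize]
  have h5 := hu.trans (Nat.mul_le_mul_right _ (Nat.succ_le_of_lt h2))
  have h6 : (enc (([] : List β), (a, (l a).foldl (f a) (i a)))).size =
    esize a + esize ((l a).foldl (f a) (i a)) + 3 := h3 _
  have h7 := esize_pos (l a)
  change t + (u + ((Data.cons .nil (.cons (enc a) (enc ((l a).foldl (f a) (i a))))).size +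
    (Data.cons (enc a) (enc ((l a).foldl (f a) (i a)))).size)) ≤ _
  rw [h3, h4]
  simp only [S]
  simp only [S] at h5
  omega

/-- Folds are polynomial-time if every step adds at most a polynomial amount to the state. -/
lemma PolyTime.foldl {l : α → List β} {f : α → σ → β → σ} {i : α → σ} {D : α → ℕ}
    (hl : PolyTime l) (hf : PolyTime fun p : α × σ × β => f p.1 p.2.1 p.2.2) (hi : PolyTime i)
    (hD : PolyBdd D) (h : ∀ a s, ∀ x ∈ l a, esize (f a s x) ≤ esize s + D a) :
    PolyTime fun a => (l a).foldl (f a) (i a) := by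
  refine PolyTime.foldl_of_bound (B := fun a => esize (i a) + esize (l a) * D a) hl hf hi
    (hi.size.add (hl.size.mul hD)) fun a l₁ l₂ e => ?_
  have key : ∀ (l' : List β) (s : σ), (∀ x ∈ l', x ∈ l a) →
      esize (l'.foldl (f a) s) ≤ esize s + l'.length * D a := by
    intro l'
    induction l' with
    | nil => simp
    | cons x l' ih =>
      intro s hx
      have h1 := ih (f a s x) fun y hy => hx y (by simp [hy])
      have h2 := h a s x (hx x (by simp))
      simp only [List.foldl_cons, List.length_cons, add_mul]
      omega
  refine (key l₁ _ fun x hx => by simp [e, hx]).trans ?_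
  have h3 := length_lt_esize (l a)
  have h4 : l₁.length ≤ esize (l a) := by rw [e] at h3 ⊢; simp at h3; omega
  have := Nat.mul_le_mul_right (D a) h4
  omega

end Basic

/-! ### A library of polynomial-time functions -/

section Library

variable {α β γ δ σ : Type} [Enc α] [Enc β] [Enc γ] [Enc δ] [Enc σ]

omit [Enc α] [Enc β] in
-- A fold that conses builds its result in reverse; `reverse`, `append` and `map` are all obtained
-- from it.
lemma foldl_cons_map (f : α → β) (l : List α) (s : List β) :
    l.foldl (fun s x => f x :: s) s = (l.map f).reverse ++ s := by
  induction l generalizing s with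
  | nil => rfl
  | cons x l ih => simp [ih]

@[fun_prop]
lemma PolyTime.not {b : α → Bool} (hb : PolyTime b) : PolyTime fun a => !(b a) := by
  have : (fun a => !(b a)) = fun a => bif b a then false else true := by
    funext a; cases b a <;> rfl
  rw [this]; fun_prop

@[fun_prop]
lemma PolyTime.and {b c : α → Bool} (hb : PolyTime b) (hc : PolyTime c) :
    PolyTime fun a => b a && c a := by
  have : (fun a => b a && c a) = fun a => bif b a then c a else false := by
    funext a; cases b a <;> rfl
  rw [this]; fun_prop

@[fun_prop]
lemma PolyTime.or {b c : α → Bool} (hb : PolyTime b) (hc : PolyTime c) :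
    PolyTime fun a => b a || c a := by
  have : (fun a => b a || c a) = fun a => bif b a then true else c a := by
    funext a; cases b a <;> rfl
  rw [this]; fun_prop

@[fun_prop]
lemma PolyTime.listCons {f : α → β} {l : α → List β} (hf : PolyTime f) (hl : PolyTime l) :
    PolyTime fun a => f a :: l a :=
  (PolyTime.of_enc_eq (f := fun p : β × List β => p.1 :: p.2) fun _ => rfl).comp (hf.prodMk hl)

@[fun_prop]
lemma PolyTime.reverse {l : α → List β} (hl : PolyTime l) : PolyTime fun a => (l a).reverse := by
  have : (fun l : List β => l.reverse) = fun l => l.foldl (fun s x => x :: s) [] := by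
    funext l; simp [foldl_cons_map (fun x => x)]
  refine PolyTime.comp (g := fun l : List β => l.reverse) ?_ hl
  rw [this]
  refine PolyTime.foldl (D := fun a => esize a) (by fun_prop) (by fun_prop) (by fun_prop) .esize ?_
  intro a s x hx
  have := esize_le_of_mem hx
  simp only [esize_cons]
  omega

@[fun_prop]
lemma PolyTime.append {l l' : α → List β} (hl : PolyTime l) (hl' : PolyTime l') :
    PolyTime fun a => l a ++ l' a := by
  have : (fun a => l a ++ l' a) = fun a => (l a).reverse.foldl (fun s x => x :: s) (l' a) := by
    funext l; simp [foldl_cons_map (fun x => x)]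
  rw [this]
  refine PolyTime.foldl (D := fun a => esize (l a)) (by fun_prop) (by fun_prop) (by fun_prop)
    hl.size ?_
  intro a s x hx
  have := esize_le_of_mem (List.mem_reverse.1 hx)
  simp only [esize_cons]
  omega

@[fun_prop]
lemma PolyTime.map {l : α → List β} {f : α → β → γ} (hl : PolyTime l)
    (hf : PolyTime fun p : α × β => f p.1 p.2) : PolyTime fun a => (l a).map (f a) := by
  have : (fun a => (l a).map (f a)) =
      fun a => ((l a).foldl (fun s x => f a x :: s) []).reverse := by
    funext a
    simp [foldl_cons_map (f a)]
  obtain ⟨c, hc⟩ := hf.size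
  rw [this]
  refine PolyTime.reverse (PolyTime.foldl (f := fun a s x => f a x :: s)
    (D := fun a => (esize a + esize (l a) + 1) ^ c + 1) hl ?_ (by fun_prop)
    ((((PolyBdd.esize.add hl.size).add (.const 1)).pow c).add (.const 1)) ?_)
  · exact (hf.comp (f := fun p : α × List γ × β => (p.1, p.2.2)) (by fun_prop)).listCons
      (by fun_prop)
  · intro a s x hx
    have h1 := esize_le_of_mem hx
    have h2 : esize (f a x) ≤ (esize a + esize (l a) + 1) ^ c :=
      (hc (a, x)).trans (Nat.pow_le_pow_left (by simp; omega) c)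
    simp only [esize_cons]
    omega

@[fun_prop]
lemma PolyTime.flatten {l : α → List (List β)} (hl : PolyTime l) :
    PolyTime fun a => (l a).flatten := by
  have : (fun a => (l a).flatten) = fun a => (l a).foldl (fun s x => s ++ x) [] := by
    funext a
    have key : ∀ (l : List (List β)) (s : List β),
        l.foldl (fun s x => s ++ x) s = s ++ l.flatten := by
      intro l
      induction l with
      | nil => simp
      | cons x l ih => intro s; simp [ih]
    simp [key]
  rw [this]
  refine PolyTime.foldl (D := fun a => esize (l a)) hl (by fun_prop) (by fun_prop) hl.size ?_
  intro a s x hx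
  have := esize_le_of_mem hx
  have := esize_append s x
  omega

@[fun_prop]
lemma PolyTime.flatMap {l : α → List β} {f : α → β → List γ} (hl : PolyTime l)
    (hf : PolyTime fun p : α × β => f p.1 p.2) : PolyTime fun a => (l a).flatMap (f a) :=
  (hl.map hf).flatten

@[fun_prop]
lemma PolyTime.filter {l : α → List β} {f : α → β → Bool} (hl : PolyTime l)
    (hf : PolyTime fun p : α × β => f p.1 p.2) : PolyTime fun a => (l a).filter (f a) := by
  have : (fun a => (l a).filter (f a)) =
      fun a => (l a).flatMap fun x => bif f a x then [x] else [] := by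
    funext a
    induction l a with
    | nil => rfl
    | cons x l ih => cases h : f a x <;> simp [h, ih]
  rw [this]
  refine hl.flatMap (f := fun a x => bif f a x then [x] else []) ?_
  exact hf.cond (by fun_prop) (by fun_prop)

@[fun_prop]
lemma PolyTime.all {l : α → List β} {f : α → β → Bool} (hl : PolyTime l)
    (hf : PolyTime fun p : α × β => f p.1 p.2) : PolyTime fun a => (l a).all (f a) := by
  have : (fun a => (l a).all (f a)) =
      fun a => ((l a).map (f a)).foldl (fun s x => s && x) true := by
    funext a
    have key : ∀ (l : List Bool) (s : Bool), l.foldl (fun s x => s && x) s = (s && l.all _root_.id) := by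
      intro l
      induction l with
      | nil => simp
      | cons x l ih => intro s; simp [ih, Bool.and_assoc]
    rw [key]
    simp [List.all_map]
  rw [this]
  refine PolyTime.foldl (D := fun _ => 3) (hl.map hf) (by fun_prop) (by fun_prop) (.const 3) ?_
  intro a s x _
  have := esize_bool_le (s && x)
  omega

@[fun_prop]
lemma PolyTime.any {l : α → List β} {f : α → β → Bool} (hl : PolyTime l)
    (hf : PolyTime fun p : α × β => f p.1 p.2) : PolyTime fun a => (l a).any (f a) := by
  have : (fun a => (l a).any (f a)) = fun a => !((l a).all fun x => !(f a x)) := by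
    funext a; rw [List.any_eq_not_all_not]
  rw [this]
  exact (hl.all (f := fun a x => !(f a x)) hf.not).not

@[fun_prop]
lemma PolyTime.isEmpty {l : α → List β} (hl : PolyTime l) : PolyTime fun a => (l a).isEmpty := by
  have : (fun a => (l a).isEmpty) = fun a => bif !(l a).isEmpty then false else true := by
    funext a; simp
  rw [this]
  refine .branch hl (fun a => ?_) (by fun_prop) (by fun_prop)
  cases l a <;> simp [enc_list_nil, enc_list_cons]

@[fun_prop]
lemma PolyTime.tail {l : α → List β} (hl : PolyTime l) : PolyTime fun a => (l a).tail := by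
  refine PolyTime.comp (g := fun l : List β => l.tail) ⟨.right, fun a => esize a, .esize, ?_⟩ hl
  intro a
  cases a with
  | nil => exact ⟨_, le_rfl, .right_nil⟩
  | cons x l => exact ⟨_, le_rfl, .right_cons _ _⟩

@[fun_prop]
lemma PolyTime.headD {l : α → List β} {d : α → β} (hl : PolyTime l) (hd : PolyTime d) :
    PolyTime fun a => (l a).headD (d a) := by
  have : (fun a => (l a).headD (d a)) = fun a => (l a).reverse.foldl (fun _ x => x) (d a) := by
    funext a; cases l a <;> simp
  rw [this]
  refine PolyTime.foldl (D := fun a => esize (l a)) (by fun_prop) (by fun_prop) hd hl.size ?_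
  intro a s x hx
  have := esize_le_of_mem (List.mem_reverse.1 hx)
  omega

/-! Natural numbers. -/

lemma PolyTime.succ {f : α → ℕ} (hf : PolyTime f) : PolyTime fun a => f a + 1 :=
  (PolyTime.of_enc_eq (f := fun p : Unit × ℕ => p.2 + 1) fun _ => rfl).comp
    ((PolyTime.const ()).prodMk hf)

@[fun_prop]
-- A unary number and a list of that many units are the same tree. Arithmetic on numbers is
-- therefore inherited from lists: sums from `++`, products from `flatten`, differences from `drop`.
lemma PolyTime.replicate {n : α → ℕ} {f : α → β} (hn : PolyTime n) (hf : PolyTime f) :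
    PolyTime fun a => List.replicate (n a) (f a) := by
  have h : PolyTime fun n : ℕ => List.replicate n () := by
    refine .of_enc_eq fun n => ?_
    induction n with
    | zero => rfl
    | succ n ih => rw [List.replicate_succ, enc_list_cons, ih]; rfl
  have : (fun a => List.replicate (n a) (f a)) =
      fun a => (List.replicate (n a) ()).map fun _ => f a := by
    funext a; simp
  rw [this]
  exact (h.comp hn).map (f := fun a _ => f a) (hf.comp (by fun_prop))

@[fun_prop]
lemma PolyTime.length {l : α → List β} (hl : PolyTime l) : PolyTime fun a => (l a).length := by
  have : (fun a => (l a).length) = fun a => (l a).foldl (fun n _ => n + 1) 0 := by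
    funext a; simp [List.foldl_add_const]
  rw [this]
  refine PolyTime.foldl (D := fun _ => 2) hl ?_ (by fun_prop) (.const 2) ?_
  · exact PolyTime.succ (by fun_prop)
  · intro a s x _
    simp; omega

@[fun_prop]
lemma PolyTime.add {f g : α → ℕ} (hf : PolyTime f) (hg : PolyTime g) :
    PolyTime fun a => f a + g a := by
  have : (fun a => f a + g a) =
      fun a => (List.replicate (f a) () ++ List.replicate (g a) ()).length := by
    funext a; simp
  rw [this]; fun_prop

@[fun_prop]
lemma PolyTime.mul {f g : α → ℕ} (hf : PolyTime f) (hg : PolyTime g) :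
    PolyTime fun a => f a * g a := by
  have : (fun a => f a * g a) =
      fun a => (List.replicate (f a) (List.replicate (g a) ())).flatten.length := by
    funext a; simp
  rw [this]; fun_prop

@[fun_prop]
lemma PolyTime.drop {l : α → List β} {n : α → ℕ} (hl : PolyTime l) (hn : PolyTime n) :
    PolyTime fun a => (l a).drop (n a) := by
  have : (fun a => (l a).drop (n a)) =
      fun a => (List.replicate (n a) ()).foldl (fun l _ => l.tail) (l a) := by
    funext a
    generalize l a = l
    induction n a generalizing l with
    | zero => rfl
    | succ n ih => rw [List.replicate_succ, List.foldl_cons, ← ih]; simp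
  rw [this]
  refine PolyTime.foldl (D := fun _ => 0) (by fun_prop) (by fun_prop) hl (.const 0) ?_
  intro a s x _
  cases s <;> simp; omega

@[fun_prop]
lemma PolyTime.sub {f g : α → ℕ} (hf : PolyTime f) (hg : PolyTime g) :
    PolyTime fun a => f a - g a := by
  have : (fun a => f a - g a) = fun a => ((List.replicate (f a) ()).drop (g a)).length := by
    funext a; simp
  rw [this]; fun_prop

@[fun_prop]
lemma PolyTime.ble {f g : α → ℕ} (hf : PolyTime f) (hg : PolyTime g) :
    PolyTime fun a => Nat.ble (f a) (g a) := by
  have : (fun a => Nat.ble (f a) (g a)) = fun a => (List.replicate (f a - g a) ()).isEmpty := by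
    funext a
    rw [Bool.eq_iff_iff]
    simp [Nat.sub_eq_zero_iff_le]
  rw [this]; fun_prop

@[fun_prop]
lemma PolyTime.max {f g : α → ℕ} (hf : PolyTime f) (hg : PolyTime g) :
    PolyTime fun a => max (f a) (g a) := by
  have : (fun a => Max.max (f a) (g a)) = fun a => f a + (g a - f a) := by
    funext a; omega
  rw [this]; fun_prop

@[fun_prop]
lemma PolyTime.foldr_max {l : α → List ℕ} (hl : PolyTime l) :
    PolyTime fun a => (l a).foldr Max.max 0 := by
  have : (fun a => (l a).foldr Max.max 0) = fun a => (l a).foldl Max.max 0 := by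
    funext a; rw [List.foldl_eq_foldr]
  rw [this]
  refine PolyTime.foldl (D := fun a => esize (l a)) hl (by fun_prop) (by fun_prop) hl.size ?_
  intro a s x hx
  have := esize_le_of_mem hx
  simp only [esize_nat] at *
  omega

@[fun_prop]
lemma PolyTime.getD {l : α → List β} {n : α → ℕ} {d : α → β} (hl : PolyTime l) (hn : PolyTime n)
    (hd : PolyTime d) : PolyTime fun a => (l a).getD (n a) (d a) := by
  have : (fun a => (l a).getD (n a) (d a)) = fun a => ((l a).drop (n a)).headD (d a) := by
    funext a; simp [List.getD_eq_getElem?_getD, List.headD_eq_head?_getD]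
  rw [this]; fun_prop

@[fun_prop]
-- The next index is the length of the accumulator. A step thus adds an amount that depends on the
-- state, so the whole state is bounded instead of the increment.
lemma PolyTime.zipIdx {l : α → List β} (hl : PolyTime l) : PolyTime fun a => (l a).zipIdx := by
  have key : ∀ l : List β, l.foldl (fun s x => (x, s.length) :: s) [] = l.zipIdx.reverse := by
    intro l
    induction l using List.reverseRecOn with
    | nil => rfl
    | append_singleton l x ih => simp [List.foldl_append, ih, List.zipIdx_append]
  have : (fun a => (l a).zipIdx) =
      fun a => ((l a).foldl (fun s x => (x, s.length) :: s) []).reverse := by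
    funext a; rw [key]; simp
  rw [this]
  refine PolyTime.reverse (PolyTime.foldl_of_bound (f := fun _ s x => (x, s.length) :: s)
    (B := fun a => esize (l a) * (esize (l a) + (2 * esize (l a) + 1) + 1 + 1) + 1) hl (by fun_prop)
    (by fun_prop) ?_ ?_)
  · have h := hl.size
    exact (h.mul (((h.add (((PolyBdd.const 2).mul h).add (.const 1))).add (.const 1)).add
      (.const 1))).add (.const 1)
  · intro a l₁ l₂ e
    rw [key, esize_reverse]
    have h1 := length_lt_esize (l a)
    have h2 : l₁.length ≤ (l a).length := by simp [e]
    refine (esize_list_le _ (esize (l a) + (2 * esize (l a) + 1) + 1) ?_).trans ?_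
    · rintro ⟨x, i⟩ hx
      have h3 := List.snd_lt_of_mem_zipIdx hx
      have h4 := esize_le_of_mem (a := x) (l := l a) (by
        rw [e]; exact List.mem_append_left _ (List.fst_mem_of_mem_zipIdx hx))
      simp only [esize_prod, esize_nat]
      simp at h3
      omega
    · rw [List.length_zipIdx]
      gcongr
      omega

@[fun_prop]
lemma PolyTime.range {n : α → ℕ} (hn : PolyTime n) : PolyTime fun a => List.range (n a) := by
  have : (fun a => List.range (n a)) =
      fun a => (List.replicate (n a) ()).zipIdx.map fun x => x.2 := by
    funext a
    rw [show (fun x : Unit × ℕ => x.2) = Prod.snd from rfl, List.zipIdx_map_snd]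
    simp [List.range_eq_range']
  rw [this]; fun_prop

@[fun_prop]
lemma PolyTime.product {l : α → List β} {l' : α → List γ} (hl : PolyTime l) (hl' : PolyTime l') :
    PolyTime fun a => (l a).product (l' a) := by
  unfold List.product
  fun_prop

/-! Trees. -/

namespace Data

/-- The left subtree. -/
def left : Data → Data
  | nil => nil
  | cons a _ => a

/-- The right subtree. -/
def right : Data → Data
  | nil => nil
  | cons _ b => b

/-- Whether the tree has more than one node. -/
def isCons : Data → Bool
  | nil => false
  | cons _ _ => true

end Data

@[fun_prop]
lemma PolyTime.data_left {f : α → Data} (hf : PolyTime f) : PolyTime fun a => (f a).left := by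
  refine PolyTime.comp (g := Data.left) ⟨.left, fun a => esize a, .esize, ?_⟩ hf
  intro d
  cases d with
  | nil => exact ⟨_, le_rfl, .left_nil⟩
  | cons a b => exact ⟨_, le_rfl, .left_cons _ _⟩

@[fun_prop]
lemma PolyTime.data_right {f : α → Data} (hf : PolyTime f) : PolyTime fun a => (f a).right := by
  refine PolyTime.comp (g := Data.right) ⟨.right, fun a => esize a, .esize, ?_⟩ hf
  intro d
  cases d with
  | nil => exact ⟨_, le_rfl, .right_nil⟩
  | cons a b => exact ⟨_, le_rfl, .right_cons _ _⟩

@[fun_prop]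
lemma PolyTime.data_cons {f g : α → Data} (hf : PolyTime f) (hg : PolyTime g) :
    PolyTime fun a => Data.cons (f a) (g a) :=
  (PolyTime.of_enc_eq (f := fun p : Data × Data => Data.cons p.1 p.2) fun _ => rfl).comp
    (hf.prodMk hg)

@[fun_prop]
lemma PolyTime.data_isCons {f : α → Data} (hf : PolyTime f) : PolyTime fun a => (f a).isCons := by
  have : (fun a => (f a).isCons) = fun a => bif (f a).isCons then true else false := by
    funext a; simp
  rw [this]
  refine .branch hf (fun a => ?_) (by fun_prop) (by fun_prop)
  cases h : f a <;> simp [enc, Data.isCons]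

@[fun_prop]
lemma PolyTime.encode {f : α → β} (hf : PolyTime f) : PolyTime fun a => enc (f a) :=
  (PolyTime.of_enc_eq (f := fun b : β => enc b) fun _ => rfl).comp hf

end Library

section Library

variable {α β γ δ σ : Type} [Enc α] [Enc β] [Enc γ] [Enc δ] [Enc σ]

/-! ### Trees as strings -/

/-- One step of writing the trees of a stack in preorder; the output is reversed. -/
def bitsStep (s : List Data × List (Fin 2)) : List Data × List (Fin 2) :=
  bif s.1.isEmpty then s
  else bif (s.1.headD .nil).isCons then
    ((s.1.headD .nil).left :: (s.1.headD .nil).right :: s.1.tail, 1 :: s.2)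
  else (s.1.tail, 0 :: s.2)

lemma bitsStep_iterate (d : Data) (l : List Data) (o : List (Fin 2)) :
    bitsStep^[d.size] (d :: l, o) = (l, d.bits.reverse ++ o) := by
  induction d generalizing l o with
  | nil => rfl
  | cons a b iha ihb =>
    have : (Data.cons a b).size = b.size + (a.size + 1) := by simp only [Data.size]; omega
    rw [this, Function.iterate_add_apply, Function.iterate_add_apply]
    change bitsStep^[b.size] (bitsStep^[a.size] (a :: b :: l, 1 :: o)) = _
    rw [iha, ihb]
    simp [Data.bits]

lemma iterate_of_fixed {σ : Type} {f : σ → σ} {s : σ} (h : f s = s) (n : ℕ) : f^[n] s = s :=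
  Function.iterate_fixed h n

/-- Loops are polynomial-time if they stop after polynomially many steps and the states have
polynomial size. -/
lemma PolyTime.loop {i : α → σ} {f : σ → σ} {c : σ → Bool} {N B : α → ℕ} (hi : PolyTime i)
    (hf : PolyTime f) (hc : PolyTime c) (hfix : ∀ s, c s = false → f s = s)
    (hN : ∀ a, c (f^[N a] (i a)) = false) (hNb : PolyBdd N) (hBb : PolyBdd B)
    (hB : ∀ a k, esize (f^[k] (i a)) ≤ B a) : PolyTime fun a => f^[N a] (i a) := by
  obtain ⟨p, T, hT, hp⟩ := hi
  obtain ⟨q, U, ⟨d, hU⟩, hq⟩ := hf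
  obtain ⟨r, V, ⟨e, hV⟩, hr⟩ := hc
  have key : ∀ (n K b : ℕ) (s : σ), c (f^[n] s) = false → (∀ k, esize (f^[k] s) ≤ b) →
      K = b + (b + 1) ^ d + (b + 1) ^ e →
      ∃ t ≤ (n + 1) * K, Runs (.loop r q) (enc s) (enc (f^[n] s)) t := by
    intro n K b
    induction n with
    | zero =>
      intro s hs hb hK
      obtain ⟨v, hv, hrv⟩ := hr s
      have h0 : esize s ≤ b := hb 0
      have h1 := hv.trans ((hV s).trans (Nat.pow_le_pow_left (by omega : _ ≤ b + 1) e))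
      rw [Function.iterate_zero_apply] at hs ⊢
      rw [hs] at hrv
      refine ⟨_, ?_, .loop_done hrv⟩
      simp only [esize] at h0
      omega
    | succ n ih =>
      intro s hs hb hK
      obtain ⟨v, hv, hrv⟩ := hr s
      have h0 : esize s ≤ b := hb 0
      have h1 := hv.trans ((hV s).trans (Nat.pow_le_pow_left (by omega : _ ≤ b + 1) e))
      cases hcs : c s with
      | false =>
        -- The loop may stop before the `n` steps are over; a state that fails the test is fixed by
        -- `f`, so it already is the iterate.
        rw [iterate_of_fixed (hfix s hcs)]
        rw [hcs] at hrv
        refine ⟨_, ?_, .loop_done hrv⟩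
        simp only [esize] at h0
        rw [add_mul (n + 1)]
        omega
      | true =>
        obtain ⟨u, hu, hqu⟩ := hq s
        have h2 := hu.trans ((hU s).trans (Nat.pow_le_pow_left (by omega : _ ≤ b + 1) d))
        obtain ⟨t, ht, hrt⟩ := ih (f s) hs (fun k => hb (k + 1)) hK
        rw [hcs] at hrv
        refine ⟨_, ?_, .loop_step hrv hqu hrt⟩
        simp only [esize] at h0
        rw [add_mul (n + 1)]
        omega
  refine ⟨.comp p (.loop r q),
    fun a => T a + (N a + 1) * (B a + (B a + 1) ^ d + (B a + 1) ^ e), hT.add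
      ((hNb.add (.const 1)).mul ((hBb.add ((hBb.add (.const 1)).pow d)).add
        ((hBb.add (.const 1)).pow e))), fun a => ?_⟩
  obtain ⟨t, ht, hrt⟩ := hp a
  obtain ⟨u, hu, hru⟩ := key (N a) _ (B a) (i a) (hN a) (hB a) rfl
  exact ⟨_, add_le_add ht hu, .comp hrt hru⟩

lemma esize_data (d : Data) : esize d = d.size := rfl

lemma esize_fin_two_le (b : Fin 2) : esize b ≤ 3 := by revert b; decide

@[fun_prop]
lemma PolyTime.bits {f : α → Data} (hf : PolyTime f) : PolyTime fun a => (f a).bits := by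
  refine PolyTime.comp (g := Data.bits) ?_ hf
  have : Data.bits = fun d : Data => (bitsStep^[d.size] ([d], [])).2.reverse := by
    funext d; simp [bitsStep_iterate]
  rw [this]
  refine PolyTime.reverse (PolyTime.snd (PolyTime.loop (c := fun s => !s.1.isEmpty)
    (B := fun d => 5 * (d.size + 4)) (by fun_prop) (by unfold bitsStep; fun_prop) (by fun_prop)
    ?_ ?_ .esize (((PolyBdd.const 5).mul (PolyBdd.esize.add (.const 4)))) ?_))
  · rintro ⟨l, o⟩ h
    simp only [Bool.not_eq_false'] at h
    simp [bitsStep, h]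
  · intro d; simp [bitsStep_iterate]
  · intro d k
    -- A potential argument: every step removes one node from the stack, worth 4, and writes one
    -- symbol, which enlarges the output by at most 4.
    have key : ∀ k, 4 * ((bitsStep^[k] ([d], [])).1.map Data.size).sum +
        esize (bitsStep^[k] ([d], [])).2 ≤ 4 * d.size + 1 := by
      intro k
      induction k with
      | zero => simp
      | succ k ih =>
        rw [Function.iterate_succ_apply']
        generalize bitsStep^[k] ([d], []) = s at ih
        obtain ⟨l, o⟩ := s
        have h0 := esize_fin_two_le 0
        have h1 := esize_fin_two_le 1
        match l with
        | [] => simpa [bitsStep] using ih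
        | .nil :: l => simp [bitsStep, Data.isCons, Data.size] at ih ⊢; omega
        | .cons a b :: l =>
          simp [bitsStep, Data.isCons, Data.left, Data.right, Data.size] at ih ⊢
          omega
    have h1 := key k
    have h2 : ∀ l : List Data, esize l ≤ 2 * (l.map Data.size).sum + 1 := by
      intro l
      induction l with
      | nil => simp
      | cons a l ih => have := a.size_pos; simp [esize_data]; omega
    have h3 := h2 (bitsStep^[k] ([d], [])).1
    rw [← Prod.mk.eta (p := bitsStep^[k] ([d], [])), esize_prod]
    omega

/-- The tree written by a string. -/
def parse (l : List (Fin 2)) : Data :=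
  (l.foldr (fun b s => bif b == 0 then .nil :: s
    else .cons (s.headD .nil) (s.tail.headD .nil) :: s.tail.tail) []).headD .nil

/-- Read from the right, a string drives a stack: 0 pushes a leaf, 1 joins the two topmost trees.
For the induction, the strings following and the stacks below have to be arbitrary. -/
lemma parse_bits (d : Data) : parse d.bits = d := by
  have key : ∀ (d : Data) (l : List (Fin 2)) (s : List Data),
      (d.bits ++ l).foldr (fun b s => bif b == 0 then .nil :: s
        else .cons (s.headD .nil) (s.tail.headD .nil) :: s.tail.tail) s =
      d :: l.foldr (fun b s => bif b == 0 then .nil :: s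
        else .cons (s.headD .nil) (s.tail.headD .nil) :: s.tail.tail) s := by
    intro d
    induction d with
    | nil => intro l s; simp [Data.bits]
    | cons a b iha ihb =>
      intro l s
      rw [Data.bits, List.cons_append, List.foldr_cons, List.append_assoc, iha, ihb]
      rfl
  have := key d [] []
  rw [List.append_nil] at this
  rw [parse, this]
  rfl

lemma Data.bits_injective : Function.Injective Data.bits := fun d e h => by
  rw [← parse_bits d, h, parse_bits]

/-- Being the first symbol of the alphabet. -/
lemma PolyTime.fin_two_eq_zero {f : α → Fin 2} (hf : PolyTime f) : PolyTime fun a => f a == 0 := by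
  have : (fun a => f a == 0) = fun a => bif !(f a == 0) then false else true := by
    funext a; cases f a == 0 <;> rfl
  rw [this]
  refine .branch hf (fun a => ?_) (by fun_prop) (by fun_prop)
  generalize f a = b
  revert b; decide

@[fun_prop]
lemma PolyTime.parse {l : α → List (Fin 2)} (hl : PolyTime l) : PolyTime fun a => parse (l a) := by
  refine PolyTime.comp (g := ParamComplexity.parse) ?_ hl
  have : ParamComplexity.parse = fun l : List (Fin 2) => (l.reverse.foldl
      (fun s b => bif b == 0 then .nil :: s
        else .cons (s.headD .nil) (s.tail.headD .nil) :: s.tail.tail) []).headD .nil := by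
    funext l; rw [List.foldl_reverse]; rfl
  rw [this]
  refine PolyTime.headD (PolyTime.foldl (D := fun _ => 4) (by fun_prop) ?_ (by fun_prop) (.const 4)
    ?_) (by fun_prop)
  · exact (PolyTime.fin_two_eq_zero (by fun_prop)).cond (by fun_prop) (by fun_prop)
  · intro a s b _
    cases b == 0
    · rcases s with _ | ⟨x, _ | ⟨y, s⟩⟩ <;> simp [esize_data, Data.size] <;> omega
    · simp [esize_data, Data.size]; omega

/-! ### Equality -/

/-- Equality of strings, symbol by symbol. -/
lemma PolyTime.bits_beq {l l' : α → List (Fin 2)} (hl : PolyTime l) (hl' : PolyTime l') :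
    PolyTime fun a => l a == l' a := by
  have key : ∀ (l l' : List (Fin 2)) (b : Bool),
      l.foldl (fun s x => (s.1.tail, s.2 && !s.1.isEmpty && ((s.1.headD 0 == 0) == (x == 0))))
        (l', b) = (l'.drop l.length, b && (l == l'.take l.length)) := by
    intro l
    induction l with
    | nil => simp
    | cons x l ih =>
      intro l' b
      rw [List.foldl_cons, ih]
      have h : ∀ x y : Fin 2, ((y == 0) == (x == 0)) = (x == y) := by decide
      cases l' with
      | nil => simp
      | cons y l' => simp [h, Bool.and_assoc]
  have : (fun a => l a == l' a) = fun a =>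
      (((l a).foldl (fun s x =>
        (s.1.tail, s.2 && !s.1.isEmpty && ((s.1.headD 0 == 0) == (x == 0))))
        (l' a, true)).1.isEmpty && ((l a).foldl (fun s x =>
        (s.1.tail, s.2 && !s.1.isEmpty && ((s.1.headD 0 == 0) == (x == 0))))
        (l' a, true)).2) := by
    funext a
    rw [key, Bool.eq_iff_iff]
    simp only [beq_iff_eq, Bool.true_and, Bool.and_eq_true, List.isEmpty_iff, List.drop_eq_nil_iff]
    constructor
    · intro h; simp [h]
    · rintro ⟨h, h'⟩; rwa [List.take_of_length_le h] at h'
  have hbeq : ∀ {δ : Type} [Enc δ] {b c : δ → Bool}, PolyTime b → PolyTime c →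
      PolyTime fun a => b a == c a := by
    intro δ _ b c hb hc
    have : (fun a => b a == c a) = fun a => bif b a then c a else !(c a) := by
      funext a; cases b a <;> cases c a <;> rfl
    rw [this]; fun_prop
  rw [this]
  have hs : PolyTime fun a => (l a).foldl (fun s x =>
        (s.1.tail, s.2 && !s.1.isEmpty && ((s.1.headD 0 == 0) == (x == 0)))) (l' a, true) := by
    refine PolyTime.foldl (D := fun _ => 3) (by fun_prop) ?_ (by fun_prop) (.const 3) ?_
    · refine PolyTime.prodMk (by fun_prop) (PolyTime.and (by fun_prop) (hbeq ?_ ?_))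
      · exact PolyTime.fin_two_eq_zero (by fun_prop)
      · exact PolyTime.fin_two_eq_zero (by fun_prop)
    · rintro a ⟨s, b⟩ x _
      simp only [esize_prod]
      have h1 := esize_bool_le (b && !s.isEmpty && ((s.headD 0 == 0) == (x == 0)))
      have h2 : esize s.tail ≤ esize s := by cases s <;> simp; omega
      omega
  fun_prop

/-- Encodings from which the element can be recovered. -/
class EncInj (α : Type) [Enc α] : Prop where
  enc_injective : Function.Injective (enc : α → Data)

instance : EncInj ℕ := ⟨fun m n h => by
  have h' : esize m = esize n := congrArg Data.size h
  simpa using h'⟩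

instance {m : ℕ} : EncInj (Fin m) := ⟨fun a b h =>
  Fin.ext (EncInj.enc_injective (α := ℕ) (show enc a.val = enc b.val from h))⟩

instance : EncInj Bool := ⟨by intro a b; cases a <;> cases b <;> simp [enc]⟩

instance [EncInj α] [EncInj β] : EncInj (α × β) := ⟨by
  rintro ⟨a, b⟩ ⟨c, d⟩ h
  simp only [enc_prod, Data.cons.injEq] at h
  rw [EncInj.enc_injective h.1, EncInj.enc_injective h.2]⟩

instance [EncInj α] : EncInj (List α) := ⟨by
  intro l
  induction l with
  | nil => intro l' h; cases l' with
    | nil => rfl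
    | cons b l' => simp [enc_list_nil, enc_list_cons] at h
  | cons a l ih => intro l' h; cases l' with
    | nil => simp [enc_list_nil, enc_list_cons] at h
    | cons b l' =>
      simp only [enc_list_cons, Data.cons.injEq] at h
      rw [EncInj.enc_injective h.1, ih h.2]⟩

@[fun_prop]
-- Elements of an injectively encoded type are equal iff the preorder strings of their trees are, so
-- one comparison of strings settles all types.
lemma PolyTime.beq [EncInj β] [BEq β] [LawfulBEq β] {f g : α → β} (hf : PolyTime f)
    (hg : PolyTime g) : PolyTime fun a => f a == g a := by
  have : (fun a => f a == g a) = fun a => (enc (f a)).bits == (enc (g a)).bits := by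
    funext a
    rw [Bool.eq_iff_iff]
    simp [Data.bits_injective.eq_iff, EncInj.enc_injective.eq_iff]
  rw [this]
  exact PolyTime.bits_beq (by fun_prop) (by fun_prop)

@[fun_prop]
lemma PolyTime.bne [EncInj β] [BEq β] [LawfulBEq β] {f g : α → β} (hf : PolyTime f)
    (hg : PolyTime g) : PolyTime fun a => f a != g a := by
  unfold _root_.bne; fun_prop

@[fun_prop]
lemma PolyTime.elem [EncInj β] [BEq β] [LawfulBEq β] {f : α → β} {l : α → List β}
    (hf : PolyTime f) (hl : PolyTime l) : PolyTime fun a => (l a).elem (f a) := by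
  have : (fun a => (l a).elem (f a)) = fun a => (l a).any fun x => f a == x := by
    funext a
    rw [Bool.eq_iff_iff]
    simp
  rw [this]; fun_prop

/-! ### Tuples -/

/-- All lists of length `n` with entries in a list. -/
def tuples {α : Type} : ℕ → List α → List (List α)
  | 0, _ => [[]]
  | n + 1, L => (L.product (tuples n L)).map fun p => p.1 :: p.2

@[fun_prop]
lemma PolyTime.tuples {l : α → List β} (n : ℕ) (hl : PolyTime l) :
    PolyTime fun a => tuples n (l a) := by
  induction n with
  | zero => exact .const _
  | succ n ih =>
    unfold ParamComplexity.tuples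
    fun_prop

lemma mem_tuples {α : Type} {n : ℕ} {L t : List α} :
    t ∈ tuples n L ↔ t.length = n ∧ ∀ x ∈ t, x ∈ L := by
  induction n generalizing t with
  | zero =>
    simp only [tuples, List.mem_singleton, List.length_eq_zero_iff]
    constructor
    · rintro rfl; simp
    · exact fun h => h.1
  | succ n ih =>
    have hp : ∀ a b, (a, b) ∈ L.product (tuples n L) ↔ a ∈ L ∧ b ∈ tuples n L :=
      fun a b => List.pair_mem_product
    simp only [tuples, List.mem_map, Prod.exists, hp, ih]
    constructor
    · rintro ⟨a, b, ⟨ha, hb, hb'⟩, rfl⟩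
      simp only [List.length_cons, hb, List.mem_cons, true_and]
      rintro x (rfl | hx)
      · exact ha
      · exact hb' x hx
    · rintro ⟨h, h'⟩
      cases t with
      | nil => simp at h
      | cons a b =>
        exact ⟨a, b, ⟨h' a (by simp), by simpa using h, fun x hx => h' x (by simp [hx])⟩, rfl⟩

lemma length_tuples {α : Type} (n : ℕ) (L : List α) : (tuples n L).length = L.length ^ n := by
  induction n with
  | zero => simp [tuples]
  | succ n ih =>
    rw [tuples, List.length_map, pow_succ', ← ih]
    exact List.length_product L (tuples n L)

lemma nodup_tuples {α : Type} (n : ℕ) {L : List α} (h : L.Nodup) : (tuples n L).Nodup := by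
  induction n with
  | zero => simp [tuples]
  | succ n ih =>
    refine List.Nodup.map ?_ (h.product ih)
    rintro ⟨a, b⟩ ⟨c, d⟩ e
    simpa using e

end Library

/-! ### Gates and circuits as data -/

namespace Data

/-- The list that a tree represents. -/
def toList : Data → List Data
  | nil => []
  | cons a b => a :: b.toList

/-- The number that a tree represents. -/
def toNat (d : Data) : ℕ := d.toList.length

/-- The list of numbers that a tree represents. -/
def toNats (d : Data) : List ℕ := d.toList.map toNat

lemma ofList_toList (d : Data) : ofList d.toList = d := by
  induction d with
  | nil => rfl
  | cons a b _ ih => rw [toList, ofList, ih]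

lemma toList_ofList (l : List Data) : (ofList l).toList = l := by
  induction l with
  | nil => rfl
  | cons a l ih => rw [ofList, toList, ih]

lemma toNat_ofNat (n : ℕ) : (ofNat n).toNat = n := by
  induction n with
  | zero => rfl
  | succ n ih => exact congrArg (· + 1) ih

lemma toNats_ofList (l : List ℕ) : (ofList (l.map ofNat)).toNats = l := by
  rw [toNats, toList_ofList, List.map_map]
  conv_rhs => rw [← List.map_id l]
  exact List.map_congr_left fun n _ => toNat_ofNat n

end Data

namespace Gate

/-- The kind of a gate: conjunction, disjunction or negation. -/
def kind : Gate → ℕ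
  | and _ => 0
  | or _ => 1
  | not _ => 2

/-- The gate that a tree represents. -/
def ofData (d : Data) : Gate :=
  bif d.left.toNat == 0 then .and d.right.toNats
  else bif d.left.toNat == 1 then .or d.right.toNats else .not d.right.toNat

lemma ofData_toData (g : Gate) : ofData g.toData = g := by
  cases g <;> simp [ofData, toData, Data.left, Data.right, Data.toNat_ofNat, Data.toNats_ofList]

end Gate

section PolyTime

variable {α β : Type} [Enc α] [Enc β]

@[fun_prop]
lemma PolyTime.data_toList {f : α → Data} (hf : PolyTime f) : PolyTime fun a => (f a).toList := by
  refine PolyTime.comp (g := Data.toList) (.of_enc_eq fun d => ?_) hf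
  change Data.ofList (d.toList.map _root_.id) = d
  rw [List.map_id, Data.ofList_toList]

@[fun_prop]
lemma PolyTime.data_toNat {f : α → Data} (hf : PolyTime f) : PolyTime fun a => (f a).toNat := by
  unfold Data.toNat; fun_prop

@[fun_prop]
lemma PolyTime.data_toNats {f : α → Data} (hf : PolyTime f) :
    PolyTime fun a => (f a).toNats := by
  unfold Data.toNats; fun_prop

/-- Functions with the same encoded values take the same time. -/
lemma PolyTime.of_enc {γ : Type} [Enc γ] {f : α → β} {g : α → γ} (hg : PolyTime g)
    (h : ∀ a, enc (f a) = enc (g a)) : PolyTime f := by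
  obtain ⟨p, T, hT, hp⟩ := hg
  exact ⟨p, T, hT, fun a => by rw [h]; exact hp a⟩

@[fun_prop]
lemma PolyTime.gate_and {f : α → List ℕ} (hf : PolyTime f) : PolyTime fun a => Gate.and (f a) :=
  .of_enc ((PolyTime.const 0).prodMk hf) fun _ => rfl

@[fun_prop]
lemma PolyTime.gate_or {f : α → List ℕ} (hf : PolyTime f) : PolyTime fun a => Gate.or (f a) :=
  .of_enc ((PolyTime.const 1).prodMk hf) fun _ => rfl

@[fun_prop]
lemma PolyTime.gate_not {f : α → ℕ} (hf : PolyTime f) : PolyTime fun a => Gate.not (f a) :=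
  .of_enc ((PolyTime.const 2).prodMk hf) fun _ => rfl

@[fun_prop]
lemma PolyTime.gate_kind {f : α → Gate} (hf : PolyTime f) : PolyTime fun a => (f a).kind := by
  have : (fun a => (f a).kind) = fun a => (enc (f a)).left.toNat := by
    funext a
    cases f a <;> simp [enc, Gate.kind, Gate.toData, Data.left, Data.toNat_ofNat]
  rw [this]; fun_prop

@[fun_prop]
lemma PolyTime.gate_inputs {f : α → Gate} (hf : PolyTime f) :
    PolyTime fun a => (f a).inputs := by
  have : (fun a => (f a).inputs) = fun a => bif (f a).kind == 2 then [(enc (f a)).right.toNat]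
      else (enc (f a)).right.toNats := by
    funext a
    cases f a <;> simp [enc, Gate.kind, Gate.toData, Data.right, Data.toNat_ofNat, Gate.inputs,
      Data.toNats_ofList]
  rw [this]; fun_prop

@[fun_prop]
lemma PolyTime.gate_ofData {f : α → Data} (hf : PolyTime f) :
    PolyTime fun a => Gate.ofData (f a) := by
  unfold Gate.ofData; fun_prop

end PolyTime

/-! ### Labellings of the nodes -/

/-- The labels of all nodes, given the labels of the variables. -/
def labels {β : Type} [Inhabited β] (step : Gate → (ℕ → β) → β) (vars : List β)
    (gs : List Gate) : List β :=
  gs.foldl (fun vs g => vs ++ [step g fun i => vs.getD i default]) vars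

/-- The gates are in topological order after `n` variables. -/
def TopoOrdered (n : ℕ) (gs : List Gate) : Prop :=
  ∀ (j : ℕ) (hj : j < gs.length), ∀ i ∈ (gs[j]).inputs, i < n + j

section Labels

variable {β : Type} [Inhabited β] {step : Gate → (ℕ → β) → β} {vars : List β}

lemma labels_append_singleton (gs : List Gate) (g : Gate) :
    labels step vars (gs ++ [g]) =
      labels step vars gs ++ [step g fun i => (labels step vars gs).getD i default] := by
  simp [labels, List.foldl_append]

lemma length_labels (gs : List Gate) : (labels step vars gs).length = vars.length + gs.length := by
  induction gs using List.reverseRecOn with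
  | nil => rfl
  | append_singleton gs g ih => simp [labels_append_singleton, ih, add_assoc]

lemma labels_getD_var (gs : List Gate) {i : ℕ} (hi : i < vars.length) :
    (labels step vars gs).getD i default = vars.getD i default := by
  induction gs using List.reverseRecOn with
  | nil => rfl
  | append_singleton gs g ih =>
    rw [labels_append_singleton, List.getD_append _ _ _ _ (by rw [length_labels]; omega), ih]

/-- The fold computes the label of gate `j` from a prefix of the labels. By topological order that
prefix contains all its inputs, and later steps only append. -/
lemma labels_getD_gate {gs : List Gate}
    (hstep : ∀ g f f', (∀ i ∈ Gate.inputs g, f i = f' i) → step g f = step g f')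
    (hgs : TopoOrdered vars.length gs) {j : ℕ} (hj : j < gs.length) :
    (labels step vars gs).getD (vars.length + j) default =
      step gs[j] fun i => (labels step vars gs).getD i default := by
  induction gs using List.reverseRecOn with
  | nil => simp at hj
  | append_singleton gs g ih =>
    have hgs' : TopoOrdered vars.length gs := fun k hk i hi =>
      hgs k (by simp; omega) i (by rwa [List.getElem_append_left hk])
    have hin : ∀ i ∈ ((gs ++ [g])[j]).inputs, i < vars.length + j := hgs j hj
    rw [labels_append_singleton]
    have hloc : step (gs ++ [g])[j] (fun i => (labels step vars gs ++
          [step g fun i => (labels step vars gs).getD i default]).getD i default) =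
        step (gs ++ [g])[j] fun i => (labels step vars gs).getD i default := by
      refine hstep _ _ _ fun i hi => ?_
      have := hin i hi
      simp only [List.length_append, List.length_singleton] at hj
      exact List.getD_append _ _ _ _ (by rw [length_labels]; omega)
    rw [hloc]
    by_cases hj' : j < gs.length
    · rw [List.getD_append _ _ _ _ (by rw [length_labels]; omega), ih hgs' hj']
      simp only [List.getElem_append_left hj']
    · obtain rfl : j = gs.length := by simp at hj; omega
      rw [List.getD_append_right _ _ _ _ (by rw [length_labels])]
      simp [length_labels]

/-- A labelling that satisfies the local rule is the one computed by `labels`. -/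
lemma labels_unique {gs : List Gate}
    (hstep : ∀ g f f', (∀ i ∈ Gate.inputs g, f i = f' i) → step g f = step g f')
    (hgs : TopoOrdered vars.length gs) {f : ℕ → β}
    (hv : ∀ i < vars.length, f i = vars.getD i default)
    (hg : ∀ (j : ℕ) (hj : j < gs.length), f (vars.length + j) = step gs[j] f) :
    ∀ i < vars.length + gs.length, f i = (labels step vars gs).getD i default := by
  intro i
  induction i using Nat.strong_induction_on with
  | _ i ih =>
    intro hi
    by_cases h : i < vars.length
    · rw [hv i h, labels_getD_var gs h]
    · obtain ⟨j, rfl⟩ : ∃ j, i = vars.length + j := ⟨i - vars.length, by omega⟩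
      have hj : j < gs.length := by omega
      rw [hg j hj, labels_getD_gate hstep hgs hj]
      refine hstep _ _ _ fun k hk => ?_
      have := hgs j hj k hk
      exact ih k this (by omega)

end Labels

/-- The label of a node is the largest label of the nodes that feed it, plus a gate cost. -/
def levelStep (δ : Gate → ℕ) (g : Gate) (d : ℕ → ℕ) : ℕ := δ g + (g.inputs.map d).foldr max 0

lemma levelStep_congr (δ : Gate → ℕ) (g : Gate) (f f' : ℕ → ℕ)
    (h : ∀ i ∈ g.inputs, f i = f' i) : levelStep δ g f = levelStep δ g f' := by
  rw [levelStep, levelStep, List.map_congr_left h]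

lemma le_foldr_max {l : List ℕ} {x : ℕ} (h : x ∈ l) : x ≤ l.foldr max 0 := by
  induction l with
  | nil => simp at h
  | cons y l ih =>
    rcases List.mem_cons.1 h with rfl | h
    · simp
    · simp [ih h]

lemma foldr_max_le {l : List ℕ} {B : ℕ} (h : ∀ x ∈ l, x ≤ B) : l.foldr max 0 ≤ B := by
  induction l with
  | nil => simp
  | cons y l ih => simp [h y (by simp), ih fun x hx => h x (by simp [hx])]

/-- The levels of all nodes. -/
def levels (δ : Gate → ℕ) (n : ℕ) (gs : List Gate) : List ℕ :=
  labels (levelStep δ) (List.replicate n 0) gs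

/-- This keeps the numbers that occur in the computation of depth and weft polynomially small. -/
lemma levels_le {δ : Gate → ℕ} (hδ : ∀ g, δ g ≤ 1) (n : ℕ) (gs : List Gate) :
    ∀ x ∈ levels δ n gs, x ≤ gs.length := by
  induction gs using List.reverseRecOn with
  | nil => simp [levels, labels]
  | append_singleton gs g ih =>
    unfold levels at *
    rw [labels_append_singleton]
    intro x hx
    rw [List.length_append, List.length_singleton]
    rcases List.mem_append.1 hx with hx | hx
    · exact (ih x hx).trans (by omega)
    · rw [List.mem_singleton.1 hx]
      have : (g.inputs.map fun i => (labels (levelStep δ) (List.replicate n 0) gs).getD i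
          default).foldr max 0 ≤ gs.length := by
        refine foldr_max_le fun y hy => ?_
        obtain ⟨i, -, rfl⟩ := List.mem_map.1 hy
        rw [List.getD_eq_getElem?_getD]
        cases h : (labels (levelStep δ) (List.replicate n 0) gs)[i]? with
        | none => simp
        | some y => exact ih y (List.mem_of_getElem? h)
      have := hδ g
      unfold levelStep at *
      omega

section PolyTime

variable {α β : Type} [Enc α] [Enc β]

@[fun_prop]
lemma PolyTime.levels {δ : Gate → ℕ} (hδ : PolyTime δ) (hδ' : ∀ g, δ g ≤ 1) {n : α → ℕ}
    {gs : α → List Gate} (hn : PolyTime n) (hgs : PolyTime gs) :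
    PolyTime fun a => levels δ (n a) (gs a) := by
  unfold ParamComplexity.levels labels levelStep
  refine PolyTime.foldl_of_bound
    (B := fun a => (esize (n a) + esize (gs a)) * (2 * esize (gs a) + 1 + 1) + 1)
    hgs ?_ (by fun_prop)
    (((hn.size.add hgs.size).mul ((((PolyBdd.const 2).mul hgs.size).add (.const 1)).add
      (.const 1))).add (.const 1)) ?_
  · have : (default : ℕ) = 0 := rfl
    simp only [this]
    fun_prop
  · intro a l₁ l₂ e
    change esize (ParamComplexity.levels δ (n a) l₁) ≤ _
    have h1 := length_lt_esize (gs a)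
    have h2 : l₁.length ≤ (gs a).length := by simp [e]
    refine (esize_list_le _ (2 * esize (gs a) + 1) ?_).trans ?_
    · intro x hx
      have := levels_le hδ' (n a) l₁ x hx
      simp only [esize_nat]
      omega
    · unfold ParamComplexity.levels
      rw [length_labels, List.length_replicate, esize_nat]
      gcongr <;> omega

@[fun_prop]
lemma PolyTime.labels_all {vars : α → List Bool} {gs : α → List Gate} (hv : PolyTime vars)
    (hgs : PolyTime gs) :
    PolyTime fun a => labels (fun g d => g.inputs.all d) (vars a) (gs a) := by
  unfold labels
  refine PolyTime.foldl (D := fun _ => 4) hgs (by fun_prop) hv (.const 4) ?_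
  intro a s g _
  have := esize_append s [g.inputs.all fun i => s.getD i default]
  have := esize_bool_le (g.inputs.all fun i => s.getD i default)
  simp at *
  omega

end PolyTime

/-! ### Recognizing circuits -/

/-- The components of a circuit. -/
abbrev Raw : Type := ℕ × ℕ × List Gate × ℕ

namespace Circuit

/-- The components of a circuit. -/
def raw (C : Circuit) : Raw := (C.n₁, C.n₂, C.gates, C.out)

lemma raw_injective : Function.Injective raw := by
  rintro ⟨n₁, n₂, gs, o, h, h'⟩ ⟨m₁, m₂, gs', o', k, k'⟩ e
  simp only [raw, Prod.mk.injEq] at e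
  obtain ⟨rfl, rfl, rfl, rfl⟩ := e
  rfl

lemma code_eq (C : Circuit) : C.code = (enc C.raw).bits := rfl

end Circuit

namespace Raw

/-- The components of the circuit that a string represents. -/
def decode (x : List (Fin 2)) : Raw :=
  ((parse x).left.toNat, (parse x).right.left.toNat,
    (parse x).right.right.left.toList.map Gate.ofData, (parse x).right.right.right.toNat)

lemma decode_code (C : Circuit) : decode C.code = C.raw := by
  have h : ∀ gs : List Gate, (Data.ofList (gs.map Gate.toData)).toList.map Gate.ofData = gs := by
    intro gs
    rw [Data.toList_ofList, List.map_map]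
    conv_rhs => rw [← List.map_id gs]
    exact List.map_congr_left fun g _ => Gate.ofData_toData g
  simp [decode, Circuit.code, parse_bits, Data.left, Data.right, Data.toNat_ofNat, h, Circuit.raw]

/-- The components are those of a circuit. -/
def wellFormed (r : Raw) : Bool :=
  (r.2.2.1.zipIdx.all fun x => x.1.inputs.all fun i => Nat.ble (i + 1) (r.1 + r.2.1 + x.2)) &&
    Nat.ble (r.2.2.2 + 1) (r.1 + r.2.1 + r.2.2.1.length)

lemma wellFormed_iff (r : Raw) : r.wellFormed = true ↔ ∃ C : Circuit, C.raw = r := by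
  obtain ⟨n₁, n₂, gs, o⟩ := r
  simp only [wellFormed, Bool.and_eq_true, List.all_eq_true, Nat.ble_eq, Prod.forall]
  constructor
  · rintro ⟨h, h'⟩
    refine ⟨⟨n₁, n₂, gs, o, fun j hj i hi => ?_, h'⟩, rfl⟩
    exact h _ j (List.mk_mem_zipIdx_iff_getElem?.2 (List.getElem?_eq_getElem hj)) i hi
  · rintro ⟨C, hC⟩
    simp only [Circuit.raw, Prod.mk.injEq] at hC
    obtain ⟨rfl, rfl, rfl, rfl⟩ := hC
    refine ⟨fun g j hg i hi => ?_, C.out_lt⟩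
    have h1 := List.mk_mem_zipIdx_iff_getElem?.1 hg
    obtain ⟨hj, rfl⟩ := List.getElem?_eq_some_iff.1 h1
    exact C.inputs_lt j hj i hi

end Raw

/-- The string represents a circuit. -/
def isCode (x : List (Fin 2)) : Bool :=
  (enc (Raw.decode x)).bits == x && (Raw.decode x).wellFormed

/-- Decoding is total and ignores malformed parts; encoding the result again and comparing with the
input detects them. -/
lemma isCode_iff (x : List (Fin 2)) : isCode x = true ↔ ∃ C : Circuit, x = C.code := by
  simp only [isCode, Bool.and_eq_true, beq_iff_eq, Raw.wellFormed_iff]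
  constructor
  · rintro ⟨h, C, hC⟩
    exact ⟨C, by rw [C.code_eq, hC, h]⟩
  · rintro ⟨C, rfl⟩
    rw [Raw.decode_code]
    exact ⟨rfl, C, rfl⟩

lemma Circuit.code_injective : Function.Injective Circuit.code := fun C D h =>
  Circuit.raw_injective (by rw [← Raw.decode_code, h, Raw.decode_code])

section PolyTime

variable {α β : Type} [Enc α] [Enc β]

@[fun_prop]
lemma PolyTime.raw_decode {f : α → List (Fin 2)} (hf : PolyTime f) :
    PolyTime fun a => Raw.decode (f a) := by
  unfold Raw.decode; fun_prop

@[fun_prop]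
lemma PolyTime.raw_wellFormed {f : α → Raw} (hf : PolyTime f) :
    PolyTime fun a => (f a).wellFormed := by
  unfold Raw.wellFormed; fun_prop

@[fun_prop]
lemma PolyTime.isCode {f : α → List (Fin 2)} (hf : PolyTime f) :
    PolyTime fun a => isCode (f a) := by
  unfold ParamComplexity.isCode; fun_prop

end PolyTime

/-! ### Classes of circuits -/

/-- The cost of a gate that counts as large if its fan-in is more than `s`. -/
def weftCost (s : ℕ) (g : Gate) : ℕ := bif Nat.ble g.inputs.length s then 0 else 1

lemma weftCost_le (s : ℕ) (g : Gate) : weftCost s g ≤ 1 := by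
  unfold weftCost; cases Nat.ble g.inputs.length s <;> simp

lemma weftCost_eq (s : ℕ) (g : Gate) : weftCost s g = if s < g.inputs.length then 1 else 0 := by
  unfold weftCost
  by_cases h : s < g.inputs.length
  · rw [if_pos h]
    have : Nat.ble g.inputs.length s = false := by
      rw [← Bool.not_eq_true, Nat.ble_eq]; omega
    rw [this]; rfl
  · rw [if_neg h]
    have : Nat.ble g.inputs.length s = true := by
      rw [Nat.ble_eq]; omega
    rw [this]; rfl

/-- The circuits of depth at most `u` in which every path to the output has at most one gate of
fan-in more than `s`. -/
def WeftOne (s u : ℕ) : Set Circuit :=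
  {C | (levels (fun _ => 1) (C.n₁ + C.n₂) C.gates).getD C.out 0 ≤ u ∧
    (levels (weftCost s) (C.n₁ + C.n₂) C.gates).getD C.out 0 ≤ 1}

/-- The threshold 2 for large gates is replaced by a parameter `s`, so that formulas in `r`-CNF and
`r`-DNF, which have weft one for `s = r`, are covered by the same argument. -/
lemma gam_one_eq (u : ℕ) : Gam 1 u = WeftOne 2 u := by
  ext C
  have h : (fun (g : Gate) (w : ℕ → ℕ) => (if 2 < g.inputs.length then 1 else 0) +
      (g.inputs.map w).foldr max 0) = levelStep (weftCost 2) := by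
    funext g w
    rw [levelStep, weftCost_eq]
  change C.depth ≤ u ∧ C.weft ≤ 1 ↔ _
  unfold Circuit.weft
  rw [h]
  rfl

/-- Whether the circuit is in `WeftOne s u`. -/
def Raw.isWeftOne (s u : ℕ) (r : Raw) : Bool :=
  Nat.ble ((levels (fun _ => 1) (r.1 + r.2.1) r.2.2.1).getD r.2.2.2 0) u &&
    Nat.ble ((levels (weftCost s) (r.1 + r.2.1) r.2.2.1).getD r.2.2.2 0) 1

lemma Raw.isWeftOne_iff (s u : ℕ) (C : Circuit) :
    C.raw.isWeftOne s u = true ↔ C ∈ WeftOne s u := by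
  simp only [Raw.isWeftOne, Circuit.raw, Bool.and_eq_true, Nat.ble_eq]
  rfl

/-- The gate at a node, if there is one. -/
def gateD (n : ℕ) (gs : List Gate) (j : ℕ) : Gate := gs.getD (j - n) (.and [])

/-- Whether a node is a gate of a given kind. -/
def isKind (n : ℕ) (gs : List Gate) (k j : ℕ) : Bool :=
  Nat.ble n j && Nat.ble (j + 1) (n + gs.length) && (gateD n gs j).kind == k

/-- Whether a node is a literal. -/
def isLit (n : ℕ) (gs : List Gate) (j : ℕ) : Bool :=
  Nat.ble (j + 1) n ||
    (isKind n gs 2 j && (gateD n gs j).inputs.all fun i => Nat.ble (i + 1) n)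

/-- Whether every gate has fan-out at most one. -/
def isFormula (n : ℕ) (gs : List Gate) : Bool :=
  ((gs.flatMap fun g => g.inputs).filter fun i => Nat.ble n i).all fun x =>
    Nat.ble (((gs.flatMap fun g => g.inputs).filter fun i => Nat.ble n i).filter
      fun y => y == x).length 1

/-- Whether the circuit is a formula of depth two over literals: a gate of kind `k` that is fed by
gates of kind `l` with at most `r` inputs. -/
def Raw.isNF (k l r : ℕ) (x : Raw) : Bool :=
  isFormula (x.1 + x.2.1) x.2.2.1 && (isKind (x.1 + x.2.1) x.2.2.1 k x.2.2.2 &&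
    (gateD (x.1 + x.2.1) x.2.2.1 x.2.2.2).inputs.all fun j =>
      isKind (x.1 + x.2.1) x.2.2.1 l j &&
        (Nat.ble (gateD (x.1 + x.2.1) x.2.2.1 j).inputs.length r &&
          (gateD (x.1 + x.2.1) x.2.2.1 j).inputs.all fun i => isLit (x.1 + x.2.1) x.2.2.1 i))

section PolyTime

variable {α β : Type} [Enc α] [Enc β]

@[fun_prop]
lemma PolyTime.weftCost (s : ℕ) : PolyTime (weftCost s) := by
  unfold ParamComplexity.weftCost; fun_prop

@[fun_prop]
lemma PolyTime.levels_weftCost (s : ℕ) {n : α → ℕ} {gs : α → List Gate} (hn : PolyTime n)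
    (hgs : PolyTime gs) : PolyTime fun a => ParamComplexity.levels (ParamComplexity.weftCost s) (n a) (gs a) :=
  PolyTime.levels (.weftCost s) (weftCost_le s) hn hgs

@[fun_prop]
lemma PolyTime.raw_isWeftOne (s u : ℕ) {f : α → Raw} (hf : PolyTime f) :
    PolyTime fun a => (f a).isWeftOne s u := by
  have h := PolyTime.levels (α := α) (δ := fun _ => 1) (n := fun a => (f a).1 + (f a).2.1)
    (gs := fun a => (f a).2.2.1) (.const 1) (fun _ => le_rfl) (by fun_prop) (by fun_prop)
  unfold Raw.isWeftOne
  fun_prop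

@[fun_prop]
lemma PolyTime.gateD {n : α → ℕ} {gs : α → List Gate} {j : α → ℕ} (hn : PolyTime n)
    (hgs : PolyTime gs) (hj : PolyTime j) : PolyTime fun a => gateD (n a) (gs a) (j a) := by
  unfold ParamComplexity.gateD; fun_prop

@[fun_prop]
lemma PolyTime.raw_isNF (k l r : ℕ) {f : α → Raw} (hf : PolyTime f) :
    PolyTime fun a => (f a).isNF k l r := by
  unfold Raw.isNF isFormula isLit isKind
  fun_prop

end PolyTime

section NF

variable (C : Circuit)

lemma isKind_iff (k j : ℕ) : isKind (C.n₁ + C.n₂) C.gates k j = true ↔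
    ∃ g, C.gateAt j = some g ∧ g.kind = k := by
  simp only [isKind, Circuit.gateAt, gateD, Bool.and_eq_true, Nat.ble_eq, beq_iff_eq]
  constructor
  · rintro ⟨⟨h1, h2⟩, h3⟩
    rw [List.getD_eq_getElem _ _ (by omega)] at h3
    exact ⟨_, by rw [if_neg (by omega), List.getElem?_eq_getElem (by omega)], h3⟩
  · rintro ⟨g, hg, rfl⟩
    split_ifs at hg with h
    obtain ⟨h1, rfl⟩ := List.getElem?_eq_some_iff.1 hg
    refine ⟨⟨by omega, by omega⟩, ?_⟩
    rw [List.getD_eq_getElem _ _ h1]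

lemma gateD_eq {j : ℕ} {g : Gate} (h : C.gateAt j = some g) :
    gateD (C.n₁ + C.n₂) C.gates j = g := by
  simp only [Circuit.gateAt] at h
  split_ifs at h
  obtain ⟨h1, rfl⟩ := List.getElem?_eq_some_iff.1 h
  rw [gateD, List.getD_eq_getElem _ _ h1]

lemma isLit_iff (j : ℕ) : isLit (C.n₁ + C.n₂) C.gates j = true ↔ C.IsLiteral j := by
  simp only [isLit, Circuit.IsLiteral, Bool.or_eq_true, Nat.ble_eq, Bool.and_eq_true, isKind_iff,
    List.all_eq_true, Nat.succ_le_iff]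
  refine or_congr Iff.rfl ⟨?_, ?_⟩
  · rintro ⟨⟨g, hg, hk⟩, h⟩
    rw [gateD_eq C hg] at h
    cases g with
    | and l => simp [Gate.kind] at hk
    | or l => simp [Gate.kind] at hk
    | not i => exact ⟨i, h i (by simp [Gate.inputs]), hg⟩
  · rintro ⟨i, hi, hg⟩
    refine ⟨⟨_, hg, rfl⟩, ?_⟩
    rw [gateD_eq C hg]
    simpa [Gate.inputs] using hi

lemma isFormula_iff : isFormula (C.n₁ + C.n₂) C.gates = true ↔ C.IsFormula := by
  have h : (C.gates.flatMap fun g => g.inputs).filter (fun i => Nat.ble (C.n₁ + C.n₂) i) =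
      (C.gates.flatMap Gate.inputs).filter fun i => C.n₁ + C.n₂ ≤ i := by
    refine List.filter_congr fun i _ => ?_
    rw [Bool.eq_iff_iff]
    simp
  unfold isFormula Circuit.IsFormula
  rw [h, List.nodup_iff_count_le_one]
  simp only [List.all_eq_true, Nat.ble_eq]
  constructor
  · intro h a
    by_cases ha : a ∈ (C.gates.flatMap Gate.inputs).filter fun i => C.n₁ + C.n₂ ≤ i
    · rw [List.count_eq_length_filter]
      exact h a ha
    · rw [List.count_eq_zero_of_not_mem ha]; omega
  · intro h a _
    have := h a
    rwa [List.count_eq_length_filter] at this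

lemma isNF_cnf_iff (r : ℕ) : C.raw.isNF 0 1 r = true ↔ C ∈ CNF r := by
  simp only [Raw.isNF, Circuit.raw, Bool.and_eq_true, isFormula_iff, isKind_iff, List.all_eq_true,
    Nat.ble_eq, isLit_iff]
  refine and_congr Iff.rfl ⟨?_, ?_⟩
  · rintro ⟨⟨g, hg, hk⟩, h⟩
    rw [gateD_eq C hg] at h
    cases g with
    | and l =>
      refine ⟨l, hg, fun j hj => ?_⟩
      obtain ⟨⟨g', hg', hk'⟩, h'⟩ := h j hj
      rw [gateD_eq C hg'] at h'
      cases g' with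
      | or c => exact ⟨c, hg', h'⟩
      | and c => simp [Gate.kind] at hk'
      | not c => simp [Gate.kind] at hk'
    | or l => simp [Gate.kind] at hk
    | not l => simp [Gate.kind] at hk
  · rintro ⟨l, hg, h⟩
    rw [gateD_eq C hg]
    refine ⟨⟨_, hg, rfl⟩, fun j hj => ?_⟩
    obtain ⟨c, hc, h'⟩ := h j hj
    rw [gateD_eq C hc]
    exact ⟨⟨_, hc, rfl⟩, h'⟩

lemma isNF_dnf_iff (r : ℕ) : C.raw.isNF 1 0 r = true ↔ C ∈ DNF r := by
  simp only [Raw.isNF, Circuit.raw, Bool.and_eq_true, isFormula_iff, isKind_iff, List.all_eq_true,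
    Nat.ble_eq, isLit_iff]
  refine and_congr Iff.rfl ⟨?_, ?_⟩
  · rintro ⟨⟨g, hg, hk⟩, h⟩
    rw [gateD_eq C hg] at h
    cases g with
    | or l =>
      refine ⟨l, hg, fun j hj => ?_⟩
      obtain ⟨⟨g', hg', hk'⟩, h'⟩ := h j hj
      rw [gateD_eq C hg'] at h'
      cases g' with
      | and c => exact ⟨c, hg', h'⟩
      | or c => simp [Gate.kind] at hk'
      | not c => simp [Gate.kind] at hk'
    | and l => simp [Gate.kind] at hk
    | not l => simp [Gate.kind] at hk
  · rintro ⟨l, hg, h⟩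
    rw [gateD_eq C hg]
    refine ⟨⟨_, hg, rfl⟩, fun j hj => ?_⟩
    obtain ⟨c, hc, h'⟩ := h j hj
    rw [gateD_eq C hc]
    exact ⟨⟨_, hc, rfl⟩, h'⟩

end NF

/-! ### The reduction to constraints on pairs of choices -/

/-- A claim that a node has a given value. -/
abbrev Claim : Type := ℕ × Bool

/-- A pair of consecutive positions. The `v`-th variable of the second block has position `v + 1`. -/
abbrev Gap : Type := ℕ × ℕ

/-- A choice for a block: the block, whether the choice is a regular one, the certificate, the gaps,
and the literals over the first block that it requires. -/
abbrev Choice : Type := List ℕ × Bool × List Claim × List Gap × List Claim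

namespace Gate

/-- Whether the claim that the gate has value `v` is about all inputs, rather than about one. -/
def conj (g : Gate) (v : Bool) : Bool := g.kind == 2 || ((g.kind == 0) == v)

/-- The value of inputs that is relevant to the claim that the gate has value `v`. -/
def inVal (g : Gate) (v : Bool) : Bool := (g.kind == 2) != v

end Gate

/-- The position of the variable is in one of the closed gaps. -/
def covered (τ : List Gap) (v : ℕ) : Bool :=
  τ.any fun g => Nat.ble g.1 (v + 1) && Nat.ble (v + 1) g.2

/-- The position of the variable is an endpoint of one of the gaps. -/
def guess (τ : List Gap) (v : ℕ) : Bool := τ.any fun g => g.1 == v + 1 || g.2 == v + 1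

/-- All gaps between the positions `0, …, n₂ + 1`. -/
def gaps (n₂ : ℕ) : List Gap :=
  ((List.range (n₂ + 2)).product (List.range (n₂ + 2))).filter fun g => Nat.ble (g.1 + 1) g.2

/-- Whether all variables of the second block on which a node depends are covered. -/
def covers (n₁ n₂ : ℕ) (gs : List Gate) (τ : List Gap) : List Bool :=
  labels (fun g d => g.inputs.all d)
    (List.replicate n₁ true ++ (List.range n₂).map fun v => covered τ v) gs

/-- The weft of a node if gates of fan-in more than `s` count. -/
def weftAt (s n : ℕ) (gs : List Gate) (j : ℕ) : ℕ := (levels (weftCost s) n gs).getD j 0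

/-- Whether a claim follows from the claims in `w` and its requirements. -/
def justified (s n : ℕ) (gs : List Gate) (w : List Claim) (c : Claim) : Bool :=
  weftAt s n gs c.1 == 0 || bif (gateD n gs c.1).conj c.2 then
    !(Nat.ble (gateD n gs c.1).inputs.length s) ||
      (gateD n gs c.1).inputs.all fun i => w.elem (i, (gateD n gs c.1).inVal c.2)
  else (gateD n gs c.1).inputs.any fun i => w.elem (i, (gateD n gs c.1).inVal c.2)

/-- The claims about nodes of weft zero that have to hold for a claim to be justified. -/
def requirements (s n : ℕ) (gs : List Gate) (c : Claim) : List Claim :=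
  bif weftAt s n gs c.1 == 0 then [c] else
  bif (gateD n gs c.1).conj c.2 && !(Nat.ble (gateD n gs c.1).inputs.length s) then
    (gateD n gs c.1).inputs.map fun i => (i, (gateD n gs c.1).inVal c.2)
  else []

/-- The certificates for the claim that the output has value `v`. -/
def certs (s u n : ℕ) (gs : List Gate) (out : ℕ) (v : Bool) : List (List Claim) :=
  (tuples ((s + 1) ^ u) ((List.range (n + gs.length)).product [true, false])).filter fun w =>
    w.elem (out, v) && w.all fun c => justified s n gs w c

/-- The universal variable for the value of the node `j` under the `t`-th guess. -/
def nodeVar (n₁ N t j : ℕ) : ℕ := n₁ + t * N + j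

/-- The literals required by a certificate with gaps `τ`. -/
def regularLits (s n₁ n₂ : ℕ) (gs : List Gate) (w : List Claim) (τ : List Gap) (t : ℕ) :
    List Claim :=
  ((w.flatMap fun c => requirements s (n₁ + n₂) gs c).filter
    fun c => (covers n₁ n₂ gs τ).getD c.1 false).map
      fun c => (nodeVar n₁ (n₁ + n₂ + gs.length) t c.1, c.2)

/-- The ways in which the universal variables for the guess `τ` can fail to be the values of the
nodes. -/
def faults (n₁ n₂ : ℕ) (gs : List Gate) (τ : List Gap) (t : ℕ) : List (List Claim) :=
  (((List.range n₁).product [true, false]).map fun c =>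
    [c, (nodeVar n₁ (n₁ + n₂ + gs.length) t c.1, !c.2)]) ++
  (((List.range n₂).map fun v =>
    [(nodeVar n₁ (n₁ + n₂ + gs.length) t (n₁ + v), !(guess τ v))]) ++
  ((gs.zipIdx.product [true, false]).flatMap fun x =>
    bif x.1.1.conj x.2 then
      [(nodeVar n₁ (n₁ + n₂ + gs.length) t (n₁ + n₂ + x.1.2), !x.2) ::
        x.1.1.inputs.map fun i => (nodeVar n₁ (n₁ + n₂ + gs.length) t i, x.1.1.inVal x.2)]
    else x.1.1.inputs.map fun i =>
      [(nodeVar n₁ (n₁ + n₂ + gs.length) t (n₁ + n₂ + x.1.2), !x.2),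
        (nodeVar n₁ (n₁ + n₂ + gs.length) t i, x.1.1.inVal x.2)]))

/-- The numbered tuples of gaps. -/
def guesses (m n₂ : ℕ) : List (List Gap × ℕ) := (tuples m (gaps n₂)).zipIdx

/-- The first gap starts at position `0`, and the last gap ends at position `n₂ + 1`. -/
def boundary (n₂ k : ℕ) (I : List ℕ) (τ : List Gap) : Bool :=
  I.zipIdx.all fun x => (x.1 != 0 || (τ.getD x.2 (0, 0)).1 == 0) &&
    (x.1 != k || (τ.getD x.2 (0, 0)).2 == n₂ + 1)

/-- Gaps with the same index agree, and gaps with consecutive indices are adjacent. -/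
def compatible (I : List ℕ) (τ : List Gap) (I' : List ℕ) (τ' : List Gap) : Bool :=
  I.zipIdx.all fun x => I'.zipIdx.all fun y =>
    (x.1 != y.1 || τ.getD x.2 (0, 0) == τ'.getD y.2 (0, 0)) &&
    (x.1 + 1 != y.1 || (τ.getD x.2 (0, 0)).2 == (τ'.getD y.2 (0, 0)).1)

/-- The blocks: tuples of indices of gaps. -/
def blocks (m k : ℕ) : List (List ℕ) := tuples m (List.range (k + 1))

/-- All choices. -/
def choices (s u : ℕ) (v : Bool) (r : Raw) (k : ℕ) : List Choice :=
  (blocks (s ^ u) k).flatMap fun I =>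
    ((((certs s u (r.1 + r.2.1) r.2.2.1 r.2.2.2 v).product (guesses (s ^ u) r.2.1)).filter fun x =>
      boundary r.2.1 k I x.2.1).map fun x =>
        (I, true, x.1, x.2.1, regularLits s r.1 r.2.1 r.2.2.1 x.1 x.2.1 x.2.2)) ++
    ((guesses (s ^ u) r.2.1).flatMap fun x => faults r.1 r.2.1 r.2.2.1 x.1 x.2).map fun p =>
      (I, false, [], [], p)

/-- Choices for different blocks that exclude each other. -/
def conflict (e e' : Choice) : Bool :=
  e.2.1 != e'.2.1 || (e.2.2.1 != e'.2.2.1 || !(compatible e.1 e.2.2.2.1 e'.1 e'.2.2.2.1))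

/-- A clause `(y, x, v)`: the variable `y` is false, or the variable `x` has value `v`. -/
abbrev Clause : Type := ℕ × ℕ × Bool

/-- The clauses that express that the chosen variables are choices for different blocks without
conflicts whose requirements are met. -/
def choiceClauses (n₁ : ℕ) (E : List Choice) : List Clause :=
  (E.zipIdx.flatMap fun x => x.1.2.2.2.2.map fun c => (n₁ + x.2, c.1, c.2)) ++
  E.zipIdx.flatMap fun x => (E.zipIdx.filter fun y =>
    (x.1.1 == y.1.1 && x.2 != y.2) || conflict x.1 y.1).map fun y => (n₁ + x.2, n₁ + y.2, false)

/-- The number of universal variables. -/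
def numUniversal (m : ℕ) (r : Raw) : ℕ :=
  r.1 + (guesses m r.2.1).length * (r.1 + r.2.1 + r.2.2.1.length)

section PolyTime

variable {α β : Type} [Enc α] [Enc β]

@[fun_prop]
lemma PolyTime.gate_conj {g : α → Gate} {v : α → Bool} (hg : PolyTime g) (hv : PolyTime v) :
    PolyTime fun a => (g a).conj (v a) := by
  unfold Gate.conj; fun_prop

@[fun_prop]
lemma PolyTime.gate_inVal {g : α → Gate} {v : α → Bool} (hg : PolyTime g) (hv : PolyTime v) :
    PolyTime fun a => (g a).inVal (v a) := by
  unfold Gate.inVal; fun_prop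

@[fun_prop]
lemma PolyTime.covered {τ : α → List Gap} {v : α → ℕ} (hτ : PolyTime τ) (hv : PolyTime v) :
    PolyTime fun a => covered (τ a) (v a) := by
  unfold ParamComplexity.covered; fun_prop

@[fun_prop]
lemma PolyTime.guess {τ : α → List Gap} {v : α → ℕ} (hτ : PolyTime τ) (hv : PolyTime v) :
    PolyTime fun a => guess (τ a) (v a) := by
  unfold ParamComplexity.guess; fun_prop

@[fun_prop]
lemma PolyTime.covers {n₁ n₂ : α → ℕ} {gs : α → List Gate} {τ : α → List Gap} (h₁ : PolyTime n₁)
    (h₂ : PolyTime n₂) (hgs : PolyTime gs) (hτ : PolyTime τ) :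
    PolyTime fun a => covers (n₁ a) (n₂ a) (gs a) (τ a) := by
  unfold ParamComplexity.covers; fun_prop

@[fun_prop]
lemma PolyTime.weftAt (s : ℕ) {n j : α → ℕ} {gs : α → List Gate} (hn : PolyTime n)
    (hgs : PolyTime gs) (hj : PolyTime j) : PolyTime fun a => weftAt s (n a) (gs a) (j a) := by
  unfold ParamComplexity.weftAt; fun_prop

@[fun_prop]
lemma PolyTime.justified (s : ℕ) {n : α → ℕ} {gs : α → List Gate} {w : α → List Claim}
    {c : α → Claim} (hn : PolyTime n) (hgs : PolyTime gs) (hw : PolyTime w) (hc : PolyTime c) :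
    PolyTime fun a => justified s (n a) (gs a) (w a) (c a) := by
  unfold ParamComplexity.justified; fun_prop

@[fun_prop]
lemma PolyTime.requirements (s : ℕ) {n : α → ℕ} {gs : α → List Gate}
    {c : α → Claim} (hn : PolyTime n) (hgs : PolyTime gs) (hc : PolyTime c) :
    PolyTime fun a => requirements s (n a) (gs a) (c a) := by
  unfold ParamComplexity.requirements; fun_prop

@[fun_prop]
lemma PolyTime.certs (s u : ℕ) (v : Bool) {n out : α → ℕ} {gs : α → List Gate} (hn : PolyTime n)
    (hgs : PolyTime gs) (ho : PolyTime out) :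
    PolyTime fun a => certs s u (n a) (gs a) (out a) v := by
  unfold ParamComplexity.certs; fun_prop

@[fun_prop]
lemma PolyTime.nodeVar {n N t j : α → ℕ} (hn : PolyTime n) (hN : PolyTime N) (ht : PolyTime t)
    (hj : PolyTime j) : PolyTime fun a => nodeVar (n a) (N a) (t a) (j a) := by
  unfold ParamComplexity.nodeVar; fun_prop

@[fun_prop]
lemma PolyTime.regularLits (s : ℕ) {n₁ n₂ t : α → ℕ} {gs : α → List Gate} {w : α → List Claim}
    {τ : α → List Gap} (h₁ : PolyTime n₁) (h₂ : PolyTime n₂) (hgs : PolyTime gs) (hw : PolyTime w)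
    (hτ : PolyTime τ) (ht : PolyTime t) :
    PolyTime fun a => regularLits s (n₁ a) (n₂ a) (gs a) (w a) (τ a) (t a) := by
  unfold ParamComplexity.regularLits; fun_prop

@[fun_prop]
lemma PolyTime.faults {n₁ n₂ t : α → ℕ} {gs : α → List Gate}
    {τ : α → List Gap} (h₁ : PolyTime n₁) (h₂ : PolyTime n₂) (hgs : PolyTime gs)
    (hτ : PolyTime τ) (ht : PolyTime t) :
    PolyTime fun a => faults (n₁ a) (n₂ a) (gs a) (τ a) (t a) := by
  unfold ParamComplexity.faults; fun_prop

@[fun_prop]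
lemma PolyTime.guesses (m : ℕ) {n : α → ℕ} (hn : PolyTime n) :
    PolyTime fun a => guesses m (n a) := by
  unfold ParamComplexity.guesses gaps; fun_prop

@[fun_prop]
lemma PolyTime.boundary {n k : α → ℕ} {I : α → List ℕ} {τ : α → List Gap} (hn : PolyTime n)
    (hk : PolyTime k) (hI : PolyTime I) (hτ : PolyTime τ) :
    PolyTime fun a => boundary (n a) (k a) (I a) (τ a) := by
  unfold ParamComplexity.boundary; fun_prop

@[fun_prop]
lemma PolyTime.compatible {I I' : α → List ℕ} {τ τ' : α → List Gap} (hI : PolyTime I)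
    (hτ : PolyTime τ) (hI' : PolyTime I') (hτ' : PolyTime τ') :
    PolyTime fun a => compatible (I a) (τ a) (I' a) (τ' a) := by
  unfold ParamComplexity.compatible; fun_prop

@[fun_prop]
lemma PolyTime.blocks (m : ℕ) {k : α → ℕ} (hk : PolyTime k) :
    PolyTime fun a => blocks m (k a) := by
  unfold ParamComplexity.blocks; fun_prop

@[fun_prop]
lemma PolyTime.choices (s u : ℕ) (v : Bool) {r : α → Raw} {k : α → ℕ} (hr : PolyTime r)
    (hk : PolyTime k) : PolyTime fun a => choices s u v (r a) (k a) := by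
  unfold ParamComplexity.choices; fun_prop

@[fun_prop]
lemma PolyTime.conflict {e e' : α → Choice} (he : PolyTime e) (he' : PolyTime e') :
    PolyTime fun a => conflict (e a) (e' a) := by
  unfold ParamComplexity.conflict; fun_prop

@[fun_prop]
lemma PolyTime.choiceClauses {n : α → ℕ} {E : α → List Choice} (hn : PolyTime n)
    (hE : PolyTime E) : PolyTime fun a => choiceClauses (n a) (E a) := by
  unfold ParamComplexity.choiceClauses; fun_prop

@[fun_prop]
lemma PolyTime.numUniversal (m : ℕ) {r : α → Raw} (hr : PolyTime r) :
    PolyTime fun a => numUniversal m (r a) := by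
  unfold ParamComplexity.numUniversal; fun_prop

end PolyTime

/-! ### Values of nodes -/

lemma Gate.eval_congr (g : Gate) (f f' : ℕ → Bool) (h : ∀ i ∈ g.inputs, f i = f' i) :
    g.eval f = g.eval f' := by
  cases g with
  | and l =>
    rw [Bool.eq_iff_iff]
    simp only [inputs] at h
    simp +contextual [eval, h]
  | or l =>
    rw [Bool.eq_iff_iff]
    simp only [inputs] at h
    simp only [eval, List.any_eq_true]
    exact exists_congr fun i => and_congr_right fun hi => by rw [h i hi]
  | not i => simp [eval, h i (by simp [inputs])]

/-- A true conjunction, a false disjunction and any negation speak about all inputs; a false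
conjunction and a true disjunction about some input. With this split, gates of all kinds and both
values are treated alike. -/
lemma Gate.eval_eq_iff_of_conj {g : Gate} {v : Bool} (h : g.conj v = true) (f : ℕ → Bool) :
    g.eval f = v ↔ ∀ i ∈ g.inputs, f i = g.inVal v := by
  cases g <;> cases v <;> simp [conj, kind] at h <;> simp [eval, inVal, kind, inputs]

lemma Gate.eval_eq_iff_of_not_conj {g : Gate} {v : Bool} (h : g.conj v = false) (f : ℕ → Bool) :
    g.eval f = v ↔ ∃ i ∈ g.inputs, f i = g.inVal v := by
  cases g <;> cases v <;> simp [conj, kind] at h <;> simp [eval, inVal, kind, inputs]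

namespace Circuit

variable (C : Circuit) (a : Fin C.n₁ → Bool) (b : Fin C.n₂ → Bool)

/-- The number of nodes. -/
def size : ℕ := C.n₁ + C.n₂ + C.gates.length

/-- The value of a node. -/
def nodeVal (j : ℕ) : Bool := (labels Gate.eval (List.ofFn (Fin.append a b)) C.gates).getD j default

lemma eval_eq : C.eval a b = C.nodeVal a b C.out := rfl

lemma topoOrdered : TopoOrdered (C.n₁ + C.n₂) C.gates := C.inputs_lt

lemma nodeVal_left {i : ℕ} (hi : i < C.n₁) : C.nodeVal a b i = a ⟨i, hi⟩ := by
  rw [nodeVal, labels_getD_var _ (by simp; omega), List.getD_eq_getElem _ _ (by simp; omega)]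
  simp only [List.getElem_ofFn]
  exact Fin.append_left a b ⟨i, hi⟩

lemma nodeVal_right {i : ℕ} (hi : i < C.n₂) : C.nodeVal a b (C.n₁ + i) = b ⟨i, hi⟩ := by
  rw [nodeVal, labels_getD_var _ (by simp; omega), List.getD_eq_getElem _ _ (by simp; omega)]
  simp only [List.getElem_ofFn]
  exact Fin.append_right a b ⟨i, hi⟩

lemma nodeVal_gate {j : ℕ} (hj : j < C.gates.length) :
    C.nodeVal a b (C.n₁ + C.n₂ + j) = (C.gates[j]).eval (C.nodeVal a b) := by
  have h := labels_getD_gate (step := Gate.eval) (vars := List.ofFn (Fin.append a b))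
    Gate.eval_congr (by rw [List.length_ofFn]; exact C.topoOrdered) hj
  rw [List.length_ofFn] at h
  exact h

/-- Local consistency at every node determines the evaluation. This is why truthfulness of the added
universal variables can be tested gate by gate. -/
lemma nodeVal_unique {f : ℕ → Bool} (h₁ : ∀ (i : ℕ) (hi : i < C.n₁), f i = a ⟨i, hi⟩)
    (h₂ : ∀ (i : ℕ) (hi : i < C.n₂), f (C.n₁ + i) = b ⟨i, hi⟩)
    (h : ∀ (j : ℕ) (hj : j < C.gates.length), f (C.n₁ + C.n₂ + j) = (C.gates[j]).eval f) :
    ∀ i < C.size, f i = C.nodeVal a b i := by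
  have := labels_unique (step := Gate.eval) (vars := List.ofFn (Fin.append a b)) (f := f)
    Gate.eval_congr (by rw [List.length_ofFn]; exact C.topoOrdered) ?_
    (by rw [List.length_ofFn]; exact h)
  · rwa [List.length_ofFn] at this
  · intro i hi
    rw [← labels_getD_var C.gates hi]
    change f i = C.nodeVal a b i
    rw [List.length_ofFn] at hi
    by_cases h' : i < C.n₁
    · rw [h₁ i h', nodeVal_left]
    · obtain ⟨j, rfl⟩ : ∃ j, i = C.n₁ + j := ⟨i - C.n₁, by omega⟩
      rw [h₂ j (by omega), nodeVal_right]

/-- The depth of a node. -/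
def depthAt (j : ℕ) : ℕ := (levels (fun _ => 1) (C.n₁ + C.n₂) C.gates).getD j 0

lemma levels_getD_var (δ : Gate → ℕ) {j : ℕ} (hj : j < C.n₁ + C.n₂) :
    (levels δ (C.n₁ + C.n₂) C.gates).getD j 0 = 0 := by
  have := labels_getD_var (step := levelStep δ) (vars := List.replicate (C.n₁ + C.n₂) 0) C.gates
    (i := j) (by simpa using hj)
  refine Eq.trans this ?_
  rw [List.getD_eq_getElem _ _ (by simpa using hj)]
  simp

lemma levels_getD_gate (δ : Gate → ℕ) {j : ℕ} (hj : j < C.gates.length) :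
    (levels δ (C.n₁ + C.n₂) C.gates).getD (C.n₁ + C.n₂ + j) 0 =
      levelStep δ C.gates[j] fun i => (levels δ (C.n₁ + C.n₂) C.gates).getD i 0 := by
  have h := labels_getD_gate (step := levelStep δ) (vars := List.replicate (C.n₁ + C.n₂) 0)
    (levelStep_congr δ) (by rw [List.length_replicate]; exact C.topoOrdered) hj
  rw [List.length_replicate] at h
  exact h

lemma levels_input_le (δ : Gate → ℕ) {i j : ℕ} (hj : j < C.gates.length)
    (hi : i ∈ (C.gates[j]).inputs) :
    δ C.gates[j] + (levels δ (C.n₁ + C.n₂) C.gates).getD i 0 ≤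
      (levels δ (C.n₁ + C.n₂) C.gates).getD (C.n₁ + C.n₂ + j) 0 := by
  rw [C.levels_getD_gate δ hj, levelStep]
  exact Nat.add_le_add_left (le_foldr_max (List.mem_map.2
    ⟨i, hi, (rfl : (fun i => (levels δ (C.n₁ + C.n₂) C.gates).getD i 0) i = _)⟩)) _

lemma depthAt_input {i j : ℕ} (hj : j < C.gates.length) (hi : i ∈ (C.gates[j]).inputs) :
    1 + C.depthAt i ≤ C.depthAt (C.n₁ + C.n₂ + j) :=
  C.levels_input_le (fun _ => 1) hj hi

lemma one_le_depthAt {j : ℕ} (hj : j < C.gates.length) :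
    1 ≤ C.depthAt (C.n₁ + C.n₂ + j) := by
  rw [depthAt, C.levels_getD_gate _ hj, levelStep]
  exact Nat.le_add_right _ _

/-- The weft of a node if gates of fan-in more than `s` count. -/
abbrev weft' (s j : ℕ) : ℕ := weftAt s (C.n₁ + C.n₂) C.gates j

lemma weft'_var (s : ℕ) {j : ℕ} (hj : j < C.n₁ + C.n₂) : C.weft' s j = 0 :=
  C.levels_getD_var _ hj

lemma weft'_input (s : ℕ) {i j : ℕ} (hj : j < C.gates.length) (hi : i ∈ (C.gates[j]).inputs) :
    weftCost s C.gates[j] + C.weft' s i ≤ C.weft' s (C.n₁ + C.n₂ + j) :=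
  C.levels_input_le _ hj hi

lemma fanin_le_of_weft'_eq_zero {s j : ℕ} (hj : j < C.gates.length)
    (h : C.weft' s (C.n₁ + C.n₂ + j) = 0) : (C.gates[j]).inputs.length ≤ s := by
  rw [weft', weftAt, C.levels_getD_gate _ hj, levelStep, weftCost_eq] at h
  by_contra h'
  rw [if_pos (by omega)] at h
  omega

/-- The large gate uses up the only unit of weft available. -/
lemma weft'_input_of_large {s i j : ℕ} (hj : j < C.gates.length)
    (hi : i ∈ (C.gates[j]).inputs) (hs : s < (C.gates[j]).inputs.length)
    (h : C.weft' s (C.n₁ + C.n₂ + j) ≤ 1) : C.weft' s i = 0 := by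
  have := C.weft'_input s hj hi
  rw [weftCost_eq, if_pos hs] at this
  omega

lemma gateD_gates {j : ℕ} (hj : j < C.gates.length) :
    gateD (C.n₁ + C.n₂) C.gates (C.n₁ + C.n₂ + j) = C.gates[j] := by
  rw [gateD, Nat.add_sub_cancel_left, List.getD_eq_getElem]

lemma node_cases {j : ℕ} (hj : j < C.size) :
    j < C.n₁ + C.n₂ ∨ ∃ i, ∃ _ : i < C.gates.length, j = C.n₁ + C.n₂ + i := by
  by_cases h : j < C.n₁ + C.n₂
  · exact .inl h
  · exact .inr ⟨j - (C.n₁ + C.n₂), by unfold size at hj; omega, by omega⟩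

lemma input_lt_size {i j : ℕ} (hj : j < C.gates.length) (hi : i ∈ (C.gates[j]).inputs) :
    i < C.size := by
  have := C.inputs_lt j hj i hi
  unfold size; omega

/-! ### Coverage -/

/-- Whether the variables of the second block below a node are covered. -/
abbrev cov (τ : List Gap) (j : ℕ) : Bool := (covers C.n₁ C.n₂ C.gates τ).getD j false

lemma cov_left (τ : List Gap) {i : ℕ} (hi : i < C.n₁) : C.cov τ i = true := by
  have := labels_getD_var (step := fun g d => g.inputs.all d)
    (vars := List.replicate C.n₁ true ++ (List.range C.n₂).map fun v => covered τ v) C.gates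
    (i := i) (by simp; omega)
  refine Eq.trans this ?_
  rw [List.getD_append _ _ _ _ (by simpa using hi), List.getD_eq_getElem _ _ (by simpa using hi)]
  simp

lemma cov_right (τ : List Gap) {i : ℕ} (hi : i < C.n₂) : C.cov τ (C.n₁ + i) = covered τ i := by
  have := labels_getD_var (step := fun g d => g.inputs.all d)
    (vars := List.replicate C.n₁ true ++ (List.range C.n₂).map fun v => covered τ v) C.gates
    (i := C.n₁ + i) (by simp; omega)
  refine Eq.trans this ?_
  rw [List.getD_append_right _ _ _ _ (by simp), List.getD_eq_getElem _ _ (by simpa using hi)]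
  simp

lemma cov_gate (τ : List Gap) {j : ℕ} (hj : j < C.gates.length) :
    C.cov τ (C.n₁ + C.n₂ + j) = (C.gates[j]).inputs.all (C.cov τ) := by
  have hl : (List.replicate C.n₁ true ++ (List.range C.n₂).map fun v => covered τ v).length =
    C.n₁ + C.n₂ := by simp
  have h := labels_getD_gate (step := fun g d => g.inputs.all d)
    (vars := List.replicate C.n₁ true ++ (List.range C.n₂).map fun v => covered τ v)
    (fun g f f' h => by rw [Bool.eq_iff_iff]; simp +contextual [h])
    (by rw [hl]; exact C.topoOrdered) hj
  rw [hl] at h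
  exact h

/-- The assignment to the second block given by a guess. -/
def guessed (τ : List Gap) : Fin C.n₂ → Bool := fun v => guess τ v

variable {a b}

/-- All variables of the second block below a covered node are covered, and there `b` agrees with
the guess. So the value of the node under any matching `b` can be looked up in the universal
variables for `τ`. -/
lemma nodeVal_eq_of_cov {τ : List Gap}
    (h : ∀ v : Fin C.n₂, covered τ v = true → b v = guess τ v) {j : ℕ} (hj : j < C.size)
    (hc : C.cov τ j = true) : C.nodeVal a b j = C.nodeVal a (C.guessed τ) j := by
  induction j using Nat.strong_induction_on with
  | _ j ih =>
    rcases C.node_cases hj with h' | ⟨i, hi, rfl⟩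
    · by_cases h₁ : j < C.n₁
      · rw [nodeVal_left _ _ _ h₁, nodeVal_left _ _ _ h₁]
      · obtain ⟨v, rfl⟩ : ∃ v, j = C.n₁ + v := ⟨j - C.n₁, by omega⟩
        have hv : v < C.n₂ := by omega
        rw [nodeVal_right _ _ _ hv, nodeVal_right _ _ _ hv]
        rw [C.cov_right τ hv] at hc
        exact h ⟨v, hv⟩ hc
    · rw [nodeVal_gate _ _ _ hi, nodeVal_gate _ _ _ hi]
      rw [C.cov_gate τ hi, List.all_eq_true] at hc
      exact Gate.eval_congr _ _ _ fun x hx =>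
        ih x (C.inputs_lt i hi x hx) (C.input_lt_size hi hx) (hc x hx)

end Circuit

lemma covered_mono {τ τ' : List Gap} (h : τ ⊆ τ') {v : ℕ} (hv : covered τ v = true) :
    covered τ' v = true := by
  simp only [covered, List.any_eq_true] at hv ⊢
  obtain ⟨g, hg, h'⟩ := hv
  exact ⟨g, h hg, h'⟩

lemma Circuit.cov_mono (C : Circuit) {τ τ' : List Gap} (h : τ ⊆ τ') {j : ℕ} (hj : j < C.size)
    (hc : C.cov τ j = true) : C.cov τ' j = true := by
  induction j using Nat.strong_induction_on with
  | _ j ih =>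
    rcases C.node_cases hj with h' | ⟨i, hi, rfl⟩
    · by_cases h₁ : j < C.n₁
      · exact C.cov_left τ' h₁
      · obtain ⟨v, rfl⟩ : ∃ v, j = C.n₁ + v := ⟨j - C.n₁, by omega⟩
        have hv : v < C.n₂ := by omega
        rw [C.cov_right _ hv] at hc ⊢
        exact covered_mono h hc
    · rw [C.cov_gate _ hi, List.all_eq_true] at hc ⊢
      exact fun x hx => ih x (C.inputs_lt i hi x hx) (C.input_lt_size hi hx) (hc x hx)

/-! ### Chains of positions -/

/-- Increasing positions `0 = s 0 < s 1 < ⋯ < s (k + 1) = n + 1`. -/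
structure IsChain (n k : ℕ) (s : ℕ → ℕ) : Prop where
  zero : s 0 = 0
  last : s (k + 1) = n + 1
  lt : ∀ i ≤ k, s i < s (i + 1)

namespace IsChain

variable {n k : ℕ} {s : ℕ → ℕ}

lemma strictMono (hs : IsChain n k s) {i j : ℕ} (hij : i < j) (hj : j ≤ k + 1) : s i < s j := by
  induction j with
  | zero => omega
  | succ j ih =>
    have h1 := hs.lt j (by omega)
    by_cases h : i = j
    · rwa [h]
    · exact (ih (by omega) (by omega)).trans h1

lemma le_of_le (hs : IsChain n k s) {i j : ℕ} (hi : i ≤ k + 1) (h : s i ≤ s j) : i ≤ j := by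
  by_contra h'
  exact absurd (hs.strictMono (not_le.1 h') hi) (by omega)

lemma injOn (hs : IsChain n k s) {i j : ℕ} (hi : i ≤ k + 1) (hj : j ≤ k + 1) (h : s i = s j) :
    i = j := le_antisymm (hs.le_of_le hi h.le) (hs.le_of_le hj h.ge)

lemma exists_gap (hs : IsChain n k s) {v : ℕ} (hv : v < n) :
    ∃ i ≤ k, s i ≤ v + 1 ∧ v + 1 ≤ s (i + 1) := by
  have key : ∀ j ≤ k, v + 1 ≤ s (j + 1) → ∃ i ≤ k, s i ≤ v + 1 ∧ v + 1 ≤ s (i + 1) := by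
    intro j
    induction j with
    | zero => exact fun hj h => ⟨0, hj, by rw [hs.zero]; omega, h⟩
    | succ j ih =>
      intro hj h
      by_cases h' : s (j + 1) ≤ v + 1
      · exact ⟨j + 1, hj, h', h⟩
      · exact ih (by omega) (by omega)
  exact key k le_rfl (by rw [hs.last]; omega)

/-- The `i`-th gap. -/
def _root_.ParamComplexity.gapAt (s : ℕ → ℕ) (i : ℕ) : Gap := (s i, s (i + 1))

lemma gapAt_mem (hs : IsChain n k s) {i : ℕ} (hi : i ≤ k) : gapAt s i ∈ gaps n := by
  have h1 := hs.lt i hi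
  have h2 : s (i + 1) ≤ n + 1 := by
    by_cases h : i = k
    · rw [h, hs.last]
    · rw [← hs.last]; exact (hs.strictMono (by omega) le_rfl).le
  rw [gaps, List.mem_filter]
  exact ⟨List.pair_mem_product.2 ⟨List.mem_range.2 (by omega), List.mem_range.2 (by omega)⟩,
    by rw [Nat.ble_eq]; exact h1⟩

/-- The assignment that is true at the inner positions of the chain. -/
def _root_.ParamComplexity.chainAssign (n k : ℕ) (s : ℕ → ℕ) : Fin n → Bool :=
  fun v => (List.range k).any fun i => s (i + 1) == v + 1

lemma _root_.ParamComplexity.chainAssign_eq_true {v : Fin n} :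
    chainAssign n k s v = true ↔ ∃ i, 1 ≤ i ∧ i ≤ k ∧ s i = v + 1 := by
  simp only [chainAssign, List.any_eq_true, List.mem_range, beq_iff_eq]
  constructor
  · rintro ⟨i, hi, h⟩
    exact ⟨i + 1, by omega, by omega, h⟩
  · rintro ⟨i, hi, hi', h⟩
    exact ⟨i - 1, by omega, by rwa [Nat.sub_add_cancel hi]⟩

/-- If the position `v + 1` is a member `s i` of the chain and lies in the closed gap `j`,
monotonicity gives `i = j` or `i = j + 1`, so it is an endpoint. Conversely, an endpoint at the
position of a variable is neither the sentinel `0` nor the sentinel `n + 1`, hence an inner member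
of the chain. -/
lemma chainAssign_eq_guess (hs : IsChain n k s) {τ : List Gap}
    (hτ : ∀ g ∈ τ, ∃ i ≤ k, g = gapAt s i) (v : Fin n) (hv : covered τ v = true) :
    chainAssign n k s v = guess τ v := by
  rw [Bool.eq_iff_iff]
  simp only [chainAssign_eq_true, guess, List.any_eq_true, Bool.or_eq_true, beq_iff_eq]
  have hin : ∀ i ≤ k + 1, s i = v + 1 → 1 ≤ i ∧ i ≤ k := by
    intro i hi h
    constructor
    · by_contra h'
      rw [show i = 0 by omega, hs.zero] at h
      omega
    · by_contra h'
      rw [show i = k + 1 by omega, hs.last] at h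
      omega
  constructor
  · rintro ⟨i, hi, hi', h⟩
    simp only [covered, List.any_eq_true, Bool.and_eq_true, Nat.ble_eq] at hv
    obtain ⟨g, hg, h1, h2⟩ := hv
    obtain ⟨j, hj, rfl⟩ := hτ g hg
    refine ⟨_, hg, ?_⟩
    simp only [gapAt] at h1 h2 ⊢
    rw [← h] at h1 h2 ⊢
    have e1 := hs.le_of_le (by omega) h1
    have e2 := hs.le_of_le (by omega) h2
    rcases (by omega : j = i ∨ j + 1 = i) with rfl | rfl <;> simp
  · rintro ⟨g, hg, h⟩
    obtain ⟨j, hj, rfl⟩ := hτ g hg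
    rcases h with h | h
    · exact ⟨j, (hin j (by omega) h).1, (hin j (by omega) h).2, h⟩
    · exact ⟨j + 1, (hin _ (by omega) h).1, (hin _ (by omega) h).2, h⟩

lemma weight_chainAssign (hs : IsChain n k s) : weight (chainAssign n k s) = k := by
  have hb : ∀ i ∈ Finset.Icc 1 k, s i - 1 < n ∧ s i - 1 + 1 = s i := by
    intro i hi
    rw [Finset.mem_Icc] at hi
    have h1 := hs.strictMono (show 0 < i by omega) (by omega)
    have h2 := hs.strictMono (show i < k + 1 by omega) le_rfl
    rw [hs.last] at h2
    omega
  rw [weight]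
  symm
  have : k = (Finset.Icc 1 k).card := by simp
  conv_lhs => rw [this]
  refine Finset.card_bij (fun i hi => ⟨s i - 1, (hb i hi).1⟩) ?_ ?_ ?_
  · intro i hi
    have h1 := (hb i hi).2
    rw [Finset.mem_Icc] at hi
    simp only [Finset.mem_filter, Finset.mem_univ, true_and, chainAssign_eq_true]
    exact ⟨i, hi.1, hi.2, h1.symm⟩
  · intro i hi j hj h
    have h1 := (hb i hi).2
    have h2 := (hb j hj).2
    rw [Fin.mk.injEq] at h
    rw [Finset.mem_Icc] at hi hj
    exact hs.injOn (by omega) (by omega) (by omega)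
  · intro v hv
    simp only [Finset.mem_filter, Finset.mem_univ, true_and, chainAssign_eq_true] at hv
    obtain ⟨i, h1, h2, h3⟩ := hv
    exact ⟨i, Finset.mem_Icc.2 ⟨h1, h2⟩, Fin.ext (by simp [h3])⟩

end IsChain

/-- The positions of the true variables are enumerated increasingly and framed by the two sentinels.
-/
lemma exists_chain {n k : ℕ} (b : Fin n → Bool) (hb : weight b = k) :
    ∃ s, IsChain n k s ∧ b = chainAssign n k s := by
  let S : Finset ℕ := (Finset.univ.filter fun i => b i = true).map
    (Fin.valEmbedding.trans ⟨Nat.succ, Nat.succ_injective⟩)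
  have hS : S.card = k := by rw [Finset.card_map]; exact hb
  have hmem : ∀ x, x ∈ S ↔ ∃ v : Fin n, b v = true ∧ v + 1 = x := by
    intro x; simp [S]
  let e := S.orderEmbOfFin hS
  have he : ∀ i, e i ∈ S := fun i => S.orderEmbOfFin_mem hS i
  have he' : ∀ x ∈ S, ∃ i, e i = x := by
    intro x hx
    have : x ∈ Set.range e := by rw [S.range_orderEmbOfFin hS]; exact hx
    exact this
  have hle : ∀ i, 1 ≤ e i ∧ e i ≤ n := by
    intro i
    obtain ⟨v, -, hv⟩ := (hmem _).1 (he i)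
    have := v.2
    omega
  let s : ℕ → ℕ := fun i => if h : 1 ≤ i ∧ i ≤ k then e ⟨i - 1, by omega⟩
    else if i = 0 then 0 else n + 1
  have hs : ∀ (i : ℕ) (h : 1 ≤ i ∧ i ≤ k), s i = e ⟨i - 1, by omega⟩ := fun i h => dif_pos h
  have hs0 : s 0 = 0 := rfl
  have hs1 : s (k + 1) = n + 1 := by simp [s]
  refine ⟨s, ⟨hs0, hs1, fun i hi => ?_⟩, ?_⟩
  · by_cases h0 : i = 0
    · by_cases hk : i = k
      · rw [hk, hs1, ← hk, h0, hs0]; omega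
      · rw [h0, hs0, hs _ (by omega)]
        exact (hle _).1
    · by_cases hk : i = k
      · rw [show s (i + 1) = n + 1 by rw [hk, hs1], hs i (by omega)]
        exact Nat.lt_succ_of_le (hle _).2
      · rw [hs i (by omega), hs (i + 1) (by omega)]
        exact e.strictMono (by rw [Fin.mk_lt_mk]; omega)
  · funext v
    rw [Bool.eq_iff_iff, chainAssign_eq_true]
    constructor
    · intro hv
      obtain ⟨i, hi⟩ := he' (v + 1) ((hmem _).2 ⟨v, hv, rfl⟩)
      have := i.2
      refine ⟨i + 1, by omega, by omega, ?_⟩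
      rw [hs _ (by omega)]
      exact hi
    · rintro ⟨i, h1, h2, h3⟩
      rw [hs i ⟨h1, h2⟩] at h3
      obtain ⟨w, hw, hw'⟩ := (hmem _).1 (he ⟨i - 1, by omega⟩)
      have : w = v := Fin.ext (by omega)
      rwa [← this]

/-! ### Covering nodes of weft zero by few gaps -/

namespace Circuit

variable (C : Circuit) {a : Fin C.n₁ → Bool} {b : Fin C.n₂ → Bool}

/-- A node of weft zero depends on few variables, so that few gaps cover it. -/
lemma exists_cov {s k : ℕ} {p : ℕ → ℕ} (hp : IsChain C.n₂ k p) (hs : 1 ≤ s) (d : ℕ) :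
    ∀ j < C.size, C.depthAt j ≤ d → C.weft' s j = 0 →
      ∃ L : List ℕ, L.length ≤ s ^ d ∧ (∀ i ∈ L, i ≤ k) ∧ C.cov (L.map (gapAt p)) j = true := by
  induction d with
  | zero =>
    intro j hj hd _
    rcases C.node_cases hj with h' | ⟨i, hi, rfl⟩
    · by_cases h₁ : j < C.n₁
      · exact ⟨[], by simp, by simp, C.cov_left _ h₁⟩
      · obtain ⟨v, rfl⟩ : ∃ v, j = C.n₁ + v := ⟨j - C.n₁, by omega⟩
        have hv : v < C.n₂ := by omega
        obtain ⟨i, hi, h1, h2⟩ := hp.exists_gap hv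
        refine ⟨[i], by simp, by simpa using hi, ?_⟩
        rw [C.cov_right _ hv]
        simp [covered, gapAt, h1, h2]
    · have := C.one_le_depthAt hi
      omega
  | succ d ih =>
    intro j hj hd hw
    rcases C.node_cases hj with h' | ⟨i, hi, rfl⟩
    · by_cases h₁ : j < C.n₁
      · exact ⟨[], by simp, by simp, C.cov_left _ h₁⟩
      · obtain ⟨v, rfl⟩ : ∃ v, j = C.n₁ + v := ⟨j - C.n₁, by omega⟩
        have hv : v < C.n₂ := by omega
        obtain ⟨i, hi, h1, h2⟩ := hp.exists_gap hv
        refine ⟨[i], by simpa using Nat.one_le_pow _ _ hs, by simpa using hi, ?_⟩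
        rw [C.cov_right _ hv]
        simp [covered, gapAt, h1, h2]
    · have key : ∀ x ∈ (C.gates[i]).inputs, ∃ L : List ℕ, L.length ≤ s ^ d ∧ (∀ i ∈ L, i ≤ k) ∧
          C.cov (L.map (gapAt p)) x = true := by
        intro x hx
        have h1 := C.depthAt_input hi hx
        have h2 := C.weft'_input s hi hx
        exact ih x (C.input_lt_size hi hx) (by omega) (by omega)
      -- At weft zero the fan-in is at most `s`, so the covers of the inputs together have at most
      -- `s * s ^ d` members.
      choose! F hF1 hF2 hF3 using key
      refine ⟨(C.gates[i]).inputs.flatMap F, ?_, ?_, ?_⟩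
      · rw [List.length_flatMap]
        have h3 : ((C.gates[i]).inputs.map fun x => (F x).length).sum ≤
            (C.gates[i]).inputs.length * s ^ d := by
          have := List.sum_le_card_nsmul ((C.gates[i]).inputs.map fun x => (F x).length) (s ^ d)
            (by intro y hy; obtain ⟨x, hx, rfl⟩ := List.mem_map.1 hy; exact hF1 x hx)
          simpa using this
        refine h3.trans ?_
        rw [pow_succ']
        exact Nat.mul_le_mul_right _ (C.fanin_le_of_weft'_eq_zero hi hw)
      · intro y hy
        obtain ⟨x, hx, hy⟩ := List.mem_flatMap.1 hy
        exact hF2 x hx y hy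
      · rw [C.cov_gate _ hi, List.all_eq_true]
        intro x hx
        refine C.cov_mono (List.map_subset _ ?_) (C.input_lt_size hi hx) (hF3 x hx)
        exact fun y hy => List.mem_flatMap.2 ⟨x, hx, hy⟩

/-! ### Certificates -/

/-- Justification only asks for the presence of claims, so certificates of several inputs can be
joined. -/
lemma _root_.ParamComplexity.justified_mono {s n : ℕ} {gs : List Gate} {w w' : List Claim}
    {c : Claim} (h : w ⊆ w') (hc : justified s n gs w c = true) : justified s n gs w' c = true := by
  revert hc
  simp only [justified, Bool.or_eq_true]
  cases (gateD n gs c.1).conj c.2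
  · simp only [cond_false, List.any_eq_true, List.elem_eq_mem, decide_eq_true_eq]
    exact Or.imp_right fun ⟨i, hi, h'⟩ => ⟨i, hi, h h'⟩
  · simp only [cond_true, Bool.or_eq_true, List.all_eq_true, List.elem_eq_mem, decide_eq_true_eq]
    exact Or.imp_right (Or.imp_right fun h' i hi => h (h' i hi))

/-- A true value of a node has a small certificate. -/
lemma exists_cert {s : ℕ} (hs : 1 ≤ s) (d : ℕ) : ∀ j < C.size, C.depthAt j ≤ d → C.weft' s j ≤ 1 →
    ∃ w : List Claim, (j, C.nodeVal a b j) ∈ w ∧ w.length ≤ (s + 1) ^ d ∧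
      ∀ c ∈ w, c.1 < C.size ∧ c.2 = C.nodeVal a b c.1 ∧
        justified s (C.n₁ + C.n₂) C.gates w c = true := by
  have simple : ∀ (d j : ℕ), j < C.size →
      justified s (C.n₁ + C.n₂) C.gates [(j, C.nodeVal a b j)] (j, C.nodeVal a b j) = true →
      ∃ w : List Claim, (j, C.nodeVal a b j) ∈ w ∧ w.length ≤ (s + 1) ^ d ∧
      ∀ c ∈ w, c.1 < C.size ∧ c.2 = C.nodeVal a b c.1 ∧
        justified s (C.n₁ + C.n₂) C.gates w c = true := by
    intro d j hj h
    refine ⟨[(j, C.nodeVal a b j)], by simp, by simpa using Nat.one_le_pow _ _ (by omega), ?_⟩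
    intro c hc
    rw [List.mem_singleton] at hc
    subst hc
    exact ⟨hj, rfl, h⟩
  induction d with
  | zero =>
    intro j hj hd _
    rcases C.node_cases hj with h' | ⟨i, hi, rfl⟩
    · exact simple 0 j hj (by simp [justified, show weftAt s _ _ j = 0 from C.weft'_var s h'])
    · have := C.one_le_depthAt hi
      omega
  | succ d ih =>
    intro j hj hd hw
    by_cases h0 : C.weft' s j = 0
    · exact simple _ j hj (by simp [justified, show weftAt s _ _ j = 0 from h0])
    rcases C.node_cases hj with h' | ⟨i, hi, rfl⟩
    · exact absurd (C.weft'_var s h') h0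
    have key : ∀ x ∈ (C.gates[i]).inputs, ∃ w : List Claim, (x, C.nodeVal a b x) ∈ w ∧
        w.length ≤ (s + 1) ^ d ∧ ∀ c ∈ w, c.1 < C.size ∧ c.2 = C.nodeVal a b c.1 ∧
        justified s (C.n₁ + C.n₂) C.gates w c = true := by
      intro x hx
      have h1 := C.depthAt_input hi hx
      have h2 := C.weft'_input s hi hx
      exact ih x (C.input_lt_size hi hx) (by omega) (by omega)
    have hev := (C.nodeVal_gate a b hi).symm
    by_cases hc : (C.gates[i]).conj (C.nodeVal a b (C.n₁ + C.n₂ + i)) = true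
    · rw [Gate.eval_eq_iff_of_conj hc] at hev
      -- A small gate expands into certificates for all its inputs: `1 + s * (s + 1) ^ d ≤ (s + 1) ^
      -- (d + 1)` claims.
      by_cases hl : (C.gates[i]).inputs.length ≤ s
      · choose! F hF1 hF2 hF3 using key
        refine ⟨(C.n₁ + C.n₂ + i, C.nodeVal a b (C.n₁ + C.n₂ + i)) ::
          (C.gates[i]).inputs.flatMap F, by simp, ?_, ?_⟩
        · rw [List.length_cons, List.length_flatMap]
          have h3 : ((C.gates[i]).inputs.map fun x => (F x).length).sum ≤
              (C.gates[i]).inputs.length * (s + 1) ^ d := by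
            have := List.sum_le_card_nsmul ((C.gates[i]).inputs.map fun x => (F x).length)
              ((s + 1) ^ d)
              (by intro y hy; obtain ⟨x, hx, rfl⟩ := List.mem_map.1 hy; exact hF2 x hx)
            simpa using this
          have h4 := Nat.mul_le_mul_right ((s + 1) ^ d) hl
          have h5 := Nat.one_le_pow d (s + 1) (by omega)
          rw [pow_succ', add_mul]
          omega
        · intro c hc'
          rcases List.mem_cons.1 hc' with rfl | hc'
          · refine ⟨hj, rfl, ?_⟩
            simp only [justified, C.gateD_gates hi, hc, cond_true, Bool.or_eq_true,
              List.all_eq_true, List.elem_eq_mem, decide_eq_true_eq]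
            refine .inr (.inr fun x hx => List.mem_cons_of_mem _ (List.mem_flatMap.2 ⟨x, hx, ?_⟩))
            rw [← hev x hx]
            exact hF1 x hx
          · obtain ⟨x, hx, hcx⟩ := List.mem_flatMap.1 hc'
            obtain ⟨h1, h2, h3⟩ := hF3 x hx c hcx
            exact ⟨h1, h2, justified_mono (fun y hy =>
              List.mem_cons_of_mem _ (List.mem_flatMap.2 ⟨x, hx, hy⟩)) h3⟩
      -- A large gate would need too many claims. Its claim counts as justified by itself, and the
      -- values of its inputs are left to `requirements`.
      · refine simple _ _ hj ?_
        have : Nat.ble (C.gates[i]).inputs.length s = false := by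
          rw [← Bool.not_eq_true, Nat.ble_eq]; exact hl
        simp [justified, C.gateD_gates hi, hc, this]
    · rw [Bool.not_eq_true] at hc
      rw [Gate.eval_eq_iff_of_not_conj hc] at hev
      -- Whatever the fan-in, one witnessing input suffices here.
      obtain ⟨x, hx, hv⟩ := hev
      obtain ⟨w, hw1, hw2, hw3⟩ := key x hx
      refine ⟨(C.n₁ + C.n₂ + i, C.nodeVal a b (C.n₁ + C.n₂ + i)) :: w, by simp, ?_, ?_⟩
      · have h5 := Nat.one_le_pow d (s + 1) (by omega)
        have h4 := Nat.mul_le_mul_right ((s + 1) ^ d) hs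
        rw [List.length_cons, pow_succ', add_mul]
        omega
      · intro c hc'
        rcases List.mem_cons.1 hc' with rfl | hc'
        · refine ⟨hj, rfl, ?_⟩
          simp only [justified, C.gateD_gates hi, hc, cond_false, Bool.or_eq_true,
            List.any_eq_true, List.elem_eq_mem, decide_eq_true_eq]
          refine .inr ⟨x, hx, List.mem_cons_of_mem _ ?_⟩
          rw [← hv]
          exact hw1
        · obtain ⟨h1, h2, h3⟩ := hw3 c hc'
          exact ⟨h1, h2, justified_mono (fun y hy => List.mem_cons_of_mem _ hy) h3⟩

/-- The requirements of true claims are true. -/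
lemma requirements_true {s : ℕ} {c : Claim} (hc : c.1 < C.size) (hv : c.2 = C.nodeVal a b c.1) :
    ∀ r ∈ requirements s (C.n₁ + C.n₂) C.gates c, r.1 < C.size ∧ r.2 = C.nodeVal a b r.1 := by
  intro r hr
  rw [requirements] at hr
  cases h0 : weftAt s (C.n₁ + C.n₂) C.gates c.1 == 0 with
  | true =>
    rw [h0, cond_true, List.mem_singleton] at hr
    rw [hr]; exact ⟨hc, hv⟩
  | false =>
    rw [h0, cond_false] at hr
    rcases C.node_cases hc with h' | ⟨i, hi, hci⟩
    · rw [show weftAt s (C.n₁ + C.n₂) C.gates c.1 = 0 from C.weft'_var s h'] at h0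
      simp at h0
    · rw [hci, C.gateD_gates hi] at hr
      rw [hci, C.nodeVal_gate _ _ hi] at hv
      cases hcj : (C.gates[i]).conj c.2 with
      | false => simp [hcj] at hr
      | true =>
        rw [eq_comm, Gate.eval_eq_iff_of_conj hcj] at hv
        cases hl : Nat.ble (C.gates[i]).inputs.length s with
        | true => simp [hcj, hl] at hr
        | false =>
          simp only [hcj, hl, Bool.not_false, Bool.and_self, cond_true, List.mem_map] at hr
          obtain ⟨x, hx, rfl⟩ := hr
          exact ⟨C.input_lt_size hi hx, (hv x hx).symm⟩

/-- Certificates are sound. -/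
lemma cert_sound {s u : ℕ} {w : List Claim}
    (hw : ∀ c ∈ w, justified s (C.n₁ + C.n₂) C.gates w c = true)
    (hr : ∀ c ∈ w, ∀ r ∈ requirements s (C.n₁ + C.n₂) C.gates c, r.1 < C.size →
      C.depthAt r.1 ≤ u → C.weft' s r.1 = 0 → C.nodeVal a b r.1 = r.2) :
    ∀ j < C.size, ∀ v, (j, v) ∈ w → C.depthAt j ≤ u → C.weft' s j ≤ 1 → C.nodeVal a b j = v := by
  intro j
  induction j using Nat.strong_induction_on with
  | _ j ih =>
    intro hj v hjv hd hwj
    by_cases h0 : C.weft' s j = 0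
    · refine hr _ hjv (j, v) ?_ hj hd h0
      simp [requirements, show weftAt s _ _ j = 0 from h0]
    rcases C.node_cases hj with h' | ⟨i, hi, rfl⟩
    · exact absurd (C.weft'_var s h') h0
    have h0' : (weftAt s (C.n₁ + C.n₂) C.gates (C.n₁ + C.n₂ + i) == 0) = false := by
      simpa using h0
    have hju := hw _ hjv
    have hre := hr _ hjv
    simp only [justified, h0', Bool.false_or, C.gateD_gates hi] at hju
    simp only [requirements, h0', cond_false, C.gateD_gates hi] at hre
    have step : ∀ x ∈ (C.gates[i]).inputs, ∀ v', (x, v') ∈ w → C.nodeVal a b x = v' := by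
      intro x hx v' hxv
      have h1 := C.depthAt_input hi hx
      have h2 := C.weft'_input s hi hx
      exact ih x (C.inputs_lt i hi x hx) (C.input_lt_size hi hx) v' hxv (by omega) (by omega)
    rw [C.nodeVal_gate _ _ hi]
    cases hc : (C.gates[i]).conj v with
    | true =>
      rw [Gate.eval_eq_iff_of_conj hc]
      intro x hx
      simp only [hc, cond_true, Bool.or_eq_true, List.all_eq_true, List.elem_eq_mem,
        decide_eq_true_eq] at hju
      cases hl : Nat.ble (C.gates[i]).inputs.length s with
      | true =>
        rw [hl] at hju
        exact step x hx _ ((hju.resolve_left (by simp)) x hx)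
      | false =>
        have hls : s < (C.gates[i]).inputs.length := by
          rw [← Bool.not_eq_true, Nat.ble_eq] at hl; omega
        have h1 := C.depthAt_input hi hx
        -- The inputs of a large gate are not in the certificate. They have weft zero, and their
        -- values are supplied by the requirements.
        refine hre (x, _) ?_ (C.input_lt_size hi hx) (by simp only; omega)
          (C.weft'_input_of_large hi hx hls hwj)
        simp only [hc, hl, Bool.not_false, Bool.and_self, cond_true, List.mem_map]
        exact ⟨x, hx, rfl⟩
    | false =>
      rw [Gate.eval_eq_iff_of_not_conj hc]
      simp only [hc, cond_false, List.any_eq_true, List.elem_eq_mem, decide_eq_true_eq] at hju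
      obtain ⟨x, hx, hxw⟩ := hju
      exact ⟨x, hx, step x hx _ hxw⟩

end Circuit

/-! ### Correctness of the constraints -/

lemma compatible_iff {I I' : List ℕ} {τ τ' : List Gap} : compatible I τ I' τ' = true ↔
    ∀ l i, I[l]? = some i → ∀ l' i', I'[l']? = some i' →
      (i = i' → τ.getD l (0, 0) = τ'.getD l' (0, 0)) ∧
      (i + 1 = i' → (τ.getD l (0, 0)).2 = (τ'.getD l' (0, 0)).1) := by
  simp only [compatible, List.all_eq_true, Prod.forall, List.mk_mem_zipIdx_iff_getElem?,
    Bool.and_eq_true, Bool.or_eq_true, bne_iff_ne, beq_iff_eq, ← imp_iff_not_or]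
  exact ⟨fun h l i hl l' i' hl' => h i l hl i' l' hl', fun h i l hl i' l' hl' => h l i hl l' i' hl'⟩

lemma boundary_iff {n k : ℕ} {I : List ℕ} {τ : List Gap} : boundary n k I τ = true ↔
    ∀ l i, I[l]? = some i → (i = 0 → (τ.getD l (0, 0)).1 = 0) ∧
      (i = k → (τ.getD l (0, 0)).2 = n + 1) := by
  simp only [boundary, List.all_eq_true, Prod.forall, List.mk_mem_zipIdx_iff_getElem?,
    Bool.and_eq_true, Bool.or_eq_true, bne_iff_ne, beq_iff_eq, ← imp_iff_not_or]
  exact forall_comm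

namespace Circuit

variable (C : Circuit)

/-- The part of an assignment that concerns the first block. -/
def first (α : ℕ → Bool) : Fin C.n₁ → Bool := fun i => α i

/-- The variable for the value of a node under a guess. -/
abbrev nvar (t j : ℕ) : ℕ := nodeVar C.n₁ C.size t j

/-- Every violation of a local evaluation rule is listed as a fault. Without faults the variables
for the guess obey all rules, and `nodeVal_unique` applies. -/
lemma nodeVal_of_no_fault {α : ℕ → Bool} {τ : List Gap} {t : ℕ}
    (h : ∀ p ∈ faults C.n₁ C.n₂ C.gates τ t, ∃ c ∈ p, α c.1 ≠ c.2) :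
    ∀ j < C.size, α (C.nvar t j) = C.nodeVal (C.first α) (C.guessed τ) j := by
  have hbool : ∀ x y : Bool, x ≠ !y → x = y := by decide
  refine C.nodeVal_unique (f := fun j => α (C.nvar t j)) _ _ ?_ ?_ ?_
  · intro i hi
    obtain ⟨c, hc, hc'⟩ := h [(i, α i), (C.nvar t i, !(α i))] (by
      refine List.mem_append_left _ (List.mem_map.2 ⟨(i, α i), ?_, rfl⟩)
      exact List.pair_mem_product.2 ⟨List.mem_range.2 hi, by cases α i <;> simp⟩)
    rcases List.mem_cons.1 hc with rfl | hc
    · exact absurd rfl hc'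
    · rw [List.mem_singleton] at hc
      subst hc
      exact hbool _ _ hc'
  · intro i hi
    obtain ⟨c, hc, hc'⟩ := h [(C.nvar t (C.n₁ + i), !(guess τ i))] (by
      refine List.mem_append_right _ (List.mem_append_left _ (List.mem_map.2 ⟨i, ?_, rfl⟩))
      exact List.mem_range.2 hi)
    rw [List.mem_singleton] at hc
    subst hc
    exact hbool _ _ hc'
  · intro j hj
    by_contra hne
    -- The relevant fault is the one for the value `v` that the inputs force on the gate: the gate's
    -- variable is `!v` although the inputs demand `v`.
    generalize hv : (C.gates[j]).eval (fun j => α (C.nvar t j)) = v at hne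
    have hne' : α (C.nvar t (C.n₁ + C.n₂ + j)) = !v := by
      revert hne; generalize α (C.nvar t (C.n₁ + C.n₂ + j)) = x; revert x v; simp
    have hmem : ((C.gates[j], j), v) ∈ C.gates.zipIdx.product [true, false] :=
      List.pair_mem_product.2 ⟨List.mk_mem_zipIdx_iff_getElem?.2 (List.getElem?_eq_getElem hj),
        by cases v <;> simp⟩
    cases hc : (C.gates[j]).conj v with
    | true =>
      rw [Gate.eval_eq_iff_of_conj hc] at hv
      obtain ⟨c, hcm, hcv⟩ := h ((C.nvar t (C.n₁ + C.n₂ + j), !v) ::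
        (C.gates[j]).inputs.map fun i => (C.nvar t i, (C.gates[j]).inVal v)) (by
          refine List.mem_append_right _ (List.mem_append_right _ (List.mem_flatMap.2
            ⟨_, hmem, ?_⟩))
          rw [hc]
          exact List.mem_singleton.2 rfl)
      rcases List.mem_cons.1 hcm with rfl | hcm
      · exact hcv hne'
      · obtain ⟨i, hi, rfl⟩ := List.mem_map.1 hcm
        exact hcv (hv i hi)
    | false =>
      rw [Gate.eval_eq_iff_of_not_conj hc] at hv
      obtain ⟨i, hi, hiv⟩ := hv
      obtain ⟨c, hcm, hcv⟩ := h [(C.nvar t (C.n₁ + C.n₂ + j), !v),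
        (C.nvar t i, (C.gates[j]).inVal v)] (by
          refine List.mem_append_right _ (List.mem_append_right _ (List.mem_flatMap.2
            ⟨_, hmem, ?_⟩))
          rw [hc]
          exact List.mem_map.2 ⟨i, hi, rfl⟩)
      rcases List.mem_cons.1 hcm with rfl | hcm
      · exact hcv hne'
      · rw [List.mem_singleton] at hcm
        subst hcm
        exact hcv hiv

/-- True values obey the evaluation rules, whereas the literals of a fault together contradict one
of them. -/
lemma no_fault {α : ℕ → Bool} {τ : List Gap} {t : ℕ}
    (h : ∀ j < C.size, α (C.nvar t j) = C.nodeVal (C.first α) (C.guessed τ) j) :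
    ∀ p ∈ faults C.n₁ C.n₂ C.gates τ t, ∃ c ∈ p, α c.1 ≠ c.2 := by
  intro p hp
  have hsz : C.n₁ + C.n₂ + C.gates.length = C.size := rfl
  rcases List.mem_append.1 hp with hp | hp
  · obtain ⟨⟨i, v⟩, hiv, rfl⟩ := List.mem_map.1 hp
    have hi := List.mem_range.1 (List.pair_mem_product.1 hiv).1
    by_cases hα : α i = v
    · refine ⟨_, List.mem_cons_of_mem _ (List.mem_singleton.2 rfl), ?_⟩
      change α (C.nvar t i) ≠ !v
      rw [h i (by unfold size; omega), nodeVal_left _ _ _ hi, first, hα]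
      simp
    · exact ⟨_, List.mem_cons_self, hα⟩
  rcases List.mem_append.1 hp with hp | hp
  · obtain ⟨i, hi, rfl⟩ := List.mem_map.1 hp
    rw [List.mem_range] at hi
    refine ⟨_, List.mem_singleton.2 rfl, ?_⟩
    change α (C.nvar t (C.n₁ + i)) ≠ !(guess τ i)
    rw [h _ (by unfold size; omega), nodeVal_right _ _ _ hi, guessed]
    simp
  · obtain ⟨⟨⟨g, j⟩, v⟩, hm, hp⟩ := List.mem_flatMap.1 hp
    obtain ⟨hj, rfl⟩ := List.getElem?_eq_some_iff.1
      (List.mk_mem_zipIdx_iff_getElem?.1 (List.pair_mem_product.1 hm).1)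
    by_contra hcon
    push Not at hcon
    have hval := C.nodeVal_gate (C.first α) (C.guessed τ) hj
    rw [← h _ (by unfold size; omega)] at hval
    simp only [hsz] at hp
    cases hc : (C.gates[j]).conj v with
    | true =>
      rw [hc, cond_true, List.mem_singleton] at hp
      subst hp
      have h1 := hcon _ List.mem_cons_self
      simp only at h1
      have h2 : (C.gates[j]).eval (C.nodeVal (C.first α) (C.guessed τ)) = v := by
        rw [Gate.eval_eq_iff_of_conj hc]
        intro i hi
        rw [← h i (C.input_lt_size hj hi)]
        exact hcon (C.nvar t i, _) (List.mem_cons_of_mem _ (List.mem_map.2 ⟨i, hi, rfl⟩))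
      rw [h2, h1] at hval
      simp at hval
    | false =>
      rw [hc, cond_false, List.mem_map] at hp
      obtain ⟨i, hi, rfl⟩ := hp
      have h1 := hcon _ List.mem_cons_self
      simp only at h1
      have h2 : (C.gates[j]).eval (C.nodeVal (C.first α) (C.guessed τ)) = v := by
        rw [Gate.eval_eq_iff_of_not_conj hc]
        refine ⟨i, hi, ?_⟩
        rw [← h i (C.input_lt_size hj hi)]
        exact hcon _ (List.mem_cons_of_mem _ (List.mem_singleton.2 rfl))
      rw [h2, h1] at hval
      simp at hval

lemma size_pos : 0 < C.size := by have := C.out_lt; unfold size; omega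

/-- The assignment whose variables for nodes have the intended values. -/
def truthful (m : ℕ) (a : Fin C.n₁ → Bool) (x : ℕ) : Bool :=
  if h : x < C.n₁ then a ⟨x, h⟩
  else C.nodeVal a (C.guessed ((guesses m C.n₂).getD ((x - C.n₁) / C.size) ([], 0)).1)
    ((x - C.n₁) % C.size)

lemma first_truthful (m : ℕ) (a : Fin C.n₁ → Bool) : C.first (C.truthful m a) = a := by
  funext i
  simp [first, truthful]

lemma guesses_getD {m n t : ℕ} {τ : List Gap} (h : (τ, t) ∈ guesses m n) :
    (guesses m n).getD t ([], 0) = (τ, t) := by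
  have h1 := List.mk_mem_zipIdx_iff_getElem?.1 h
  rw [List.getD_eq_getElem?_getD, guesses, List.getElem?_zipIdx, h1]
  simp

lemma truthful_nvar {m t j : ℕ} {τ : List Gap} (a : Fin C.n₁ → Bool)
    (h : (τ, t) ∈ guesses m C.n₂) (hj : j < C.size) :
    C.truthful m a (C.nvar t j) = C.nodeVal a (C.guessed τ) j := by
  have h1 : ¬ C.nvar t j < C.n₁ := by unfold nvar nodeVar; omega
  have h2 : C.nvar t j - C.n₁ = j + C.size * t := by unfold nvar nodeVar; rw [mul_comm]; omega
  -- Quotient and remainder by the number of nodes recover the number of the guess and the node.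
  rw [truthful, dif_neg h1, h2, Nat.add_mul_div_left _ _ C.size_pos, Nat.div_eq_of_lt hj, zero_add,
    guesses_getD h, Nat.add_mul_mod_self_left, Nat.mod_eq_of_lt hj]

end Circuit

/-- A selection of choices, one for every block, that satisfies all constraints. -/
def Selects (E : List Choice) (B : List (List ℕ)) (α : ℕ → Bool) (sel : List ℕ → Choice) : Prop :=
  ∀ I ∈ B, sel I ∈ E ∧ (sel I).1 = I ∧ (∀ c ∈ (sel I).2.2.2.2, α c.1 = c.2) ∧
    ∀ J ∈ B, conflict (sel I) (sel J) = false

lemma conflict_eq_false {e e' : Choice} : conflict e e' = false ↔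
    e.2.1 = e'.2.1 ∧ e.2.2.1 = e'.2.2.1 ∧ compatible e.1 e.2.2.2.1 e'.1 e'.2.2.2.1 = true := by
  simp [conflict]

namespace Circuit

variable (C : Circuit) {s u k : ℕ} {v : Bool}

lemma mem_choices {e : Choice} : e ∈ choices s u v C.raw k ↔
    ∃ I ∈ blocks (s ^ u) k,
      (∃ w ∈ certs s u (C.n₁ + C.n₂) C.gates C.out v, ∃ τ t, (τ, t) ∈ guesses (s ^ u) C.n₂ ∧
        boundary C.n₂ k I τ = true ∧
        e = (I, true, w, τ, regularLits s C.n₁ C.n₂ C.gates w τ t)) ∨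
      ∃ τ t, (τ, t) ∈ guesses (s ^ u) C.n₂ ∧ ∃ p ∈ faults C.n₁ C.n₂ C.gates τ t,
        e = (I, false, [], [], p) := by
  have hp : ∀ (l : List (List Claim)) (l' : List (List Gap × ℕ)) x y,
    (x, y) ∈ l.product l' ↔ x ∈ l ∧ y ∈ l' := fun l l' x y => List.pair_mem_product
  simp only [choices, raw, List.mem_flatMap, List.mem_append, List.mem_map, List.mem_filter,
    Prod.exists, hp]
  refine exists_congr fun I => and_congr_right fun _ => or_congr ?_ ?_
  · constructor
    · rintro ⟨w, τ, t, ⟨⟨h1, h2⟩, h3⟩, rfl⟩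
      exact ⟨w, h1, τ, t, h2, h3, rfl⟩
    · rintro ⟨w, h1, τ, t, h2, h3, rfl⟩
      exact ⟨w, τ, t, ⟨⟨h1, h2⟩, h3⟩, rfl⟩
  · constructor
    · rintro ⟨p, ⟨τ, t, h1, h2⟩, rfl⟩
      exact ⟨τ, t, h1, p, h2, rfl⟩
    · rintro ⟨τ, t, h1, p, h2, rfl⟩
      exact ⟨p, ⟨τ, t, h1, h2⟩, rfl⟩

lemma mem_guesses {m n : ℕ} {τ : List Gap} (h1 : τ.length = m) (h2 : ∀ g ∈ τ, g ∈ gaps n) :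
    ∃ t, (τ, t) ∈ guesses m n := by
  obtain ⟨t, ht⟩ := List.mem_iff_getElem?.1 (mem_tuples.2 ⟨h1, h2⟩)
  exact ⟨t, List.mk_mem_zipIdx_iff_getElem?.2 ht⟩

lemma mem_tuples_of_mem_guesses {m n t : ℕ} {τ : List Gap} (h : (τ, t) ∈ guesses m n) :
    τ ∈ tuples m (gaps n) :=
  List.mem_of_getElem? (List.mk_mem_zipIdx_iff_getElem?.1 h)

lemma mem_blocks {m k : ℕ} {I : List ℕ} : I ∈ blocks m k ↔ I.length = m ∧ ∀ i ∈ I, i ≤ k := by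
  simp [blocks, mem_tuples]

lemma mem_regularLits {w : List Claim} {τ : List Gap} {t : ℕ} {c : Claim} :
    c ∈ regularLits s C.n₁ C.n₂ C.gates w τ t ↔ ∃ d ∈ w, ∃ r ∈ requirements s (C.n₁ + C.n₂)
      C.gates d, C.cov τ r.1 = true ∧ c = (C.nvar t r.1, r.2) := by
  simp only [regularLits, List.mem_map, List.mem_filter, List.mem_flatMap]
  constructor
  · rintro ⟨r, ⟨⟨d, h1, h2⟩, h3⟩, rfl⟩
    exact ⟨d, h1, r, h2, h3, rfl⟩
  · rintro ⟨d, h1, r, h2, h3, rfl⟩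
    exact ⟨r, ⟨⟨d, h1, h2⟩, h3⟩, rfl⟩

lemma mem_certs {w : List Claim} : w ∈ certs s u (C.n₁ + C.n₂) C.gates C.out v ↔
    (w.length = (s + 1) ^ u ∧ ∀ c ∈ w, c.1 < C.size) ∧ (C.out, v) ∈ w ∧
      ∀ c ∈ w, justified s (C.n₁ + C.n₂) C.gates w c = true := by
  have hp : ∀ c : Claim, c ∈ (List.range (C.n₁ + C.n₂ + C.gates.length)).product [true, false] ↔
      c.1 < C.size := by
    rintro ⟨i, v⟩
    refine List.pair_mem_product.trans ?_
    cases v <;> simp [size]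
  simp [certs, mem_tuples, hp]

/-- A satisfying assignment to the second block gives a selection. -/
lemma exists_selects (hs : 1 ≤ s) (hC : C ∈ WeftOne s u) (α : ℕ → Bool)
    {b : Fin C.n₂ → Bool} (hb : weight b = k) (hv : C.eval (C.first α) b = v) :
    ∃ sel, Selects (choices s u v C.raw k) (blocks (s ^ u) k) α sel := by
  -- If some universal variables are untruthful, one fault serves as the irregular choice of every
  -- block. Its list of gaps is empty, so all lookups return the default `(0, 0)`, which agrees with
  -- itself and is adjacent to itself.
  by_cases hf : ∃ τ t, (τ, t) ∈ guesses (s ^ u) C.n₂ ∧ ∃ p ∈ faults C.n₁ C.n₂ C.gates τ t,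
      ∀ c ∈ p, α c.1 = c.2
  · obtain ⟨τ, t, h1, p, h2, h3⟩ := hf
    refine ⟨fun I => (I, false, [], [], p), fun I hI => ⟨?_, rfl, h3, fun J _ => ?_⟩⟩
    · exact C.mem_choices.2 ⟨I, hI, .inr ⟨τ, t, h1, p, h2, rfl⟩⟩
    · rw [conflict_eq_false]
      refine ⟨rfl, rfl, compatible_iff.2 ?_⟩
      simp
  · push Not at hf
    have htruth : ∀ τ t, (τ, t) ∈ guesses (s ^ u) C.n₂ → ∀ j < C.size,
        α (C.nvar t j) = C.nodeVal (C.first α) (C.guessed τ) j :=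
      fun τ t h => C.nodeVal_of_no_fault (hf τ t h)
    obtain ⟨p, hp, rfl⟩ := exists_chain b hb
    obtain ⟨w₀, hw1, hw2, hw3⟩ := C.exists_cert (a := C.first α) (b := chainAssign C.n₂ k p) hs u
      C.out C.out_lt hC.1 hC.2
    rw [← C.eval_eq, hv] at hw1
    -- Certificates have a fixed length; copies of the claim about the output fill up.
    let w := w₀ ++ List.replicate ((s + 1) ^ u - w₀.length) (C.out, v)
    have hsub : w₀ ⊆ w := List.subset_append_left _ _
    have hww : ∀ c ∈ w, c ∈ w₀ := by
      intro c hc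
      rcases List.mem_append.1 hc with hc | hc
      · exact hc
      · rw [List.eq_of_mem_replicate hc]; exact hw1
    have hw : w ∈ certs s u (C.n₁ + C.n₂) C.gates C.out v := by
      refine C.mem_certs.2 ⟨⟨?_, fun c hc => (hw3 c (hww c hc)).1⟩, hsub hw1, fun c hc => ?_⟩
      · simp [w]; omega
      · exact justified_mono hsub (hw3 c (hww c hc)).2.2
    have hg : ∀ I ∈ blocks (s ^ u) k, ∃ t, (I.map (gapAt p), t) ∈ guesses (s ^ u) C.n₂ := by
      intro I hI
      rw [mem_blocks] at hI
      refine mem_guesses (by simpa using hI.1) fun g hg => ?_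
      obtain ⟨i, hi, rfl⟩ := List.mem_map.1 hg
      exact hp.gapAt_mem (hI.2 i hi)
    choose! T hT using hg
    have hget : ∀ (I : List ℕ) l i, I[l]? = some i →
        (I.map (gapAt p)).getD l (0, 0) = gapAt p i := by
      intro I l i h
      rw [List.getD_eq_getElem?_getD, List.getElem?_map, h]
      rfl
    -- All blocks share the certificate and read their gaps off one chain, which rules out
    -- conflicts.
    refine ⟨fun I => (I, true, w, I.map (gapAt p),
      regularLits s C.n₁ C.n₂ C.gates w (I.map (gapAt p)) (T I)), fun I hI =>
        ⟨C.mem_choices.2 ⟨I, hI, .inl ⟨w, hw, _, _, hT I hI, ?_, rfl⟩⟩, rfl, ?_, fun J _ => ?_⟩⟩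
    · rw [boundary_iff]
      intro l i hi
      rw [hget I l i hi]
      exact ⟨fun h => by rw [h]; exact hp.zero, fun h => by rw [h]; exact hp.last⟩
    · intro c hc
      obtain ⟨d, hd, r, hr, hcov, rfl⟩ := C.mem_regularLits.1 hc
      obtain ⟨h1, h2, -⟩ := hw3 d (hww d hd)
      obtain ⟨h3, h4⟩ := C.requirements_true h1 h2 r hr
      change α (C.nvar (T I) r.1) = r.2
      rw [htruth _ _ (hT I hI) _ h3, h4]
      refine (C.nodeVal_eq_of_cov (fun x hx => hp.chainAssign_eq_guess ?_ x hx) h3 hcov).symm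
      intro g hg
      obtain ⟨i, hi, rfl⟩ := List.mem_map.1 hg
      exact ⟨i, (mem_blocks.1 hI).2 i hi, rfl⟩
    · rw [conflict_eq_false]
      refine ⟨rfl, rfl, compatible_iff.2 fun l i hi l' i' hi' => ?_⟩
      simp only
      rw [hget I l i hi, hget J l' i' hi']
      exact ⟨fun h => by rw [h], fun h => by rw [← h]; rfl⟩

/-- A selection for the truthful assignment gives a satisfying assignment to the second block. -/
lemma exists_of_selects (hs : 1 ≤ s) (hC : C ∈ WeftOne s u) (a : Fin C.n₁ → Bool)
    {sel : List ℕ → Choice}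
    (hsel : Selects (choices s u v C.raw k) (blocks (s ^ u) k) (C.truthful (s ^ u) a) sel) :
    ∃ b : Fin C.n₂ → Bool, weight b = k ∧ C.eval a b = v := by
  have hm : 1 ≤ s ^ u := Nat.one_le_pow _ _ hs
  -- A truthful assignment has no faults, so the demands of an irregular choice cannot be met.
  have hreg : ∀ I ∈ blocks (s ^ u) k, ∃ w ∈ certs s u (C.n₁ + C.n₂) C.gates C.out v,
      ∃ τ t, (τ, t) ∈ guesses (s ^ u) C.n₂ ∧ boundary C.n₂ k I τ = true ∧
        sel I = (I, true, w, τ, regularLits s C.n₁ C.n₂ C.gates w τ t) := by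
    intro I hI
    obtain ⟨h1, h2, h3, -⟩ := hsel I hI
    obtain ⟨J, hJ, h | h⟩ := C.mem_choices.1 h1
    · obtain ⟨w, hw, τ, t, ht, hb, he⟩ := h
      obtain rfl : J = I := by rw [he] at h2; exact h2
      exact ⟨w, hw, τ, t, ht, hb, he⟩
    · obtain ⟨τ, t, ht, p, hp, he⟩ := h
      rw [he] at h3
      obtain ⟨c, hc, hc'⟩ := C.no_fault (α := C.truthful (s ^ u) a) (τ := τ) (t := t)
        (fun j hj => by rw [C.truthful_nvar a ht hj, C.first_truthful]) p hp
      exact absurd (h3 c hc) hc'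
  choose! W hW F T hT hB hE using hreg
  have hconf : ∀ I ∈ blocks (s ^ u) k, ∀ J ∈ blocks (s ^ u) k,
      W I = W J ∧ compatible I (F I) J (F J) = true := by
    intro I hI J hJ
    have := (hsel I hI).2.2.2 J hJ
    rw [hE I hI, hE J hJ, conflict_eq_false] at this
    exact this.2
  -- The constant block at `i` isolates the index `i`. Its gap, at entry 0, is the reference with
  -- which the gaps of index `i` in all other blocks are compared; entry 0 exists since `1 ≤ s ^ u`.
  let R : ℕ → List ℕ := fun i => List.replicate (s ^ u) i
  have hR : ∀ i ≤ k, R i ∈ blocks (s ^ u) k := fun i hi =>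
    mem_blocks.2 ⟨by simp [R], fun j hj => by rw [List.eq_of_mem_replicate hj]; exact hi⟩
  have hR0 : ∀ i, (R i)[0]? = some i := fun i => by
    rw [List.getElem?_replicate]; simp; omega
  let γ : ℕ → Gap := fun i => (F (R i)).getD 0 (0, 0)
  have hγ : ∀ I ∈ blocks (s ^ u) k, ∀ l i, I[l]? = some i → (F I).getD l (0, 0) = γ i := by
    intro I hI l i hi
    have hik : i ≤ k := (mem_blocks.1 hI).2 i (List.mem_of_getElem? hi)
    exact (compatible_iff.1 (hconf I hI (R i) (hR i hik)).2 l i hi 0 i (hR0 i)).1 rfl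
  have hlt : ∀ i ≤ k, (γ i).1 < (γ i).2 := by
    intro i hi
    have h1 := mem_tuples.1 (mem_tuples_of_mem_guesses (hT _ (hR i hi)))
    have h2 : γ i ∈ F (R i) := by
      simp only [γ]
      rw [List.getD_eq_getElem _ _ (by omega)]
      exact List.getElem_mem _
    have h3 := h1.2 _ h2
    rw [gaps, List.mem_filter, Nat.ble_eq] at h3
    exact h3.2
  have hadj : ∀ i, i + 1 ≤ k → (γ i).2 = (γ (i + 1)).1 := fun i hi =>
    (compatible_iff.1 (hconf _ (hR i (by omega)) _ (hR (i + 1) hi)).2 0 i (hR0 _) 0 (i + 1)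
      (hR0 _)).2 rfl
  -- The chain consists of the left ends of the gaps. Adjacency, and the boundary condition for the
  -- last gap, turn right ends into the next members.
  let p : ℕ → ℕ := fun i => if i ≤ k then (γ i).1 else C.n₂ + 1
  have hgap : ∀ i ≤ k, γ i = gapAt p i := by
    intro i hi
    have h1 : p i = (γ i).1 := if_pos hi
    have h2 : p (i + 1) = (γ i).2 := by
      by_cases h : i + 1 ≤ k
      · rw [hadj i h]; exact if_pos h
      · rw [show p (i + 1) = C.n₂ + 1 from if_neg h]
        exact ((boundary_iff.1 (hB _ (hR i hi)) 0 i (hR0 i)).2 (by omega)).symm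
    rw [gapAt, h1, h2]
  have hp : IsChain C.n₂ k p := by
    refine ⟨?_, if_neg (by omega), fun i hi => ?_⟩
    · rw [show p 0 = (γ 0).1 from if_pos (by omega)]
      exact (boundary_iff.1 (hB _ (hR 0 (by omega))) 0 0 (hR0 0)).1 rfl
    · have := hlt i hi
      rw [hgap i hi] at this
      exact this
  have hF : ∀ I ∈ blocks (s ^ u) k, F I = I.map (gapAt p) := by
    intro I hI
    have h1 := (mem_tuples.1 (mem_tuples_of_mem_guesses (hT _ hI))).1
    have h2 := (mem_blocks.1 hI).1
    refine List.ext_getElem (by simp [h1, h2]) fun l hl hl' => ?_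
    have hl2 : l < I.length := by simpa using hl'
    have h3 := hγ I hI l I[l] (List.getElem?_eq_getElem hl2)
    rw [List.getD_eq_getElem _ _ hl] at h3
    rw [h3, List.getElem_map, hgap]
    exact (mem_blocks.1 hI).2 _ (List.getElem_mem _)
  refine ⟨chainAssign C.n₂ k p, hp.weight_chainAssign, ?_⟩
  have hw := C.mem_certs.1 (hW _ (hR 0 (by omega)))
  rw [C.eval_eq]
  refine C.cert_sound (u := u) hw.2.2 ?_ C.out C.out_lt v hw.2.1 hC.1 hC.2
  intro c hc r hr hr1 hr2 hr3
  obtain ⟨L, hL1, hL2, hL3⟩ := C.exists_cov hp hs u r.1 hr1 hr2 hr3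
  -- The indices that cover the required node, filled up with 0, form a block. The choice for this
  -- block covers the node and therefore demands its value.
  let I := L ++ List.replicate (s ^ u - L.length) 0
  have hI : I ∈ blocks (s ^ u) k := by
    refine mem_blocks.2 ⟨by simp [I]; omega, fun i hi => ?_⟩
    rcases List.mem_append.1 hi with hi | hi
    · exact hL2 i hi
    · rw [List.eq_of_mem_replicate hi]; omega
  have hcov : C.cov (F I) r.1 = true := by
    refine C.cov_mono ?_ hr1 hL3
    rw [hF I hI]
    exact List.map_subset _ (List.subset_append_left _ _)
  have hsat := (hsel I hI).2.2.1
  rw [hE I hI] at hsat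
  have h1 := hsat (C.nvar (T I) r.1, r.2) (C.mem_regularLits.2
    ⟨c, by rw [(hconf I hI _ (hR 0 (by omega))).1]; exact hc, r, hr, hcov, rfl⟩)
  simp only at h1
  rw [C.truthful_nvar a (hT I hI) hr1] at h1
  rw [← h1]
  refine C.nodeVal_eq_of_cov (fun x hx => hp.chainAssign_eq_guess ?_ x hx) hr1 hcov
  intro g hg
  rw [hF I hI] at hg
  obtain ⟨i, hi, rfl⟩ := List.mem_map.1 hg
  exact ⟨i, (mem_blocks.1 hI).2 i hi, rfl⟩

/-- From left to right an arbitrary `α` is handled through its first `n₁` values; from right to left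
only truthful assignments are used. -/
theorem forall_exists_iff_selects (hs : 1 ≤ s) (hC : C ∈ WeftOne s u) :
    (∀ a, ∃ b : Fin C.n₂ → Bool, weight b = k ∧ C.eval a b = v) ↔
      ∀ α, ∃ sel, Selects (choices s u v C.raw k) (blocks (s ^ u) k) α sel := by
  constructor
  · intro h α
    obtain ⟨b, hb, hv⟩ := h (C.first α)
    exact C.exists_selects hs hC α hb hv
  · intro h a
    obtain ⟨sel, hsel⟩ := h (C.truthful (s ^ u) a)
    exact C.exists_of_selects hs hC a hsel

end Circuit

/-! ### Selections as weighted assignments -/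

/-- The joint assignment to the two blocks of variables. -/
def glue {n : ℕ} (n₁ : ℕ) (α : ℕ → Bool) (b : Fin n → Bool) (x : ℕ) : Bool :=
  if x < n₁ then α x else if h : x - n₁ < n then b ⟨x - n₁, h⟩ else false

lemma glue_left {n n₁ : ℕ} (α : ℕ → Bool) (b : Fin n → Bool) {x : ℕ} (hx : x < n₁) :
    glue n₁ α b x = α x := if_pos hx

lemma glue_right {n n₁ : ℕ} (α : ℕ → Bool) (b : Fin n → Bool) (i : Fin n) :
    glue n₁ α b (n₁ + i) = b i := by
  simp [glue]

/-- The clause is satisfied. -/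
def Clause.Holds (f : ℕ → Bool) (c : Clause) : Prop := f c.1 = true → f c.2.1 = c.2.2

/-- By `hlit` the demanded literals lie in the universal part, where `glue` is `α`. The case `i = j`
is included in the last condition: a choice that conflicts with itself yields a clause forbidding
it, as `Selects` requires. -/
lemma choiceClauses_hold_iff {n₁ : ℕ} {E : List Choice} {α : ℕ → Bool} {b : Fin E.length → Bool}
    (hlit : ∀ e ∈ E, ∀ c ∈ e.2.2.2.2, c.1 < n₁) :
    (∀ c ∈ choiceClauses n₁ E, c.Holds (glue n₁ α b)) ↔
      (∀ i, b i = true → ∀ c ∈ E[i].2.2.2.2, α c.1 = c.2) ∧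
      ∀ i j, b i = true → b j = true →
        (E[i].1 = E[j].1 → i = j) ∧ conflict E[i] E[j] = false := by
  constructor
  · intro h
    refine ⟨fun i hi c hc => ?_, fun i j hi hj => ?_⟩
    · have := h (n₁ + i, c.1, c.2) (List.mem_append_left _ (List.mem_flatMap.2
        ⟨(E[i], i.1), List.mk_mem_zipIdx_iff_getElem?.2 (List.getElem?_eq_getElem i.2),
          List.mem_map.2 ⟨c, hc, rfl⟩⟩)) (by simpa only [glue_right] using hi)
      simp only at this
      rwa [glue_left _ _ (hlit _ (List.getElem_mem _) c hc)] at this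
    · have key : ¬ ((E[i].1 == E[j].1 && i.1 != j.1) || conflict E[i] E[j]) = true := by
        intro hcon
        have := h (n₁ + i, n₁ + j, false) (List.mem_append_right _ (List.mem_flatMap.2
          ⟨(E[i], i.1), List.mk_mem_zipIdx_iff_getElem?.2 (List.getElem?_eq_getElem i.2),
          List.mem_map.2 ⟨(E[j], j.1), List.mem_filter.2
            ⟨List.mk_mem_zipIdx_iff_getElem?.2 (List.getElem?_eq_getElem j.2), hcon⟩, rfl⟩⟩))
          (by simpa only [glue_right] using hi)
        simp only [glue_right, hj] at this
        simp at this
      simp only [Bool.or_eq_true, Bool.and_eq_true, beq_iff_eq, bne_iff_ne, not_or, not_and,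
        not_not, Bool.not_eq_true] at key
      exact ⟨fun h => Fin.ext (key.1 h), key.2⟩
  · rintro ⟨h1, h2⟩ c hc
    rcases List.mem_append.1 hc with hc | hc
    · obtain ⟨⟨e, i⟩, hi, hc⟩ := List.mem_flatMap.1 hc
      obtain ⟨d, hd, rfl⟩ := List.mem_map.1 hc
      obtain ⟨hi', rfl⟩ := List.getElem?_eq_some_iff.1 (List.mk_mem_zipIdx_iff_getElem?.1 hi)
      intro hb
      have hb' := (glue_right (n₁ := n₁) α b ⟨i, hi'⟩).symm.trans hb
      simp only
      rw [glue_left _ _ (hlit _ (List.getElem_mem _) d hd)]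
      exact h1 ⟨i, hi'⟩ hb' d hd
    · obtain ⟨⟨e, i⟩, hi, hc⟩ := List.mem_flatMap.1 hc
      obtain ⟨⟨e', j⟩, hjf, rfl⟩ := List.mem_map.1 hc
      obtain ⟨hj, hcon⟩ := List.mem_filter.1 hjf
      clear hjf hc
      obtain ⟨hi', rfl⟩ := List.getElem?_eq_some_iff.1 (List.mk_mem_zipIdx_iff_getElem?.1 hi)
      obtain ⟨hj', rfl⟩ := List.getElem?_eq_some_iff.1 (List.mk_mem_zipIdx_iff_getElem?.1 hj)
      intro hb
      have hb' := (glue_right (n₁ := n₁) α b ⟨i, hi'⟩).symm.trans hb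
      refine ((glue_right (n₁ := n₁) α b ⟨j, hj'⟩)).trans ?_
      by_contra hbj
      rw [Bool.not_eq_false] at hbj
      obtain ⟨h3, h4⟩ := h2 _ _ hb' hbj
      simp only [Fin.getElem_fin] at h3 h4
      simp only [h4, Bool.or_false, Bool.and_eq_true, beq_iff_eq, bne_iff_ne] at hcon
      exact hcon.2 (by simpa using h3 hcon.1)

lemma exists_selects_iff {n₁ : ℕ} {E : List Choice} {B : List (List ℕ)} (hB : B.Nodup)
    (hE : ∀ e ∈ E, e.1 ∈ B) (hlit : ∀ e ∈ E, ∀ c ∈ e.2.2.2.2, c.1 < n₁) (α : ℕ → Bool) :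
    (∃ sel, Selects E B α sel) ↔ ∃ b : Fin E.length → Bool, weight b = B.length ∧
      ∀ c ∈ choiceClauses n₁ E, c.Holds (glue n₁ α b) := by
  have hcard : B.toFinset.card = B.length := List.toFinset_card_of_nodup hB
  constructor
  · rintro ⟨sel, hsel⟩
    have hidx : ∀ I ∈ B, ∃ i : Fin E.length, E[i] = sel I := by
      intro I hI
      obtain ⟨i, hi, h⟩ := List.mem_iff_getElem.1 (hsel I hI).1
      exact ⟨⟨i, hi⟩, h⟩
    choose idx hidx using fun I : {I // I ∈ B} => hidx I.1 I.2
    have hinj : Function.Injective idx := by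
      intro I J h
      have h1 := hidx I
      rw [h, hidx J] at h1
      have h2 := (hsel I.1 I.2).2.1
      rw [← h1, (hsel J.1 J.2).2.1] at h2
      exact Subtype.ext h2.symm
    let b : Fin E.length → Bool := fun i => decide (i ∈ B.attach.toFinset.image idx)
    have hb : ∀ i, b i = true ↔ ∃ I, idx I = i := by
      intro i; simp [b]
    refine ⟨b, ?_, (choiceClauses_hold_iff hlit).2 ⟨?_, ?_⟩⟩
    · have : (Finset.univ.filter fun i => b i = true) = B.attach.toFinset.image idx := by
        ext i; simp [b]
      rw [weight, this, Finset.card_image_of_injective _ hinj,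
        List.toFinset_card_of_nodup (List.nodup_attach.2 hB), List.length_attach]
    · intro i hi c hc
      obtain ⟨I, rfl⟩ := (hb i).1 hi
      rw [hidx I] at hc
      exact (hsel I.1 I.2).2.2.1 c hc
    · intro i j hi hj
      obtain ⟨I, rfl⟩ := (hb i).1 hi
      obtain ⟨J, rfl⟩ := (hb j).1 hj
      rw [hidx I, hidx J]
      refine ⟨fun h => ?_, (hsel I.1 I.2).2.2.2 J.1 J.2⟩
      rw [(hsel I.1 I.2).2.1, (hsel J.1 J.2).2.1] at h
      rw [Subtype.ext h]
  · rintro ⟨b, hb, hc⟩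
    obtain ⟨h1, h2⟩ := (choiceClauses_hold_iff hlit).1 hc
    have himg : (Finset.univ.filter fun i => b i = true).image (fun i => E[i].1) = B.toFinset := by
      refine Finset.eq_of_subset_of_card_le ?_ ?_
      · intro I hI
        obtain ⟨i, -, rfl⟩ := Finset.mem_image.1 hI
        exact List.mem_toFinset.2 (hE _ (List.getElem_mem _))
      · rw [Finset.card_image_of_injOn, hcard, ← hb, weight]
        intro i hi j hj h
        simp only [Finset.coe_filter, Finset.mem_univ, true_and, Set.mem_ofPred_eq] at hi hj
        exact (h2 i j hi hj).1 h
    have hex : ∀ I ∈ B, ∃ i, b i = true ∧ E[i].1 = I := by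
      intro I hI
      rw [← List.mem_toFinset, ← himg] at hI
      obtain ⟨i, hi, h⟩ := Finset.mem_image.1 hI
      exact ⟨i, (Finset.mem_filter.1 hi).2, h⟩
    choose idx hidx using fun I : {I // I ∈ B} => hex I.1 I.2
    refine ⟨fun I => if h : I ∈ B then E[idx ⟨I, h⟩] else default, fun I hI => ?_⟩
    beta_reduce
    rw [dif_pos hI]
    refine ⟨List.getElem_mem _, (hidx ⟨I, hI⟩).2, h1 _ (hidx ⟨I, hI⟩).1, fun J hJ => ?_⟩
    rw [dif_pos hJ]
    exact (h2 _ _ (hidx ⟨I, hI⟩).1 (hidx ⟨J, hJ⟩).1).2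

/-! ### From circuits to clauses: ranges of the variables and equivalence -/

namespace Circuit

variable (C : Circuit) {s u k : ℕ} {v : Bool}

lemma choice_block {e : Choice} (h : e ∈ choices s u v C.raw k) : e.1 ∈ blocks (s ^ u) k := by
  obtain ⟨I, hI, ⟨w, -, τ, t, -, -, rfl⟩ | ⟨τ, t, -, p, -, rfl⟩⟩ := C.mem_choices.1 h <;> exact hI

lemma nvar_lt {m t j : ℕ} {τ : List Gap} (ht : (τ, t) ∈ guesses m C.n₂) (hj : j < C.size) :
    C.nvar t j < numUniversal m C.raw := by
  have h1 : t < (guesses m C.n₂).length := by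
    have := List.snd_lt_of_mem_zipIdx ht
    simpa [guesses] using this
  have h2 := Nat.mul_le_mul_right C.size (Nat.succ_le_of_lt h1)
  rw [Nat.succ_mul] at h2
  change C.n₁ + t * C.size + j < C.n₁ + (guesses m C.n₂).length * C.size
  omega

lemma fault_lt {m t : ℕ} {τ : List Gap} (ht : (τ, t) ∈ guesses m C.n₂) {p : List Claim}
    (hp : p ∈ faults C.n₁ C.n₂ C.gates τ t) {c : Claim} (hc : c ∈ p) :
    c.1 < numUniversal m C.raw := by
  have key : ∀ j < C.size, nodeVar C.n₁ (C.n₁ + C.n₂ + C.gates.length) t j <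
    numUniversal m C.raw := fun j hj => C.nvar_lt ht hj
  rcases List.mem_append.1 hp with hp | hp
  · obtain ⟨⟨i, x⟩, hiv, rfl⟩ := List.mem_map.1 hp
    have hi := List.mem_range.1 (List.pair_mem_product.1 hiv).1
    rcases List.mem_cons.1 hc with rfl | hc
    · exact hi.trans_le (Nat.le_add_right _ _)
    · rw [List.mem_singleton] at hc
      subst hc
      exact key _ (by unfold size; omega)
  rcases List.mem_append.1 hp with hp | hp
  · obtain ⟨i, hi, rfl⟩ := List.mem_map.1 hp
    rw [List.mem_range] at hi
    rw [List.mem_singleton] at hc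
    subst hc
    exact key _ (by unfold size; omega)
  · obtain ⟨⟨⟨g, j⟩, x⟩, hm, hp⟩ := List.mem_flatMap.1 hp
    obtain ⟨hj, rfl⟩ := List.getElem?_eq_some_iff.1
      (List.mk_mem_zipIdx_iff_getElem?.1 (List.pair_mem_product.1 hm).1)
    cases hcj : (C.gates[j]).conj x with
    | true =>
      rw [hcj, cond_true, List.mem_singleton] at hp
      subst hp
      rcases List.mem_cons.1 hc with rfl | hc
      · exact key (C.n₁ + C.n₂ + j) (by unfold size; omega)
      · obtain ⟨i, hi, rfl⟩ := List.mem_map.1 hc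
        exact key _ (C.input_lt_size hj hi)
    | false =>
      rw [hcj, cond_false, List.mem_map] at hp
      obtain ⟨i, hi, rfl⟩ := hp
      rcases List.mem_cons.1 hc with rfl | hc
      · exact key (C.n₁ + C.n₂ + j) (by unfold size; omega)
      · rw [List.mem_singleton] at hc
        subst hc
        exact key _ (C.input_lt_size hj hi)

lemma requirements_lt {c : Claim} (hc : c.1 < C.size) :
    ∀ r ∈ requirements s (C.n₁ + C.n₂) C.gates c, r.1 < C.size := by
  intro r hr
  rw [requirements] at hr
  cases h0 : weftAt s (C.n₁ + C.n₂) C.gates c.1 == 0 with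
  | true =>
    rw [h0, cond_true, List.mem_singleton] at hr
    rwa [hr]
  | false =>
    rw [h0, cond_false] at hr
    rcases C.node_cases hc with h' | ⟨i, hi, hci⟩
    · rw [show weftAt s (C.n₁ + C.n₂) C.gates c.1 = 0 from C.weft'_var s h'] at h0
      simp at h0
    · rw [hci, C.gateD_gates hi] at hr
      cases hcj : (C.gates[i]).conj c.2 && !(Nat.ble (C.gates[i]).inputs.length s) with
      | false => simp [hcj] at hr
      | true =>
        rw [hcj, cond_true, List.mem_map] at hr
        obtain ⟨x, hx, rfl⟩ := hr
        exact C.input_lt_size hi hx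

/-- This is the hypothesis `hlit` of `exists_selects_iff`: choices make demands on universal
variables only. -/
lemma choice_lit_lt {e : Choice} (h : e ∈ choices s u v C.raw k) :
    ∀ c ∈ e.2.2.2.2, c.1 < numUniversal (s ^ u) C.raw := by
  intro c hc
  obtain ⟨I, -, ⟨w, hw, τ, t, ht, -, rfl⟩ | ⟨τ, t, ht, p, hp, rfl⟩⟩ := C.mem_choices.1 h
  · obtain ⟨d, hd, r, hr, -, rfl⟩ := C.mem_regularLits.1 hc
    exact C.nvar_lt ht (C.requirements_lt ((C.mem_certs.1 hw).1.2 d hd) r hr)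
  · exact C.fault_lt ht hp hc

/-- The clauses for a circuit, a value and a parameter. -/
def _root_.ParamComplexity.targetClauses (s u : ℕ) (v : Bool) (r : Raw) (k : ℕ) : List Clause :=
  choiceClauses (numUniversal (s ^ u) r) (choices s u v r k)

/-- The new weight is the number of blocks, which for fixed `s` and `u` depends on `k` alone. -/
theorem forall_exists_iff_clauses (hs : 1 ≤ s) (hC : C ∈ WeftOne s u) :
    (∀ a, ∃ b : Fin C.n₂ → Bool, weight b = k ∧ C.eval a b = v) ↔
      ∀ α : ℕ → Bool, ∃ b : Fin (choices s u v C.raw k).length → Bool,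
        weight b = (blocks (s ^ u) k).length ∧ ∀ c ∈ targetClauses s u v C.raw k,
          c.Holds (glue (numUniversal (s ^ u) C.raw) α b) := by
  rw [C.forall_exists_iff_selects hs hC]
  exact forall_congr' fun α => exists_selects_iff (nodup_tuples _ List.nodup_range)
    (fun e he => C.choice_block he) (fun e he => C.choice_lit_lt he) α

lemma targetClauses_lt {c : Clause} (hc : c ∈ targetClauses s u v C.raw k) :
    c.1 < numUniversal (s ^ u) C.raw + (choices s u v C.raw k).length ∧
    c.2.1 < numUniversal (s ^ u) C.raw + (choices s u v C.raw k).length := by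
  rcases List.mem_append.1 hc with hc | hc
  · obtain ⟨⟨e, i⟩, hi, hc⟩ := List.mem_flatMap.1 hc
    obtain ⟨d, hd, rfl⟩ := List.mem_map.1 hc
    have h1 := List.snd_lt_of_mem_zipIdx hi
    have h2 := C.choice_lit_lt (List.fst_mem_of_mem_zipIdx hi) d hd
    simp only at h1 h2 ⊢
    omega
  · obtain ⟨⟨e, i⟩, hi, hc⟩ := List.mem_flatMap.1 hc
    obtain ⟨⟨e', j⟩, hj, rfl⟩ := List.mem_map.1 hc
    have h1 := List.snd_lt_of_mem_zipIdx hi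
    have h2 := List.snd_lt_of_mem_zipIdx (List.mem_filter.1 hj).1
    simp only at h1 h2 ⊢
    omega

end Circuit

/-! ### Clauses as formulas -/

/-- The gate for a clause, or for its negation. -/
def clauseGate (pol : Bool) (n L : ℕ) (x : Clause × ℕ) : Gate :=
  bif pol then .or [n + x.2, bif x.1.2.2 then x.1.2.1 else n + L + x.2]
  else .and [x.1.1, bif x.1.2.2 then n + L + x.2 else x.1.2.1]

/-- The output gate over the gates for the clauses. -/
def outGate (pol : Bool) (n L : ℕ) : Gate :=
  bif pol then .and ((List.range L).map fun i => n + 2 * L + i)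
  else .or ((List.range L).map fun i => n + 2 * L + i)

/-- The gates of a formula over `n` variables that expresses that all clauses hold if `pol` is
true, and that some clause does not hold otherwise. -/
def formulaGates (pol : Bool) (n : ℕ) (cls : List Clause) : List Gate :=
  (cls.map fun c => Gate.not c.1) ++ ((cls.map fun c => Gate.not c.2.1) ++
    ((cls.zipIdx.map fun x => clauseGate pol n cls.length x) ++ [outGate pol n cls.length]))

section Formula

variable (pol : Bool) (n : ℕ) (cls : List Clause)

lemma length_formulaGates : (formulaGates pol n cls).length = 3 * cls.length + 1 := by
  simp [formulaGates]; omega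

lemma formulaGates_fst {i : ℕ} (hi : i < cls.length) :
    (formulaGates pol n cls)[i]? = some (.not cls[i].1) := by
  rw [formulaGates, List.getElem?_append_left (by simpa using hi)]
  simp [hi]

lemma formulaGates_snd {i : ℕ} (hi : i < cls.length) :
    (formulaGates pol n cls)[cls.length + i]? = some (.not cls[i].2.1) := by
  rw [formulaGates, List.getElem?_append_right (by simp), List.getElem?_append_left (by simp; omega)]
  simp [hi]

lemma formulaGates_clause {i : ℕ} (hi : i < cls.length) :
    (formulaGates pol n cls)[2 * cls.length + i]? =
      some (clauseGate pol n cls.length (cls[i], i)) := by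
  rw [formulaGates, List.getElem?_append_right (by simp; omega),
    List.getElem?_append_right (by simp; omega), List.getElem?_append_left (by simp; omega)]
  simp only [List.length_map, show 2 * cls.length + i - cls.length - cls.length = i by omega]
  simp [hi]

lemma formulaGates_out :
    (formulaGates pol n cls)[3 * cls.length]? = some (outGate pol n cls.length) := by
  rw [formulaGates, List.getElem?_append_right (by simp; omega),
    List.getElem?_append_right (by simp; omega), List.getElem?_append_right (by simp; omega)]
  simp only [List.length_map, List.length_zipIdx,
    show 3 * cls.length - cls.length - cls.length - cls.length = 0 by omega]
  rfl

lemma formulaGates_cases {j : ℕ} (hj : j < 3 * cls.length + 1) :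
    (∃ i, i < cls.length ∧ j = i) ∨ (∃ i, i < cls.length ∧ j = cls.length + i) ∨
      (∃ i, i < cls.length ∧ j = 2 * cls.length + i) ∨ j = 3 * cls.length := by
  by_cases h1 : j < cls.length
  · exact .inl ⟨j, h1, rfl⟩
  by_cases h2 : j < 2 * cls.length
  · exact .inr (.inl ⟨j - cls.length, by omega, by omega⟩)
  by_cases h3 : j < 3 * cls.length
  · exact .inr (.inr (.inl ⟨j - 2 * cls.length, by omega, by omega⟩))
  · exact .inr (.inr (.inr (by omega)))

variable {cls n}

lemma topoOrdered_formulaGates (h : ∀ c ∈ cls, c.1 < n ∧ c.2.1 < n) :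
    TopoOrdered n (formulaGates pol n cls) := by
  intro j hj x hx
  have hj' := hj
  rw [length_formulaGates] at hj'
  have hg := List.getElem?_eq_getElem hj
  rcases formulaGates_cases cls hj' with ⟨i, hi, rfl⟩ | ⟨i, hi, rfl⟩ | ⟨i, hi, rfl⟩ | rfl
  · rw [formulaGates_fst pol n cls hi, Option.some.injEq] at hg
    rw [← hg] at hx
    have := h _ (List.getElem_mem hi)
    simp [Gate.inputs] at hx
    omega
  · rw [formulaGates_snd pol n cls hi, Option.some.injEq] at hg
    rw [← hg] at hx
    have := h _ (List.getElem_mem hi)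
    simp [Gate.inputs] at hx
    omega
  · rw [formulaGates_clause pol n cls hi, Option.some.injEq] at hg
    rw [← hg] at hx
    have := h _ (List.getElem_mem hi)
    cases pol <;> cases hv : cls[i].2.2 <;>
      simp only [clauseGate, hv, cond_true, cond_false, Gate.inputs, List.mem_cons,
        List.not_mem_nil, or_false] at hx <;> omega
  · rw [formulaGates_out pol n cls, Option.some.injEq] at hg
    rw [← hg] at hx
    cases pol <;> simp [outGate, Gate.inputs] at hx <;> omega

end Formula

/-- The formula that expresses that all clauses hold if `pol` is true, and that some clause does
not hold otherwise. -/
def clauseCircuit (pol : Bool) (n₁ n₂ : ℕ) (cls : List Clause)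
    (h : ∀ c ∈ cls, c.1 < n₁ + n₂ ∧ c.2.1 < n₁ + n₂) : Circuit where
  n₁ := n₁
  n₂ := n₂
  gates := formulaGates pol (n₁ + n₂) cls
  out := n₁ + n₂ + 3 * cls.length
  inputs_lt := topoOrdered_formulaGates pol h
  out_lt := by rw [length_formulaGates]; omega

namespace Circuit

lemma nodeVal_of_getElem? (C : Circuit) (a : Fin C.n₁ → Bool) (b : Fin C.n₂ → Bool) {j : ℕ}
    {g : Gate} (h : C.gates[j]? = some g) :
    C.nodeVal a b (C.n₁ + C.n₂ + j) = g.eval (C.nodeVal a b) := by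
  obtain ⟨hj, rfl⟩ := List.getElem?_eq_some_iff.1 h
  exact C.nodeVal_gate a b hj

lemma gateAt_of_getElem? (C : Circuit) {j : ℕ} {g : Gate} (h : C.gates[j]? = some g) :
    C.gateAt (C.n₁ + C.n₂ + j) = some g := by
  rw [gateAt, if_neg (by omega), Nat.add_sub_cancel_left, h]

end Circuit

section ClauseCircuit

variable {pol : Bool} {n₁ n₂ : ℕ} {cls : List Clause}
  {h : ∀ c ∈ cls, c.1 < n₁ + n₂ ∧ c.2.1 < n₁ + n₂}

/-- The function `f` is any extension of the two assignments to all indices; the clauses only read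
it at variables. -/
lemma clauseCircuit_eval (a : Fin n₁ → Bool) (b : Fin n₂ → Bool) (f : ℕ → Bool)
    (hf₁ : ∀ (i : ℕ) (hi : i < n₁), f i = a ⟨i, hi⟩)
    (hf₂ : ∀ (i : ℕ) (hi : i < n₂), f (n₁ + i) = b ⟨i, hi⟩) :
    (clauseCircuit pol n₁ n₂ cls h).eval a b = true ↔
      (if pol then ∀ c ∈ cls, c.Holds f else ¬ ∀ c ∈ cls, c.Holds f) := by
  set C := clauseCircuit pol n₁ n₂ cls h with hC
  have hvar : ∀ x < n₁ + n₂, C.nodeVal a b x = f x := by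
    intro x hx
    by_cases h' : x < n₁
    · rw [hf₁ x h']; exact C.nodeVal_left a b h'
    · obtain ⟨y, rfl⟩ : ∃ y, x = n₁ + y := ⟨x - n₁, by omega⟩
      rw [hf₂ y (by omega)]
      exact C.nodeVal_right a b (show y < n₂ by omega)
  have h1 : ∀ (i : ℕ) (hi : i < cls.length), C.nodeVal a b (n₁ + n₂ + i) = !(f cls[i].1) := by
    intro i hi
    refine (C.nodeVal_of_getElem? a b (formulaGates_fst pol _ cls hi)).trans ?_
    rw [Gate.eval, hvar _ (h _ (List.getElem_mem hi)).1]
  have h2 : ∀ (i : ℕ) (hi : i < cls.length),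
      C.nodeVal a b (n₁ + n₂ + cls.length + i) = !(f cls[i].2.1) := by
    intro i hi
    have := C.nodeVal_of_getElem? a b (formulaGates_snd pol _ cls hi)
    rw [← add_assoc] at this
    refine this.trans ?_
    rw [Gate.eval, hvar _ (h _ (List.getElem_mem hi)).2]
  have h3 : ∀ (i : ℕ) (hi : i < cls.length),
      C.nodeVal a b (n₁ + n₂ + 2 * cls.length + i) = true ↔
        (if pol then cls[i].Holds f else ¬ cls[i].Holds f) := by
    intro i hi
    have := C.nodeVal_of_getElem? a b (formulaGates_clause pol _ cls hi)
    rw [← add_assoc] at this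
    rw [show C.nodeVal a b (n₁ + n₂ + 2 * cls.length + i) = _ from this]
    have e1 := h1 i hi
    have e2 := h2 i hi
    have e3 := hvar _ (h _ (List.getElem_mem hi)).1
    have e4 := hvar _ (h _ (List.getElem_mem hi)).2
    unfold Clause.Holds
    cases pol <;> cases hv : cls[i].2.2 <;>
      simp only [clauseGate, hv, cond_true, cond_false, Gate.eval, List.any_cons, List.any_nil,
        List.all_cons, List.all_nil, e1, e2, e3, e4] <;>
      cases f cls[i].1 <;> cases f cls[i].2.1 <;> simp
  have h4 := C.nodeVal_of_getElem? a b (formulaGates_out pol _ cls)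
  change C.nodeVal a b (C.n₁ + C.n₂ + 3 * cls.length) = true ↔ _
  rw [h4]
  cases pol with
  | true =>
    simp only [outGate, cond_true, Gate.eval, List.all_map, List.all_eq_true, List.mem_range,
      Function.comp, if_true] at h3 ⊢
    constructor
    · intro hh c hc
      obtain ⟨i, hi, rfl⟩ := List.mem_iff_getElem.1 hc
      exact (h3 i hi).1 (hh i hi)
    · exact fun hh i hi => (h3 i hi).2 (hh _ (List.getElem_mem hi))
  | false =>
    simp only [outGate, cond_false, Gate.eval, List.any_map, List.any_eq_true, List.mem_range,
      Function.comp, Bool.false_eq_true, if_false] at h3 ⊢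
    push Not
    constructor
    · rintro ⟨i, hi, hh⟩
      exact ⟨_, List.getElem_mem hi, (h3 i hi).1 hh⟩
    · rintro ⟨c, hc, hh⟩
      obtain ⟨i, hi, rfl⟩ := List.mem_iff_getElem.1 hc
      exact ⟨i, hi, (h3 i hi).2 hh⟩

/-- The nodes at gates that feed the gate for a clause. -/
def clauseNodes (pol : Bool) (n L : ℕ) (x : Clause × ℕ) : List ℕ :=
  (bif pol then [n + x.2] else []) ++ bif pol == x.1.2.2 then [] else [n + L + x.2]

/-- Every clause has two negation gates of its own, so no gate is shared; those that a clause does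
not need feed nothing. -/
lemma clauseCircuit_isFormula : (clauseCircuit pol n₁ n₂ cls h).IsFormula := by
  set n := n₁ + n₂
  set L := cls.length with hL
  have e1 : ((cls.map fun c => Gate.not c.1).flatMap Gate.inputs).filter (fun i => n ≤ i) = [] := by
    rw [List.filter_eq_nil_iff]
    intro x hx
    simp only [List.mem_flatMap, List.mem_map] at hx
    obtain ⟨g, ⟨c, hc, rfl⟩, hx⟩ := hx
    have := (h c hc).1
    simp [Gate.inputs] at hx ⊢
    omega
  have e2 : ((cls.map fun c => Gate.not c.2.1).flatMap Gate.inputs).filter (fun i => n ≤ i) =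
      [] := by
    rw [List.filter_eq_nil_iff]
    intro x hx
    simp only [List.mem_flatMap, List.mem_map] at hx
    obtain ⟨g, ⟨c, hc, rfl⟩, hx⟩ := hx
    have := (h c hc).2
    simp [Gate.inputs] at hx ⊢
    omega
  have e3 : ((cls.zipIdx.map fun x => clauseGate pol n L x).flatMap Gate.inputs).filter
      (fun i => n ≤ i) = cls.zipIdx.flatMap (clauseNodes pol n L) := by
    rw [List.flatMap_map, List.filter_flatMap]
    refine List.flatMap_congr fun x hx => ?_
    have h1 := (h _ (List.fst_mem_of_mem_zipIdx hx)).1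
    have h2 := (h _ (List.fst_mem_of_mem_zipIdx hx)).2
    obtain ⟨⟨y, z, v⟩, i⟩ := x
    simp only at h1 h2
    have h1' : ¬ n ≤ y := by omega
    have h2' : ¬ n ≤ z := by omega
    cases pol <;> cases v <;> simp [clauseGate, clauseNodes, Gate.inputs, h1', h2'] <;> omega
  have e4 : ([outGate pol n L].flatMap Gate.inputs).filter (fun i => n ≤ i) =
      (List.range L).map fun i => n + 2 * L + i := by
    have : (outGate pol n L).inputs = (List.range L).map fun i => n + 2 * L + i := by
      cases pol <;> rfl
    rw [List.flatMap_singleton, this, List.filter_eq_self]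
    intro x hx
    obtain ⟨i, -, rfl⟩ := List.mem_map.1 hx
    simp; omega
  change (((formulaGates pol n cls).flatMap Gate.inputs).filter fun i => n ≤ i).Nodup
  have hmem : ∀ x ∈ cls.zipIdx, ∀ y ∈ clauseNodes pol n L x, y = n + x.2 ∨ y = n + L + x.2 := by
    intro x _ y hy
    cases pol <;> cases hv : x.1.2.2 <;> simp [clauseNodes, hv] at hy <;> omega
  rw [formulaGates, List.flatMap_append, List.flatMap_append, List.flatMap_append,
    List.filter_append, List.filter_append, List.filter_append, e1, e2, e3, e4, List.nil_append,
    List.nil_append]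
  refine List.Nodup.append ?_ ?_ ?_
  · rw [List.nodup_flatMap]
    constructor
    · rintro x hx
      have := List.snd_lt_of_mem_zipIdx hx
      cases pol <;> cases hv : x.1.2.2 <;> simp [clauseNodes, hv] <;> omega
    · have h1 : (cls.zipIdx.map Prod.snd).Nodup := by
        rw [List.zipIdx_map_snd]; exact List.nodup_range'
      have h2 : cls.zipIdx.Pairwise fun x y => x.2 ≠ y.2 := List.pairwise_map.1 h1
      refine h2.imp_of_mem fun {x y} hx hy hxy => ?_
      intro z hzx hzy
      have h3 := List.snd_lt_of_mem_zipIdx hx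
      have h4 := List.snd_lt_of_mem_zipIdx hy
      have h5 := hmem x hx z hzx
      have h6 := hmem y hy z hzy
      omega
  · exact List.Nodup.map (fun i j hij => by simpa using hij) List.nodup_range
  · intro z hz hz'
    obtain ⟨x, hx, hz⟩ := List.mem_flatMap.1 hz
    obtain ⟨i, -, rfl⟩ := List.mem_map.1 hz'
    have h3 := List.snd_lt_of_mem_zipIdx hx
    have h5 := hmem x hx _ hz
    omega

lemma clauseCircuit_isLiteral {i : ℕ} (hi : i < cls.length) :
    (clauseCircuit pol n₁ n₂ cls h).IsLiteral (n₁ + n₂ + i) ∧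
    (clauseCircuit pol n₁ n₂ cls h).IsLiteral (n₁ + n₂ + cls.length + i) := by
  constructor
  · exact .inr ⟨_, (h _ (List.getElem_mem hi)).1,
      Circuit.gateAt_of_getElem? _ (formulaGates_fst pol _ cls hi)⟩
  · refine .inr ⟨_, (h _ (List.getElem_mem hi)).2, ?_⟩
    rw [add_assoc]
    exact Circuit.gateAt_of_getElem? _ (formulaGates_snd pol _ cls hi)

lemma clauseCircuit_mem_cnf {r : ℕ} (hr : 2 ≤ r) : clauseCircuit true n₁ n₂ cls h ∈ CNF r := by
  refine ⟨clauseCircuit_isFormula, _, Circuit.gateAt_of_getElem? _ (formulaGates_out _ _ cls), ?_⟩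
  intro j hj
  obtain ⟨i, hi, rfl⟩ := List.mem_map.1 hj
  rw [List.mem_range] at hi
  have hg := Circuit.gateAt_of_getElem? (clauseCircuit true n₁ n₂ cls h)
    (formulaGates_clause true _ cls hi)
  rw [← add_assoc] at hg
  refine ⟨_, hg, by simpa using hr, ?_⟩
  · intro x hx
    rcases List.mem_cons.1 hx with rfl | hx
    · exact (clauseCircuit_isLiteral hi).1
    · rw [List.mem_singleton] at hx
      subst hx
      cases hv : cls[i].2.2
      · exact (clauseCircuit_isLiteral hi).2
      · exact .inl (h _ (List.getElem_mem hi)).2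

lemma clauseCircuit_mem_dnf {r : ℕ} (hr : 2 ≤ r) : clauseCircuit false n₁ n₂ cls h ∈ DNF r := by
  refine ⟨clauseCircuit_isFormula, _, Circuit.gateAt_of_getElem? _ (formulaGates_out _ _ cls), ?_⟩
  intro j hj
  obtain ⟨i, hi, rfl⟩ := List.mem_map.1 hj
  rw [List.mem_range] at hi
  have hg := Circuit.gateAt_of_getElem? (clauseCircuit false n₁ n₂ cls h)
    (formulaGates_clause false _ cls hi)
  rw [← add_assoc] at hg
  refine ⟨_, hg, by simpa using hr, ?_⟩
  · intro x hx
    rcases List.mem_cons.1 hx with rfl | hx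
    · exact .inl (h _ (List.getElem_mem hi)).1
    · rw [List.mem_singleton] at hx
      subst hx
      cases hv : cls[i].2.2
      · exact .inl (h _ (List.getElem_mem hi)).2
      · exact (clauseCircuit_isLiteral hi).2

end ClauseCircuit

/-! ### Formulas of depth two have weft one -/

namespace Circuit

variable (C : Circuit)

lemma level_le_of_gateAt (δ : Gate → ℕ) {j B : ℕ} {g : Gate} (hg : C.gateAt j = some g)
    (hB : ∀ i ∈ g.inputs, (levels δ (C.n₁ + C.n₂) C.gates).getD i 0 ≤ B) :
    (levels δ (C.n₁ + C.n₂) C.gates).getD j 0 ≤ δ g + B := by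
  rw [gateAt] at hg
  split_ifs at hg with h
  obtain ⟨hj, rfl⟩ := List.getElem?_eq_some_iff.1 hg
  obtain ⟨i, rfl⟩ : ∃ i, j = C.n₁ + C.n₂ + i := ⟨j - (C.n₁ + C.n₂), by omega⟩
  simp only [Nat.add_sub_cancel_left] at hB ⊢
  rw [C.levels_getD_gate δ (by simpa using hj), levelStep]
  refine Nat.add_le_add_left (foldr_max_le fun x hx => ?_) _
  obtain ⟨i, hi, rfl⟩ := List.mem_map.1 hx
  exact hB i hi

lemma level_isLiteral (δ : Gate → ℕ) {j : ℕ} (hj : C.IsLiteral j) (B : ℕ)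
    (hB : ∀ i, δ (.not i) ≤ B) : (levels δ (C.n₁ + C.n₂) C.gates).getD j 0 ≤ B := by
  rcases hj with hj | ⟨i, hi, hg⟩
  · rw [C.levels_getD_var δ hj]; omega
  · refine (C.level_le_of_gateAt δ (B := 0) hg fun x hx => ?_).trans (hB i)
    simp only [Gate.inputs, List.mem_singleton] at hx
    rw [hx, C.levels_getD_var δ hi]

/-- The three levels are the output, the gates below it, and the negations. Only the output can have
fan-in above `s`. -/
lemma mem_weftOne_of_depth_two {s : ℕ} (hs : 1 ≤ s) {g : Gate} (hg : C.gateAt C.out = some g)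
    (h : ∀ j ∈ g.inputs, ∃ g', C.gateAt j = some g' ∧ g'.inputs.length ≤ s ∧
      ∀ i ∈ g'.inputs, C.IsLiteral i) : C ∈ WeftOne s 3 := by
  constructor
  · refine C.level_le_of_gateAt (fun _ => 1) (B := 2) hg fun j hj => ?_
    obtain ⟨g', hg', -, hl⟩ := h j hj
    exact C.level_le_of_gateAt (fun _ => 1) (B := 1) hg' fun i hi =>
      C.level_isLiteral _ (hl i hi) 1 fun _ => le_rfl
  · refine (C.level_le_of_gateAt (weftCost s) (B := 0) hg fun j hj => ?_).trans (weftCost_le s g)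
    obtain ⟨g', hg', hs', hl⟩ := h j hj
    refine (C.level_le_of_gateAt (weftCost s) (B := 0) hg' fun i hi => ?_).trans ?_
    · refine C.level_isLiteral _ (hl i hi) 0 fun i => ?_
      rw [weftCost_eq, if_neg (by simp [Gate.inputs]; omega)]
    · rw [weftCost_eq, if_neg (by omega)]

end Circuit

lemma cnf_subset_weftOne {r s : ℕ} (hrs : r ≤ s) (hs : 1 ≤ s) : CNF r ⊆ WeftOne s 3 := by
  rintro C ⟨-, l, hl, h⟩
  refine C.mem_weftOne_of_depth_two hs hl fun j hj => ?_
  obtain ⟨c, hc, hcr, hci⟩ := h j hj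
  exact ⟨_, hc, hcr.trans hrs, hci⟩

lemma dnf_subset_weftOne {r s : ℕ} (hrs : r ≤ s) (hs : 1 ≤ s) : DNF r ⊆ WeftOne s 3 := by
  rintro C ⟨-, l, hl, h⟩
  refine C.mem_weftOne_of_depth_two hs hl fun j hj => ?_
  obtain ⟨c, hc, hcr, hci⟩ := h j hj
  exact ⟨_, hc, hcr.trans hrs, hci⟩

/-! ### Polynomial-time reductions -/

/-- A reduction computable in polynomial time, with a polynomial bound on the parameter. -/
def PolyReducible (L L' : ParamProblem) : Prop :=
  ∃ R : Inst L.alphabet → Inst L'.alphabet, (∀ x, x ∈ L.yes ↔ R x ∈ L'.yes) ∧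
    (∃ c, ∀ x, (R x).2 ≤ (x.2 + 1) ^ c) ∧ PolyTime R

lemma computable_pow_const {f : ℕ → ℕ} (hf : Computable f) (c : ℕ) :
    Computable fun k => f k ^ c := by
  induction c with
  | zero => simpa using Computable.const 1
  | succ c ih =>
    simp only [pow_succ]
    exact Primrec.nat_mul.to_comp.comp ih hf

lemma computable_add_const {f : ℕ → ℕ} (hf : Computable f) (c : ℕ) :
    Computable fun k => f k + c :=
  Primrec.nat_add.to_comp.comp hf (Computable.const c)

lemma computable_const_mul {f : ℕ → ℕ} (hf : Computable f) (c : ℕ) :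
    Computable fun k => c * f k :=
  Primrec.nat_mul.to_comp.comp (Computable.const c) hf

/-- The bound is a product of a factor in the parameter and one in the length, so any power of it
has the form `f k * (|I| + 1) ^ c`. -/
lemma esize_inst_le {m : ℕ} (x : Inst m) :
    esize x + 1 ≤ (2 * x.2 + (2 * m + 5)) * (x.1.length + 1) := by
  obtain ⟨l, k⟩ := x
  have h1 : esize l ≤ l.length * (2 * m + 1 + 1) + 1 := by
    refine esize_list_le l _ fun a _ => ?_
    have h2 : esize a = esize a.val := rfl
    have := a.2
    rw [h2, esize_nat]
    omega
  rw [esize_prod, esize_nat]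
  simp only
  nlinarith

lemma PolyReducible.fptReducible {L L' : ParamProblem} (h : PolyReducible L L') :
    FptReducible L L' := by
  obtain ⟨R, hR, ⟨d, hd⟩, p, T, ⟨c, hc⟩, hp⟩ := h
  refine ⟨R, hR, ⟨_, computable_pow_const (computable_add_const Computable.id 1) d, hd⟩, p,
    fun k => (2 * k + (2 * L.alphabet + 5)) ^ c, c,
    computable_pow_const (computable_add_const (computable_const_mul Computable.id 2) _) c, fun x => ?_⟩
  obtain ⟨t, ht, hr⟩ := hp x
  refine ⟨t, (ht.trans (hc x)).trans ?_, hr⟩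
  rw [← mul_pow]
  exact Nat.pow_le_pow_left (esize_inst_le x) c

/-- The first running time bounds the size of the intermediate instance, and a polynomial in an fpt
bound is an fpt bound. The exponent `c + 1` dominates both running times, whence the factor 2. -/
lemma FptReducible.trans_poly {L L' L'' : ParamProblem} (h : FptReducible L L')
    (h' : PolyReducible L' L'') : FptReducible L L'' := by
  obtain ⟨R, hR, ⟨g, hg, hgk⟩, p, f, e, hf, hp⟩ := h
  obtain ⟨S, hS, ⟨d, hd⟩, q, T, ⟨c, hc⟩, hq⟩ := h'
  refine ⟨fun x => S (R x), fun x => (hR x).trans (hS _), ⟨fun k => (g k + 1) ^ d,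
    computable_pow_const (computable_add_const hg 1) d, fun x => (hd _).trans
      (Nat.pow_le_pow_left (by have := hgk x; omega) d)⟩, .comp p q,
    fun k => 2 * (f k + 1) ^ (c + 1), e * (c + 1),
    computable_const_mul (computable_pow_const (computable_add_const hf 1) _) 2, fun x => ?_⟩
  obtain ⟨t, ht, hr⟩ := hp x
  obtain ⟨u, hu, hr'⟩ := hq (R x)
  refine ⟨t + u, ?_, .comp hr hr'⟩
  have h1 : esize (R x) ≤ t := hr.size_le
  have h2 : u ≤ (t + 1) ^ c := (hu.trans (hc _)).trans (Nat.pow_le_pow_left (by omega) c)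
  have h3 : t + 1 ≤ (f x.2 + 1) * (x.1.length + 1) ^ e := by
    have := Nat.one_le_pow e (x.1.length + 1) (by omega)
    rw [add_mul]
    omega
  have h4 := Nat.pow_le_pow_left h3 (c + 1)
  rw [mul_pow, ← pow_mul] at h4
  have h5 : (t + 1) ^ c ≤ (t + 1) ^ (c + 1) := Nat.pow_le_pow_right (by omega) (by omega)
  have h6 : t + 1 ≤ (t + 1) ^ (c + 1) := Nat.le_self_pow (by omega) _
  rw [mul_assoc]
  omega

/-- The components of the formula for a circuit, a value and a parameter. -/
def targetRaw (pol : Bool) (s u : ℕ) (v : Bool) (r : Raw) (k : ℕ) : Raw :=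
  (numUniversal (s ^ u) r, (choices s u v r k).length,
    formulaGates pol (numUniversal (s ^ u) r + (choices s u v r k).length)
      (targetClauses s u v r k),
    numUniversal (s ^ u) r + (choices s u v r k).length + 3 * (targetClauses s u v r k).length)

section PolyTime

variable {α : Type} [Enc α]

@[fun_prop]
lemma PolyTime.targetClauses (s u : ℕ) (v : Bool) {r : α → Raw} {k : α → ℕ} (hr : PolyTime r)
    (hk : PolyTime k) : PolyTime fun a => targetClauses s u v (r a) (k a) := by
  unfold ParamComplexity.targetClauses; fun_prop

@[fun_prop]
lemma PolyTime.formulaGates (pol : Bool) {n : α → ℕ} {cls : α → List Clause} (hn : PolyTime n)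
    (hc : PolyTime cls) : PolyTime fun a => formulaGates pol (n a) (cls a) := by
  unfold ParamComplexity.formulaGates clauseGate outGate; fun_prop

@[fun_prop]
lemma PolyTime.targetRaw (pol : Bool) (s u : ℕ) (v : Bool) {r : α → Raw} {k : α → ℕ}
    (hr : PolyTime r) (hk : PolyTime k) : PolyTime fun a => targetRaw pol s u v (r a) (k a) := by
  unfold ParamComplexity.targetRaw; fun_prop

end PolyTime

namespace Circuit

variable (C : Circuit) (pol : Bool) (s u : ℕ) (v : Bool) (k : ℕ)

/-- The formula for a circuit, a value and a parameter. -/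
def target : Circuit :=
  clauseCircuit pol (numUniversal (s ^ u) C.raw) (choices s u v C.raw k).length
    (targetClauses s u v C.raw k) fun _ hc => C.targetClauses_lt hc

variable {C s u v k}

/-- This passes between assignments on `ℕ` and assignments on the first block of the formula; only
values below `numUniversal` matter. -/
lemma target_true (hs : 1 ≤ s) (hC : C ∈ WeftOne s u) :
    (∀ a, ∃ b : Fin (C.target true s u v k).n₂ → Bool, weight b = (blocks (s ^ u) k).length ∧
      (C.target true s u v k).eval a b = true) ↔
      ∀ a, ∃ b : Fin C.n₂ → Bool, weight b = k ∧ C.eval a b = v := by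
  rw [C.forall_exists_iff_clauses hs hC]
  constructor
  · intro h α
    obtain ⟨b, hb, hv⟩ := h fun i => α i
    refine ⟨b, hb, ?_⟩
    exact (clauseCircuit_eval _ _ _ (fun i hi => glue_left _ _ hi)
      (fun i hi => glue_right _ _ ⟨i, hi⟩)).1 hv
  · intro h a
    obtain ⟨b, hb, hv⟩ := h fun i => if hi : i < (C.target true s u v k).n₁ then a ⟨i, hi⟩ else false
    refine ⟨b, hb, (clauseCircuit_eval a b _ (fun i hi => ?_)
      (fun i hi => glue_right _ _ ⟨i, hi⟩)).2 hv⟩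
    rw [glue_left _ _ hi]
    exact dif_pos hi

/-- This is the negation of the equivalence for the clauses: the formula with negative polarity says
that some clause fails. -/
lemma target_false (hs : 1 ≤ s) (hC : C ∈ WeftOne s u) :
    (∃ a, ∀ b : Fin (C.target false s u v k).n₂ → Bool, weight b = (blocks (s ^ u) k).length →
      (C.target false s u v k).eval a b = true) ↔
      ∃ a, ∀ b : Fin C.n₂ → Bool, weight b = k → C.eval a b ≠ v := by
  have h := C.forall_exists_iff_clauses (k := k) (v := v) hs hC
  have h' := not_congr h
  push Not at h'
  rw [h']
  constructor
  · rintro ⟨a, ha⟩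
    refine ⟨fun i => if hi : i < (C.target false s u v k).n₁ then a ⟨i, hi⟩ else false,
      fun b hb => ?_⟩
    have := (clauseCircuit_eval a b (glue _ (fun i =>
      if hi : i < (C.target false s u v k).n₁ then a ⟨i, hi⟩ else false) b)
      (fun i hi => by rw [glue_left _ _ hi]; exact dif_pos hi)
      (fun i hi => glue_right _ _ ⟨i, hi⟩)).1 (ha b hb)
    rw [if_neg Bool.false_ne_true] at this
    push Not at this
    exact this
  · rintro ⟨α, hα⟩
    refine ⟨fun i => α i, fun b hb => ?_⟩
    refine (clauseCircuit_eval _ _ (glue _ α b) (fun i hi => glue_left _ _ hi)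
      (fun i hi => glue_right _ _ ⟨i, hi⟩)).2 ?_
    rw [if_neg Bool.false_ne_true]
    push Not
    exact hα b hb

end Circuit

/-- The reduction: the formula for circuits that pass the test, and `d` for all other inputs. -/
def reduction (chk : Raw → Bool) (pol : Bool) (s u : ℕ) (v : Bool) (d : Inst 2) (x : Inst 2) :
    Inst 2 :=
  bif isCode x.1 && chk (Raw.decode x.1) then
    ((enc (targetRaw pol s u v (Raw.decode x.1) x.2)).bits, (blocks (s ^ u) x.2).length)
  else d

section Reduction

variable {chk : Raw → Bool} {pol : Bool} {s u : ℕ} {v : Bool} {d : Inst 2}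

lemma PolyTime.reduction (h : PolyTime chk) : PolyTime (reduction chk pol s u v d) := by
  unfold ParamComplexity.reduction
  fun_prop

lemma reduction_param_le (hd : d.2 = 0) (x : Inst 2) :
    (reduction chk pol s u v d x).2 ≤ (x.2 + 1) ^ s ^ u := by
  unfold reduction
  cases isCode x.1 && chk (Raw.decode x.1)
  · simp [hd]
  · simp [blocks, length_tuples]

lemma reduction_code {C : Circuit} (h : chk C.raw = true) (k : ℕ) :
    reduction chk pol s u v d (C.code, k) =
      ((C.target pol s u v k).code, (blocks (s ^ u) k).length) := by
  have h1 : isCode C.code = true := (isCode_iff _).2 ⟨C, rfl⟩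
  simp only [reduction, h1, Raw.decode_code, h, Bool.and_self, cond_true]
  rfl

lemma reduction_other {𝒞 : Set Circuit} (hchk : ∀ C : Circuit, chk C.raw = true ↔ C ∈ 𝒞)
    {x : Inst 2} (h : ¬ ∃ C ∈ 𝒞, x.1 = C.code) : reduction chk pol s u v d x = d := by
  have : (isCode x.1 && chk (Raw.decode x.1)) = false := by
    rw [← Bool.not_eq_true, Bool.and_eq_true, isCode_iff]
    rintro ⟨⟨C, hC⟩, h'⟩
    rw [hC, Raw.decode_code, hchk] at h'
    exact h ⟨C, h', hC⟩
  rw [reduction, this]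
  rfl

lemma mem_iff_reduction_mem {𝒞 : Set Circuit} {A B : Set (Inst 2)}
    (hchk : ∀ C : Circuit, chk C.raw = true ↔ C ∈ 𝒞)
    (hcode : ∀ C ∈ 𝒞, ∀ k, (C.code, k) ∈ A ↔
      ((C.target pol s u v k).code, (blocks (s ^ u) k).length) ∈ B)
    (hother : ∀ x : Inst 2, (¬ ∃ C ∈ 𝒞, x.1 = C.code) → (x ∈ A ↔ d ∈ B)) (x : Inst 2) :
    x ∈ A ↔ reduction chk pol s u v d x ∈ B := by
  by_cases h : ∃ C ∈ 𝒞, x.1 = C.code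
  · obtain ⟨C, hC, hx⟩ := h
    obtain ⟨l, k⟩ := x
    obtain rfl : l = C.code := hx
    rw [reduction_code ((hchk C).2 hC)]
    exact hcode C hC k
  · rw [reduction_other hchk h]
    exact hother x h

end Reduction

/-! ### The reductions between the satisfiability problems -/

lemma mem_aewSat_code {𝒞 : Set Circuit} {C : Circuit} {k : ℕ} :
    ((C.code, k) : Inst 2) ∈ (AEWSat 𝒞).yes ↔
      C ∈ 𝒞 ∧ ∀ a, ∃ b : Fin C.n₂ → Bool, weight b = k ∧ C.eval a b = true := by
  constructor
  · rintro ⟨D, hD, h, h'⟩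
    obtain rfl := Circuit.code_injective h
    exact ⟨hD, h'⟩
  · rintro ⟨hC, h⟩
    exact ⟨C, hC, rfl, h⟩

lemma mem_eawSat_code {𝒞 : Set Circuit} {C : Circuit} {k : ℕ} :
    ((C.code, k) : Inst 2) ∈ (EAWSat 𝒞).yes ↔
      C ∈ 𝒞 ∧ ∃ a, ∀ b : Fin C.n₂ → Bool, weight b = k → C.eval a b = true := by
  constructor
  · rintro ⟨D, hD, h, h'⟩
    obtain rfl := Circuit.code_injective h
    exact ⟨hD, h'⟩
  · rintro ⟨hC, h⟩
    exact ⟨C, hC, rfl, h⟩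

/-- The empty string is therefore a no-instance of all these problems and can serve as image of
inputs that are not admissible codes. -/
lemma Circuit.code_ne_nil (C : Circuit) : C.code ≠ [] := by
  simp [Circuit.code, Data.bits]

/-- A formula without clauses, which is true. -/
def trueCircuit : Circuit := clauseCircuit true 0 0 [] (by simp)

lemma trueCircuit_eval (a : Fin 0 → Bool) (b : Fin 0 → Bool) : trueCircuit.eval a b = true :=
  (clauseCircuit_eval a b (fun _ => false) (fun _ hi => absurd hi (by omega))
    (fun _ hi => absurd hi (by omega))).2 (by simp)

section Reductions

variable {𝒞 𝒟 : Set Circuit} {chk : Raw → Bool} {s u : ℕ}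

/-- Circuits of weft one reduce to formulas in 2-CNF. -/
lemma aewSat_reducible_aewSat (hpoly : PolyTime chk)
    (hchk : ∀ C : Circuit, chk C.raw = true ↔ C ∈ 𝒞) (hs : 1 ≤ s) (h𝒞 : 𝒞 ⊆ WeftOne s u)
    (h𝒟 : CNF 2 ⊆ 𝒟) : PolyReducible (AEWSat 𝒞) (AEWSat 𝒟) := by
  refine ⟨reduction chk true s u true ([], 0), mem_iff_reduction_mem hchk (fun C hC k => ?_) (fun x h => ?_),
    ⟨_, reduction_param_le rfl⟩, .reduction hpoly⟩
  · refine mem_aewSat_code.trans (Iff.trans ?_ mem_aewSat_code.symm)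
    rw [Circuit.target_true hs (h𝒞 hC)]
    exact and_congr_left fun _ => iff_of_true hC (h𝒟 (clauseCircuit_mem_cnf le_rfl))
  · refine iff_of_false ?_ ?_
    · rintro ⟨C, hC, h', -⟩
      exact h ⟨C, hC, h'⟩
    · rintro ⟨C, hC, h', -⟩
      exact C.code_ne_nil h'.symm

/-- The complement asks for an assignment under which no weighted one makes the circuit true, which
is `target_false` for `v = true`. Inputs that code no circuit of the class are yes-instances of the
complement and go to a true formula with parameter 0. -/
lemma compl_aewSat_reducible_eawSat (hpoly : PolyTime chk)
    (hchk : ∀ C : Circuit, chk C.raw = true ↔ C ∈ 𝒞) (hs : 1 ≤ s) (h𝒞 : 𝒞 ⊆ WeftOne s u)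
    (h𝒟 : DNF 2 ⊆ 𝒟) (h𝒟' : CNF 2 ⊆ 𝒟) : PolyReducible (AEWSat 𝒞).compl (EAWSat 𝒟) := by
  refine ⟨reduction chk false s u true (trueCircuit.code, 0), mem_iff_reduction_mem hchk (fun C hC k => ?_) (fun x h => ?_),
    ⟨_, reduction_param_le rfl⟩, .reduction hpoly⟩
  · refine (not_congr mem_aewSat_code).trans (Iff.trans ?_ mem_eawSat_code.symm)
    rw [Circuit.target_false hs (h𝒞 hC)]
    have := h𝒟 (clauseCircuit_mem_dnf (n₁ := numUniversal (s ^ u) C.raw) le_rfl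
      (h := fun _ hc => C.targetClauses_lt (v := true) (k := k) hc))
    constructor
    · intro hn
      refine ⟨this, ?_⟩
      by_contra hcon
      push Not at hcon
      exact hn ⟨hC, hcon⟩
    · rintro ⟨-, a, ha⟩ ⟨-, h'⟩
      obtain ⟨b, hb, hb'⟩ := h' a
      exact ha b hb hb'
  · refine iff_of_true ?_ ?_
    · rintro ⟨C, hC, h', -⟩
      exact h ⟨C, hC, h'⟩
    · exact mem_eawSat_code.2 ⟨h𝒟' (clauseCircuit_mem_cnf le_rfl), fun _ => false,
        fun b _ => trueCircuit_eval _ b⟩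

/-- The complement asks, for every assignment to the first block, for a weighted one that makes the
circuit false; this is `target_true` for `v = false`. -/
lemma compl_eawSat_reducible_aewSat (hpoly : PolyTime chk)
    (hchk : ∀ C : Circuit, chk C.raw = true ↔ C ∈ 𝒞) (hs : 1 ≤ s) (h𝒞 : 𝒞 ⊆ WeftOne s u)
    (h𝒟 : CNF 2 ⊆ 𝒟) : PolyReducible (EAWSat 𝒞).compl (AEWSat 𝒟) := by
  refine ⟨reduction chk true s u false (trueCircuit.code, 0), mem_iff_reduction_mem hchk (fun C hC k => ?_) (fun x h => ?_),
    ⟨_, reduction_param_le rfl⟩, .reduction hpoly⟩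
  · refine (not_congr mem_eawSat_code).trans (Iff.trans ?_ mem_aewSat_code.symm)
    rw [Circuit.target_true hs (h𝒞 hC)]
    have := h𝒟 (clauseCircuit_mem_cnf (n₁ := numUniversal (s ^ u) C.raw) le_rfl
      (h := fun _ hc => C.targetClauses_lt (v := false) (k := k) hc))
    constructor
    · intro hn
      refine ⟨this, ?_⟩
      by_contra hcon
      push Not at hcon
      exact hn ⟨hC, by simpa using hcon⟩
    · rintro ⟨-, h'⟩ ⟨-, a, ha⟩
      obtain ⟨b, hb, hb'⟩ := h' a
      simp [ha b hb] at hb'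
  · refine iff_of_true ?_ ?_
    · rintro ⟨C, hC, h', -⟩
      exact h ⟨C, hC, h'⟩
    · exact mem_aewSat_code.2 ⟨h𝒟 (clauseCircuit_mem_cnf le_rfl), fun a =>
        ⟨fun _ => false, by simp [weight], trueCircuit_eval a _⟩⟩

/-- Circuits of weft one reduce to formulas in 2-DNF. -/
lemma eawSat_reducible_eawSat (hpoly : PolyTime chk)
    (hchk : ∀ C : Circuit, chk C.raw = true ↔ C ∈ 𝒞) (hs : 1 ≤ s) (h𝒞 : 𝒞 ⊆ WeftOne s u)
    (h𝒟 : DNF 2 ⊆ 𝒟) : PolyReducible (EAWSat 𝒞) (EAWSat 𝒟) := by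
  -- Two negations: the value sought is false, and the formula states that the clauses fail.
  refine ⟨reduction chk false s u false ([], 0), mem_iff_reduction_mem hchk (fun C hC k => ?_) (fun x h => ?_),
    ⟨_, reduction_param_le rfl⟩, .reduction hpoly⟩
  · refine mem_eawSat_code.trans (Iff.trans ?_ mem_eawSat_code.symm)
    rw [Circuit.target_false hs (h𝒞 hC)]
    simp only [ne_eq, Bool.not_eq_false]
    exact and_congr_left fun _ => iff_of_true hC (h𝒟 (clauseCircuit_mem_dnf le_rfl))
  · refine iff_of_false ?_ ?_
    · rintro ⟨C, hC, h', -⟩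
      exact h ⟨C, hC, h'⟩
    · rintro ⟨C, hC, h', -⟩
      exact C.code_ne_nil h'.symm

end Reductions

/-! ### The three claims -/

lemma cnf_mono {r s : ℕ} (h : r ≤ s) : CNF r ⊆ CNF s := by
  rintro C ⟨hf, l, hl, h'⟩
  refine ⟨hf, l, hl, fun j hj => ?_⟩
  obtain ⟨c, hc, hr, hi⟩ := h' j hj
  exact ⟨c, hc, hr.trans h, hi⟩

lemma dnf_mono {r s : ℕ} (h : r ≤ s) : DNF r ⊆ DNF s := by
  rintro C ⟨hf, l, hl, h'⟩
  refine ⟨hf, l, hl, fun j hj => ?_⟩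
  obtain ⟨c, hc, hr, hi⟩ := h' j hj
  exact ⟨c, hc, hr.trans h, hi⟩

/-- The same map serves, since a reduction preserves non-membership as well. -/
lemma FptReducible.compl_left {L L' : ParamProblem} (h : FptReducible L.compl L') :
    FptReducible L L'.compl := by
  obtain ⟨R, hR, hg, hp⟩ := h
  exact ⟨R, fun x => by
    have := hR x
    change x ∈ L.yes ↔ ¬ R x ∈ L'.yes
    rw [← this]
    exact not_not.symm, hg, hp⟩

/-- Width two is enough, and `2 ≤ 2 ^ u + 1`. -/
theorem fptReducible_aewSat_cnf (u : ℕ) :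
    FptReducible (AEWSat (Gam 1 u)) (AEWSat (CNF (2 ^ u + 1))) := by
  rw [gam_one_eq]
  refine (aewSat_reducible_aewSat (chk := Raw.isWeftOne 2 u) (by fun_prop)
    (Raw.isWeftOne_iff 2 u) (by omega) le_rfl (cnf_mono ?_)).fptReducible
  have := Nat.one_le_pow u 2 (by omega)
  omega

/-- For membership the complement is reduced to 2-DNF formulas, which have depth at most 3 and weft
at most one. For hardness, the reduction that places the complement of a problem in `EAW 1` is
complemented and composed with the reduction to 2-CNF. -/
theorem isFptComplete_aewSat_cnf : IsFptComplete (AEW 1) (AEWSat (CNF 2)) := by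
  constructor
  · refine ⟨_, ⟨3, by omega, rfl⟩, PolyReducible.fptReducible ?_⟩
    rw [gam_one_eq]
    exact compl_aewSat_reducible_eawSat (chk := Raw.isNF 0 1 2) (by fun_prop)
      (fun C => isNF_cnf_iff C 2) (by omega) (cnf_subset_weftOne (s := 2) le_rfl (by omega))
      (dnf_subset_weftOne le_rfl (by omega)) (cnf_subset_weftOne le_rfl (by omega))
  · rintro L ⟨_, ⟨u, -, rfl⟩, h⟩
    rw [gam_one_eq] at h
    exact h.compl_left.trans_poly (compl_eawSat_reducible_aewSat (chk := Raw.isWeftOne 2 u)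
      (by fun_prop) (Raw.isWeftOne_iff 2 u) (by omega) le_rfl le_rfl)

/-- For membership, gates count as large only above fan-in `r`, so `r`-DNF formulas have weft one.
The images are 2-DNF formulas, which lie in `Gam 1 3` with its threshold 2. -/
theorem isFptComplete_eawSat_dnf {r : ℕ} (hr : 2 ≤ r) :
    IsFptComplete (EAW 1) (EAWSat (DNF r)) := by
  constructor
  · refine ⟨_, ⟨3, by omega, rfl⟩, PolyReducible.fptReducible ?_⟩
    rw [gam_one_eq]
    exact eawSat_reducible_eawSat (chk := Raw.isNF 1 0 r) (by fun_prop)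
      (fun C => isNF_dnf_iff C r) (by omega) (dnf_subset_weftOne (s := r) le_rfl (by omega))
      (dnf_subset_weftOne le_rfl (by omega))
  · rintro L ⟨_, ⟨u, -, rfl⟩, h⟩
    rw [gam_one_eq] at h
    exact h.trans_poly (eawSat_reducible_eawSat (chk := Raw.isWeftOne 2 u)
      (by fun_prop) (Raw.isWeftOne_iff 2 u) (by omega) le_rfl (dnf_mono hr))

end ParamComplexity

open ParamComplexity
theorem mainTheorem7 :
    (∀ u : ℕ, 1 ≤ u → FptReducible (AEWSat (Gam 1 u)) (AEWSat (CNF (2 ^ u + 1)))) ∧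
    IsFptComplete (AEW 1) (AEWSat (CNF 2)) ∧
    (∀ r : ℕ, 2 ≤ r → IsFptComplete (EAW 1) (EAWSat (DNF r))) :=
  ⟨fun u _ => fptReducible_aewSat_cnf u, isFptComplete_aewSat_cnf,
    fun _ hr => isFptComplete_eawSat_dnf hr⟩
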